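/- Let $\mathbb H=\{z\in\mathbb C:\operatorname{Im} z>0\}$, let $a>0$, let $V:[0,\infty)\to\mathbb R$ be continuous, and let $\gamma:[0,\infty)\to\overline{\mathbb H}$ be a continuous curve generated by the chordal Loewner chain $(g_t)$ driven by $V$. That is, writing $H_t$ for the unbounded connected component of $\mathbb H\setminus\gamma[0,t]$, the map $g_t$ is the conformal map of $H_t$ onto $\mathbb H$ with $g_t(z)=z+at/z+O(|z|^{-2})$ as $z\to\infty$, one has $\partial_t g_t(z)=a/(g_t(z)-V_t)$, $g_0(z)=z$, and, with $f_t=g_t^{-1}$ and $\hat f_t(z)=f_t(z+V_t)$, $\gamma(t)=\lim_{y\to0+}\hat f_t(iy)$ for every $t\ge 0$. (The curve may have double points and may touch the real line.) A subpower function is a continuous nondecreasing $\psi:[0,\infty)\to(0,\infty)$ with $x^{-u}\psi(x)\to0$ as $x\to\infty$ for all $u>0$. For positive functions $F,G$ that tend to $0$ at $0+$, write $F(y)\approx^* G(y)$ if there is a subpower function $\psi$ with $\psi(1/y)^{-1}G(y)\le F(y)\le\psi(1/y)G(y)$ for all sufficiently small $y>0$. For $\beta\in[-1,1)$ put $$\Theta_\beta=\{t\in(0,2]:\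 y\,|\hat f_t'(iy)|\approx^* y^{1-\beta},\ y\to0+\}.$$ For $t>0$ regard the tip $\gamma(t)$ as the prime end of $H_t$ that corresponds to $V_t$ under $g_t$. For $\varepsilon>0$ let $B$ be the open disk of radius $\varepsilon$ about $\gamma(t)$, and let $O$ be the connected component of $B\cap H_t$ that has the prime end $\gamma(t)$ on its boundary (it contains $\hat f_t(iy)$ for all small $y>0$). Let $\sigma_{t,\varepsilon}$ be the connected component (an open arc) of $\partial B\cap H_t$ that is contained in $\partial O$, is such that every curve in $H_t$ from the prime end $\gamma(t)$ to infinity passes through it, and separates every other such arc from infinity in $H_t$. Let $x_-<V_t<x_+$ be the images of the endpoints of $\sigma_{t,\varepsilon}$ under $g_t$, i.e. the limits of $g_t$ along the two ends of $\sigma_{t,\varepsilon}$, and let $E_{t,\varepsilon}$ be the set of prime ends of $H_t$ that correspond to $[x_-,x_+]$ under $g_t$. Let $\mathrm{hm}_{t,z}$ be harmonic measure on the prime ends of $H_t$ seen from $z\in H_t$, let $\mathrm{hm}_t(A)=\lim_{y\to\infty}y\,\mathrm{hm}_{t,iy}(A)$ be normalized harmonic measure from infinity, and put $\mu(t,\varepsilon)=\mathrm{hm}_t[E_{t,\varepsilon}]$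 (which equals $(x_+-x_-)/\pi$). For $\alpha>0$ put $$\Theta^{\mathrm{hm}}_\alpha=\{t\in(0,2]:\ \mu(t,\varepsilon)\approx^*\varepsilon^{\alpha},\ \varepsilon\to0+\}.$$ Then, for every $\alpha$ with $1/2\le\alpha<\infty$, $$\Theta^{\mathrm{hm}}_\alpha=\Theta_{1-1/\alpha}.$$ -/

import Mathlib

open Filter Topology Set

noncomputable section

/-- A (positive) subpower function `ψ : [0, ∞) → (0, ∞)`: continuous, nondecreasing, and
`x ^ (-u) * ψ x → 0` as `x → ∞` for every `u > 0`. -/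
structure IsSubpower (ψ : ℝ → ℝ) : Prop where
  continuousOn : ContinuousOn ψ (Ici 0)
  monotoneOn : MonotoneOn ψ (Ici 0)
  pos : ∀ x, 0 ≤ x → 0 < ψ x
  decay : ∀ u : ℝ, 0 < u → Tendsto (fun x : ℝ => x ^ (-u) * ψ x) atTop (𝓝 0)

/-- `f(y) ≈ g(y)` as `y → 0+`, up to a subpower function:
`ψ(1/y)⁻¹ g(y) ≤ f(y) ≤ ψ(1/y) g(y)` for all small `y > 0`. -/
def SubpowerEquiv (f g : ℝ → ℝ) : Prop :=
  ∃ ψ : ℝ → ℝ, IsSubpower ψ ∧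
    ∀ᶠ y in 𝓝[>] (0 : ℝ), (ψ (1 / y))⁻¹ * g y ≤ f y ∧ f y ≤ ψ (1 / y) * g y

/-- The open upper half-plane. -/
def upperHalf : Set ℂ := {z : ℂ | 0 < z.im}

/-- The unbounded connected component `H_t` of the upper half-plane minus `γ[0, t]`. -/
def unboundedComponent (γ : ℝ → ℂ) (t : ℝ) : Set ℂ :=
  {z | z ∈ upperHalf \ γ '' Icc 0 t ∧
    ¬ Bornology.IsBounded (connectedComponentIn (upperHalf \ γ '' Icc 0 t) z)}

/-- A continuous curve `γ` generated by the chordal Loewner chain `(g_t)` with driving function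
`V` and rate `a > 0`.  The curve may have double points and may touch the real line. -/
structure LoewnerCurve where
  /-- the rate of growth of the half-plane capacity -/
  a : ℝ
  a_pos : 0 < a
  /-- the driving function `V_t`, `t ≥ 0` -/
  V : ℝ → ℝ
  continuousOn_V : ContinuousOn V (Ici 0)
  /-- the curve `γ(t)`, `t ≥ 0` -/
  γ : ℝ → ℂ
  continuousOn_γ : ContinuousOn γ (Ici 0)
  /-- the conformal maps `g_t : H_t → ℍ` (only the values on `H_t` matter) -/
  g : ℝ → ℂ → ℂ
  differentiableOn_g : ∀ t, 0 ≤ t → DifferentiableOn ℂ (g t) (unboundedComponent γ t)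
  bijOn_g : ∀ t, 0 ≤ t → BijOn (g t) (unboundedComponent γ t) upperHalf
  /-- `g_t(z) = z + a t / z + O(|z|⁻²)` as `z → ∞` -/
  expansion_g : ∀ t, 0 ≤ t →
    (fun z : ℂ => g t z - z - (a * t : ℝ) / z)
      =O[Bornology.cobounded ℂ ⊓ 𝓟 (unboundedComponent γ t)] (fun z : ℂ => ‖z‖ ^ (-2 : ℤ))
  g_zero : ∀ z ∈ unboundedComponent γ 0, g 0 z = z
  /-- the chordal Loewner equation `∂_t g_t(z) = a / (g_t(z) - V_t)` -/
  loewner : ∀ t, 0 ≤ t → ∀ z ∈ unboundedComponent γ t,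
    HasDerivWithinAt (fun s => g s z) ((a : ℂ) / (g t z - V t)) (Ici 0) t
  /-- `γ(t) = lim_{y → 0+} g_t⁻¹(V_t + i y)` -/
  tip : ∀ t, 0 ≤ t →
    Tendsto
      (fun y : ℝ => Function.invFunOn (g t) (unboundedComponent γ t) (V t + y * Complex.I))
      (𝓝[>] 0) (𝓝 (γ t))

/-- Continuous subharmonic functions on an open set `D ⊆ ℂ`. -/
def IsSubharmonicOn (u : ℂ → ℝ) (D : Set ℂ) : Prop :=
  ContinuousOn u D ∧
    ∀ z r, 0 < r → Metric.closedBall z r ⊆ D → u z ≤ Real.circleAverage u z r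

namespace LoewnerCurve

variable (L : LoewnerCurve)

/-- The domain `H_t`. -/
def H (t : ℝ) : Set ℂ := unboundedComponent L.γ t

/-- The inverse map `f_t = g_t⁻¹ : ℍ → H_t`. -/
def f (t : ℝ) (w : ℂ) : ℂ := Function.invFunOn (L.g t) (L.H t) w

/-- `f̂_t(z) = f_t(z + V_t)`. -/
def fHat (t : ℝ) (z : ℂ) : ℂ := L.f t (z + L.V t)

/-- The set `Θ_β` of times `t ∈ (0, 2]` with `y |f̂_t'(i y)| ≈ y ^ (1 - β)` as `y → 0+`. -/
def theta (β : ℝ) : Set ℝ :=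
  {t | t ∈ Ioc (0 : ℝ) 2 ∧
    SubpowerEquiv (fun y => y * ‖deriv (L.fHat t) (y * Complex.I)‖) (fun y => y ^ (1 - β))}

/-! ### Harmonic measure

The prime ends of `H_t` other than `∞` are identified, by means of `g_t`, with the points of the
real line: a point `z ∈ H_t` tends to the prime end `x` when `g_t(z) → x`.  Sets of prime ends
are thus given as subsets of `ℝ`. -/

/-- The filter of points of `H_t` that tend to the prime end `x`. -/
def primeEnd (t x : ℝ) : Filter ℂ := comap (L.g t) (𝓝 (x : ℂ)) ⊓ 𝓟 (L.H t)

/-- The Perron family of the indicator function of a set `A` of prime ends of `H_t`: the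
subharmonic functions on `H_t` with upper boundary limit at most `1` at the prime ends in `A`,
and at most `0` at the other ones, including `∞`. -/
def perronFamily (t : ℝ) (A : Set ℝ) : Set (ℂ → ℝ) :=
  {u | IsSubharmonicOn u (L.H t) ∧
    (∀ x c : ℝ, A.indicator (fun _ => (1 : ℝ)) x < c → ∀ᶠ z in L.primeEnd t x, u z < c) ∧
    (∀ c : ℝ, 0 < c → ∀ᶠ z in Bornology.cobounded ℂ ⊓ 𝓟 (L.H t), u z < c)}

/-- The harmonic measure `hm_{t,z}(A)` of the set `A` of prime ends of `H_t`, seen from `z`. -/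
def hmFrom (t : ℝ) (z : ℂ) (A : Set ℝ) : ℝ :=
  sSup {s | ∃ u ∈ L.perronFamily t A, s = u z}

/-- The normalized harmonic measure from infinity, `hm_t(A) = lim_{y → ∞} y hm_{t,iy}(A)`. -/
def hm (t : ℝ) (A : Set ℝ) : ℝ :=
  limUnder atTop (fun y : ℝ => y * L.hmFrom t (y * Complex.I) A)

/-! ### The arc `σ_{t,ε}` -/

/-- The component `O_{t,ε}` of `B(γ(t), ε) ∩ H_t` that has the prime end `γ(t)` (that is, the prime
end corresponding to `V_t`) on its boundary: the one that contains `f̂_t(i y)` for all small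
`y > 0`. -/
def tipComponent (t ε : ℝ) : Set ℂ :=
  {z | z ∈ Metric.ball (L.γ t) ε ∩ L.H t ∧
    ∀ᶠ y : ℝ in 𝓝[>] 0,
      L.fHat t (y * Complex.I) ∈ connectedComponentIn (Metric.ball (L.γ t) ε ∩ L.H t) z}

/-- `s` is a connected component of `∂B(γ(t), ε) ∩ H_t`, is contained in `∂O_{t,ε}`, and every curve
in `H_t` from the prime end `γ(t)` to infinity passes through `s`. -/
def IsSeparatingArc (t ε : ℝ) (s : Set ℂ) : Prop :=
  (∃ z ∈ Metric.sphere (L.γ t) ε ∩ L.H t,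
      s = connectedComponentIn (Metric.sphere (L.γ t) ε ∩ L.H t) z) ∧
    s ⊆ frontier (L.tipComponent t ε) ∧
    ∀ η : ℝ → ℂ, ContinuousOn η (Ioi 0) → MapsTo η (Ioi 0) (L.H t) →
      Tendsto η (𝓝[>] 0) (L.primeEnd t (L.V t)) →
      Tendsto η atTop (Bornology.cobounded ℂ) → ∃ r, 0 < r ∧ η r ∈ s

/-- `s` is a separating arc that separates all other such arcs from infinity in `H_t`. -/
def IsTipArc (t ε : ℝ) (s : Set ℂ) : Prop :=
  L.IsSeparatingArc t ε s ∧
    ∀ s', L.IsSeparatingArc t ε s' → s' ≠ s →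
      ∀ η : ℝ → ℂ, ContinuousOn η (Ici 0) → MapsTo η (Ici 0) (L.H t) → η 0 ∈ s' →
        Tendsto η atTop (Bornology.cobounded ℂ) → ∃ r, 0 ≤ r ∧ η r ∈ s

/-- The open arc `σ_{t,ε}`: the unique `s` with `IsTipArc t ε s` (written as the union of all of
them). -/
def tipArc (t ε : ℝ) : Set ℂ := ⋃₀ {s | L.IsTipArc t ε s}

/-- The images under `g_t` of the endpoints of `σ_{t,ε}`: the real points to which `g_t` tends along
`σ_{t,ε}`, i.e. the real points in the closure of the crosscut `g_t(σ_{t,ε})` of `ℍ`. -/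
def endpointImages (t ε : ℝ) : Set ℝ := {x : ℝ | (x : ℂ) ∈ closure (L.g t '' L.tipArc t ε)}

/-- The left one, `x₋`, of the two images of the endpoints of `σ_{t,ε}`. -/
def xMinus (t ε : ℝ) : ℝ := sInf (L.endpointImages t ε)

/-- The right one, `x₊`, of the two images of the endpoints of `σ_{t,ε}`. -/
def xPlus (t ε : ℝ) : ℝ := sSup (L.endpointImages t ε)

/-- `μ(t, ε)`: the normalized harmonic measure from infinity of the set `E_{t,ε}` of prime ends of
`H_t` that correspond to the points of `[x₋, x₊]`. -/
def mu (t ε : ℝ) : ℝ := L.hm t (Icc (L.xMinus t ε) (L.xPlus t ε))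

/-- The set `Θ_α^hm` of times `t ∈ (0, 2]` with `μ(t, ε) ≈ ε ^ α` as `ε → 0+`. -/
def thetaHm (α : ℝ) : Set ℝ :=
  {t | t ∈ Ioc (0 : ℝ) 2 ∧ SubpowerEquiv (fun ε => L.mu t ε) (fun ε => ε ^ α)}

end LoewnerCurve

end

/-! ### Subpower equivalence as a statement about exponents. -/

noncomputable section

/-! Fix `t`, let `F = f̂_t` map the half-plane onto `H_t`, and let `p = γ(t)` be its radial limit at
`0`. Put `d(y) = y|F'(iy)|`, `D(y) = |F(iy) - p|` and `R(ε) = x₊ - x₋`. Since `μ(t,ε) = R(ε)/π`, and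
since `≈*` with a power only concerns exponents (`subpowerEquiv_rpow_iff`), the claim is that `R(ε)
= ε^(α+o(1))` if and only if `d(y) = y^(1/α+o(1))`.

Up to constants, three inequalities link these functions: (a) `d(R(ε)) ≲ ε`; (b) if `D ≤ cε` on `(0,
y]`, then `R(ε) ≥ y/2`; (c) if `R(ε) ≤ y/2` and `D(y) ≥ 2ε`, then `ε R(ε)^4 ≲ d(y) y^4`. Each is a
length-area estimate (`length_area`): a wide family of short curves joining the crosscut `g_t(σ) -
V_t` to points where `F` is controlled by distortion cannot be mapped across a thick annulus.
Distortion also shows that `d` changes at most polynomially along the imaginary axis, and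
integrating `|F'|` bounds `D` by `d`.

From `d` to `R`: (a) bounds `R` above; the bound on `d` integrates to one on `D`, and (b) then
bounds `R` below. From `R` to `d`: (a) at `ε = y^(1/α)` and distortion bound `d` above. For the
lower bound, (b) yields some `s ≤ y` with `D(s)` at least about `y^(1/α)`; the upper bound on `d`
forces `s ≥ y^(1+o(1))`, and (c) at height `s`, followed by distortion, gives `d(y) ≥ y^(1/α+o(1))`.
The losing fourth power in (c) is harmless because there `R(ε)` and `s` are both `y^(1+o(1))`.

Two further matters carry weight. The arc `σ` must exist, be unique, and have an image accumulating
at the real line on both sides of `V_t`; existence rests on unicoherence of a simply connected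
domain (`HasContinuousLog.isPreconnected_frontier`). And the Perron harmonic measure of `[x₋, x₊]`
must be computed, by comparison with the argument function and the maximum principle. -/

theorem IsSubpower.eventually_le {ψ : ℝ → ℝ} (h : IsSubpower ψ) {u : ℝ} (hu : 0 < u) :
    ∀ᶠ y in 𝓝[>] (0 : ℝ), ψ (1 / y) ≤ y ^ (-u) := by
  have h1 : Tendsto (fun y : ℝ => 1 / y) (𝓝[>] 0) atTop := by
    simpa using tendsto_inv_nhdsGT_zero (𝕜 := ℝ)
  have h2 := (h1.eventually ((h.decay u hu).eventually (gt_mem_nhds one_pos)))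
  filter_upwards [h2, self_mem_nhdsWithin] with y hy hy0
  have hy0 : 0 < y := hy0
  rw [one_div, Real.inv_rpow hy0.le, ← Real.rpow_neg hy0.le, neg_neg] at hy
  rw [Real.rpow_neg hy0.le, ← one_div (y ^ u), le_div_iff₀' (Real.rpow_pos_of_pos hy0 u)]
  rw [one_div]
  exact hy.le

/-- Pointwise infimum of a family of majorants `C n * (1 + x) ^ (1 / (n + 1))`, `C n ≥ 1`, is a
subpower function. -/
theorem isSubpower_iInf (C : ℕ → ℝ) (hC : ∀ n, 1 ≤ C n) :
    IsSubpower (fun x => ⨅ n : ℕ, C n * (1 + x) ^ (1 / ((n : ℝ) + 1))) := by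
  set e : ℕ → ℝ := fun n => 1 / ((n : ℝ) + 1) with he
  have he0 : ∀ n, 0 < e n := fun n => by positivity
  have he1 : ∀ n, e n ≤ 1 := fun n => by
    have : (0 : ℝ) ≤ n := n.cast_nonneg
    simp only [he]
    rw [div_le_one (by positivity)]
    linarith
  have hbdd : ∀ x : ℝ, -1 < x → BddBelow (range fun n : ℕ => C n * (1 + x) ^ e n) := by
    intro x hx
    refine ⟨0, ?_⟩
    rintro _ ⟨n, rfl⟩
    have := hC n
    have : 0 ≤ (1 + x) ^ e n := Real.rpow_nonneg (by linarith) _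
    simp only; positivity
  -- An infimum of concave functions is concave, and concavity on an open set gives continuity.
  -- Hence the domain `(-1, ∞)`, which contains `[0, ∞)` in its interior.
  have hconc : ConcaveOn ℝ (Ioi (-1 : ℝ)) (fun x => ⨅ n : ℕ, C n * (1 + x) ^ e n) := by
    refine ⟨convex_Ioi _, ?_⟩
    intro x hx y hy a b ha hb hab
    refine le_ciInf fun n => ?_
    have hc := (Real.concaveOn_rpow (he0 n).le (he1 n)).2 (x := 1 + x) (y := 1 + y)
      (by simp only [mem_Ici]; linarith [mem_Ioi.1 hx]) (by simp only [mem_Ici]; linarith [mem_Ioi.1 hy]) ha hb hab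
    have h1 := mul_le_mul_of_nonneg_left (ciInf_le (hbdd x hx) n) ha
    have h2 := mul_le_mul_of_nonneg_left (ciInf_le (hbdd y hy) n) hb
    simp only [smul_eq_mul] at hc ⊢
    have h3 : 1 + (a * x + b * y) = a * (1 + x) + b * (1 + y) := by linear_combination -hab
    rw [h3]
    have h4 := mul_le_mul_of_nonneg_left hc (zero_le_one.trans (hC n))
    calc _ ≤ a * (C n * (1 + x) ^ e n) + b * (C n * (1 + y) ^ e n) := add_le_add h1 h2
      _ = C n * (a * (1 + x) ^ e n + b * (1 + y) ^ e n) := by ring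
      _ ≤ _ := h4
  have hone : ∀ x : ℝ, 0 ≤ x → 1 ≤ ⨅ n : ℕ, C n * (1 + x) ^ e n := fun x hx =>
    le_ciInf fun n => by
      have := Real.one_le_rpow (by linarith : 1 ≤ 1 + x) (he0 n).le
      nlinarith [hC n]
  refine ⟨(hconc.continuousOn isOpen_Ioi).mono fun x hx => ?_, ?_, ?_, ?_⟩
  · simp only [mem_Ici] at hx; simp only [mem_Ioi]; linarith
  · intro x hx y hy hxy
    simp only [mem_Ici] at hx hy
    refine le_ciInf fun n => (ciInf_le (hbdd x (by linarith)) n).trans ?_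
    have := hC n
    gcongr
  · intro x hx; linarith [hone x hx]
  · intro u hu
    obtain ⟨n, hn⟩ := exists_nat_one_div_lt hu
    have hlim : Tendsto (fun x : ℝ => C n * 2 ^ e n * x ^ (-(u - e n))) atTop (𝓝 0) := by
      have := (tendsto_rpow_neg_atTop (sub_pos.2 hn)).const_mul (C n * 2 ^ e n)
      rwa [mul_zero] at this
    refine squeeze_zero' ?_ ?_ hlim
    · filter_upwards [eventually_ge_atTop 0] with x hx
      have := hone x hx
      have := Real.rpow_nonneg hx (-u)
      positivity
    · filter_upwards [eventually_ge_atTop 1] with x hx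
      have hx0 : 0 < x := by linarith
      have h1 := ciInf_le (hbdd x (by linarith)) n
      have h2 : (1 + x) ^ e n ≤ (2 * x) ^ e n :=
        Real.rpow_le_rpow (by linarith) (by linarith) (he0 n).le
      rw [Real.mul_rpow (by norm_num) hx0.le] at h2
      have h3 : x ^ (-(u - e n)) = x ^ (-u) * x ^ e n := by
        rw [← Real.rpow_add hx0]; ring_nf
      have h4 := Real.rpow_nonneg hx0.le (-u)
      have h5 := hC n
      calc _ ≤ x ^ (-u) * (C n * (1 + x) ^ e n) := by gcongr
        _ ≤ x ^ (-u) * (C n * (2 ^ e n * x ^ e n)) := by gcongr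
        _ = _ := by rw [h3]; ring

/-- A subpower function is eventually below every positive power. Conversely, thresholds for the
errors `1 / (n + 1)` are merged into one subpower function by `isSubpower_iInf`. -/
theorem subpowerEquiv_rpow_iff {F : ℝ → ℝ} {β : ℝ} :
    SubpowerEquiv F (fun y => y ^ β) ↔
      ∀ u : ℝ, 0 < u → ∀ᶠ y in 𝓝[>] (0 : ℝ), y ^ (β + u) ≤ F y ∧ F y ≤ y ^ (β - u) := by
  constructor
  · rintro ⟨ψ, hψ, h⟩ u hu
    filter_upwards [h, hψ.eventually_le hu, self_mem_nhdsWithin] with y hy hψy hy0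
    have hy0 : 0 < y := hy0
    have hpos := hψ.pos (1 / y) (by positivity)
    have hβ := Real.rpow_pos_of_pos hy0 β
    refine ⟨le_trans ?_ hy.1, hy.2.trans ?_⟩
    · rw [Real.rpow_add hy0, mul_comm]
      gcongr
      rw [← neg_neg u, Real.rpow_neg hy0.le (-u)]
      gcongr
    · rw [sub_eq_add_neg, Real.rpow_add hy0, mul_comm]
      gcongr
  · intro h
    have hex : ∀ n : ℕ, ∃ δ : ℝ, 0 < δ ∧ ∀ y, 0 < y → y < δ →
        y ^ (β + 1 / ((n : ℝ) + 1)) ≤ F y ∧ F y ≤ y ^ (β - 1 / ((n : ℝ) + 1)) := by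
      intro n
      have := h (1 / ((n : ℝ) + 1)) (by positivity)
      rw [eventually_nhdsWithin_iff, Metric.eventually_nhds_iff] at this
      obtain ⟨δ, hδ, H⟩ := this
      refine ⟨δ, hδ, fun y hy hyδ => H ?_ hy⟩
      rw [Real.dist_eq, sub_zero, abs_of_pos hy]; exact hyδ
    choose δ hδ0 hδ using hex
    -- Below `δ n` the `n`-th error bound applies. Above it, the crude bound `1 / y` coming from `n
    -- = 0` is at most `1 / δ n`, which `C n` absorbs; so every majorant is valid at every small
    -- `y`.
    set C : ℕ → ℝ := fun n => 1 + 1 / δ n with hCdef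
    have hC : ∀ n, 1 ≤ C n := fun n => by
      have := hδ0 n
      have : 0 < 1 / δ n := by positivity
      simp only [hCdef]; linarith
    refine ⟨_, isSubpower_iInf C hC, ?_⟩
    have hsmall : ∀ᶠ y in 𝓝[>] (0 : ℝ), y < min 1 (δ 0) :=
      nhdsWithin_le_nhds (gt_mem_nhds (lt_min one_pos (hδ0 0)))
    filter_upwards [hsmall, self_mem_nhdsWithin] with y hy hy0
    have hy0 : 0 < y := hy0
    have hyβ := Real.rpow_pos_of_pos hy0 β
    have hy1 : y < 1 := hy.trans_le (min_le_left _ _)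
    have hFpos : 0 < F y :=
      (Real.rpow_pos_of_pos hy0 _).trans_le (hδ 0 y hy0 (hy.trans_le (min_le_right _ _))).1
    have key : ∀ n : ℕ, y ^ β / F y ≤ C n * (1 + 1 / y) ^ (1 / ((n : ℝ) + 1)) ∧
        F y / y ^ β ≤ C n * (1 + 1 / y) ^ (1 / ((n : ℝ) + 1)) := by
      intro n
      have gen : ∀ u : ℝ, 0 < u → y ^ (β + u) ≤ F y ∧ F y ≤ y ^ (β - u) →
          y ^ β / F y ≤ (1 / y) ^ u ∧ F y / y ^ β ≤ (1 / y) ^ u := by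
        intro u hu hh
        have hyu := Real.rpow_pos_of_pos hy0 u
        rw [Real.rpow_add hy0, Real.rpow_sub hy0] at hh
        rw [one_div, Real.inv_rpow hy0.le]
        constructor
        · rw [div_le_iff₀ hFpos, inv_mul_eq_div, le_div_iff₀ hyu]; exact hh.1
        · rw [div_le_iff₀ hyβ, inv_mul_eq_div]; exact hh.2
      have h1y : (1 : ℝ) ≤ 1 + 1 / y := by
        have : 0 < 1 / y := by positivity
        linarith
      have hCn := hC n
      by_cases hn : y < δ n
      · have hu : (0 : ℝ) < 1 / ((n : ℝ) + 1) := by positivity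
        have hb : (1 / y) ^ (1 / ((n : ℝ) + 1)) ≤ C n * (1 + 1 / y) ^ (1 / ((n : ℝ) + 1)) := by
          calc (1 / y) ^ (1 / ((n : ℝ) + 1)) ≤ (1 + 1 / y) ^ (1 / ((n : ℝ) + 1)) := by
                gcongr; linarith
            _ ≤ _ := le_mul_of_one_le_left (by positivity) hCn
        have := gen _ hu (hδ n y hy0 hn)
        exact ⟨this.1.trans hb, this.2.trans hb⟩
      · have h0 := gen 1 one_pos (by
          have := hδ 0 y hy0 (hy.trans_le (min_le_right _ _)); simpa using this)
        rw [Real.rpow_one] at h0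
        have hb : 1 / y ≤ C n * (1 + 1 / y) ^ (1 / ((n : ℝ) + 1)) := by
          have h2 : 1 / y ≤ C n := by
            have : 1 / y ≤ 1 / δ n := one_div_le_one_div_of_le (hδ0 n) (not_lt.1 hn)
            simp only [hCdef]; linarith
          exact h2.trans (le_mul_of_one_le_right (by linarith)
            (Real.one_le_rpow h1y (by positivity)))
        exact ⟨h0.1.trans hb, h0.2.trans hb⟩
    have k1 := le_ciInf fun n => (key n).1
    have k2 := le_ciInf fun n => (key n).2
    have hinf : 0 < ⨅ n : ℕ, C n * (1 + 1 / y) ^ (1 / ((n : ℝ) + 1)) :=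
      (div_pos hyβ hFpos).trans_le k1
    constructor
    · rw [inv_mul_le_iff₀ hinf]; exact (div_le_iff₀ hFpos).1 k1
    · exact (div_le_iff₀ hyβ).1 k2

end

/-! ### The length-area method for conformal maps into a punctured plane. -/

noncomputable section

open MeasureTheory

/-- Along a differentiable path whose modulus goes from at most `a` to at least `b`, the part inside
the annulus `a < |z| < b` has logarithmic length at least `log (b / a)`. -/
theorem ofReal_log_le_lintegral_of_le {c c' : ℝ → ℂ} {u v a b : ℝ} (ha : 0 < a) (hab : a < b)
    (huv : u ≤ v) (hc : ∀ s ∈ Icc u v, HasDerivAt c (c' s) s) (hc' : ContinuousOn c' (Icc u v))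
    (hu : ‖c u‖ ≤ a) (hv : b ≤ ‖c v‖) :
    ENNReal.ofReal (Real.log (b / a)) ≤
      ∫⁻ s in {s ∈ Icc u v | a < ‖c s‖ ∧ ‖c s‖ < b}, ENNReal.ofReal (‖c' s‖ / ‖c s‖) := by
  have hcc : ContinuousOn (fun s => ‖c s‖) (Icc u v) := fun s hs =>
    (hc s hs).continuousAt.continuousWithinAt.norm
  -- The last time with modulus at most `a`, and then the first later time with modulus at least
  -- `b`: strictly between them the path stays in the open annulus.
  obtain ⟨p, ⟨hp, hpa⟩, hpmax⟩ : ∃ p, IsGreatest (Icc u v ∩ (fun s => ‖c s‖) ⁻¹' Iic a) p := by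
    have hcl : IsCompact (Icc u v ∩ (fun s => ‖c s‖) ⁻¹' Iic a) :=
      isCompact_Icc.of_isClosed_subset
        (hcc.preimage_isClosed_of_isClosed isClosed_Icc isClosed_Iic) inter_subset_left
    exact hcl.exists_isGreatest ⟨u, left_mem_Icc.2 huv, hu⟩
  have hpv : Icc p v ⊆ Icc u v := Icc_subset_Icc hp.1 le_rfl
  obtain ⟨q, ⟨hq, hqb⟩, hqmin⟩ : ∃ q, IsLeast (Icc p v ∩ (fun s => ‖c s‖) ⁻¹' Ici b) q := by
    have hcl : IsCompact (Icc p v ∩ (fun s => ‖c s‖) ⁻¹' Ici b) :=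
      isCompact_Icc.of_isClosed_subset
        ((hcc.mono hpv).preimage_isClosed_of_isClosed isClosed_Icc isClosed_Ici) inter_subset_left
    exact hcl.exists_isLeast ⟨v, right_mem_Icc.2 hp.2, hv⟩
  simp only [mem_preimage, mem_Iic, mem_Ici] at hpa hqb
  have hpq : p ≤ q := hq.1
  have hsub : Icc p q ⊆ Icc u v := (Icc_subset_Icc le_rfl hq.2).trans hpv
  have hin : ∀ s ∈ Ioo p q, a < ‖c s‖ ∧ ‖c s‖ < b := by
    intro s hs
    have hs' := hsub (Ioo_subset_Icc_self hs)
    constructor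
    · by_contra h
      exact absurd (hpmax ⟨hs', not_lt.1 h⟩) (not_le.2 hs.1)
    · by_contra h
      exact absurd (hqmin ⟨⟨hs.1.le, hs'.2⟩, not_lt.1 h⟩) (not_le.2 hs.2)
  have hlt : p < q := by
    rcases hpq.lt_or_eq with h | h
    · exact h
    · rw [h] at hpa; linarith
  have hge : ∀ s ∈ Icc p q, a ≤ ‖c s‖ := by
    have hc2 : ContinuousOn (fun s => ‖c s‖) (Icc p q) := hcc.mono hsub
    intro s hs
    have hcl : closure (Ioo p q) = Icc p q := closure_Ioo hlt.ne
    have : MapsTo (fun s => ‖c s‖) (closure (Ioo p q)) (closure (Ici a)) :=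
      MapsTo.closure_of_continuousOn (fun s hs => (hin s hs).1.le) (by rwa [hcl])
    rw [hcl, isClosed_Ici.closure_eq] at this
    exact this hs
  -- The derivative of `log ‖c‖`, dominated by `‖c'‖ / ‖c‖` through Cauchy–Schwarz.
  set D : ℝ → ℝ := fun s => inner ℝ (c s) (c' s) / ‖c s‖ ^ 2 with hD
  have hder : ∀ s ∈ Icc p q, HasDerivAt (fun s => Real.log (‖c s‖ ^ 2) / 2) (D s) s := by
    intro s hs
    have hpos : 0 < ‖c s‖ := ha.trans_le (hge s hs)
    have := ((hc s (hsub hs)).norm_sq.log (by positivity)).div_const 2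
    refine this.congr_deriv ?_
    simp only [hD]; ring
  have hDc : ContinuousOn D (Icc p q) := by
    have h1 : ContinuousOn c (Icc p q) := fun s hs =>
      (hc s (hsub hs)).continuousAt.continuousWithinAt
    refine (h1.inner (𝕜 := ℝ) (hc'.mono hsub)).div (h1.norm.pow 2) fun s hs => ?_
    have : 0 < ‖c s‖ := ha.trans_le (hge s hs)
    positivity
  have hDi : IntervalIntegrable D volume p q := by
    apply ContinuousOn.intervalIntegrable; rwa [uIcc_of_le hpq]
  have hftc := intervalIntegral.integral_eq_sub_of_hasDerivAt
    (fun s hs => hder s (by rwa [uIcc_of_le hpq] at hs)) hDi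
  set N : ℝ → ℝ := fun s => ‖c' s‖ / ‖c s‖ with hN
  have hNc : ContinuousOn N (Icc p q) := by
    refine (hc'.mono hsub).norm.div (hcc.mono hsub) fun s hs => ?_
    exact (ha.trans_le (hge s hs)).ne'
  have hNi : IntervalIntegrable N volume p q := by
    apply ContinuousOn.intervalIntegrable; rwa [uIcc_of_le hpq]
  have hle : Real.log (b / a) ≤ ∫ s in p..q, N s := by
    have h1 : ∫ s in p..q, D s ≤ ∫ s in p..q, N s := by
      refine intervalIntegral.integral_mono_on hpq hDi hNi fun s hs => ?_
      have hpos : 0 < ‖c s‖ := ha.trans_le (hge s hs)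
      have := real_inner_le_norm (c s) (c' s)
      simp only [hD, hN]
      rw [div_le_div_iff₀ (by positivity) hpos]
      nlinarith
    have hq0 : 0 < ‖c q‖ := ha.trans_le (hge q (right_mem_Icc.2 hpq))
    have hp0 : 0 < ‖c p‖ := ha.trans_le (hge p (left_mem_Icc.2 hpq))
    rw [hftc, Real.log_pow, Real.log_pow] at h1
    rw [Real.log_div (ha.trans hab).ne' ha.ne']
    have h2 := Real.log_le_log (ha.trans hab) hqb
    have h3 := Real.log_le_log hp0 hpa
    push_cast at h1
    linarith
  have hint : IntegrableOn N (Ioo p q) volume :=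
    (hNc.integrableOn_Icc).mono_set Ioo_subset_Icc_self
  calc ENNReal.ofReal (Real.log (b / a)) ≤ ENNReal.ofReal (∫ s in p..q, N s) :=
        ENNReal.ofReal_le_ofReal hle
    _ = ENNReal.ofReal (∫ s in Ioo p q, N s) := by
        rw [intervalIntegral.integral_of_le hpq, integral_Ioc_eq_integral_Ioo]
    _ = ∫⁻ s in Ioo p q, ENNReal.ofReal (N s) :=
        ofReal_integral_eq_lintegral_ofReal hint (Eventually.of_forall fun s => by
          simp only [hN, Pi.zero_apply]; positivity)
    _ ≤ _ := lintegral_mono_set (show Ioo p q ⊆ {s ∈ Icc u v | a < ‖c s‖ ∧ ‖c s‖ < b} from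
        fun s hs => ⟨hsub (Ioo_subset_Icc_self hs), hin s hs⟩)

/-- Time reversal reduces an inward crossing to an outward one. -/
theorem ofReal_log_le_lintegral {c c' : ℝ → ℂ} {u v a b : ℝ} (ha : 0 < a) (hab : a < b)
    (huv : u ≤ v) (hc : ∀ s ∈ Icc u v, HasDerivAt c (c' s) s) (hc' : ContinuousOn c' (Icc u v))
    (h : (‖c u‖ ≤ a ∧ b ≤ ‖c v‖) ∨ (‖c v‖ ≤ a ∧ b ≤ ‖c u‖)) :
    ENNReal.ofReal (Real.log (b / a)) ≤
      ∫⁻ s in {s ∈ Icc u v | a < ‖c s‖ ∧ ‖c s‖ < b}, ENNReal.ofReal (‖c' s‖ / ‖c s‖) := by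
  rcases h with ⟨h1, h2⟩ | ⟨h1, h2⟩
  · exact ofReal_log_le_lintegral_of_le ha hab huv hc hc' h1 h2
  · have hm : ∀ s ∈ Icc (-v) (-u), -s ∈ Icc u v := fun s hs => ⟨by linarith [hs.2], by linarith [hs.1]⟩
    have := ofReal_log_le_lintegral_of_le (c := fun s => c (-s)) (c' := fun s => -c' (-s))
      (u := -v) (v := -u) ha hab (by linarith)
      (fun s hs => by
        have := (hc (-s) (hm s hs)).scomp s (hasDerivAt_neg s)
        rwa [neg_one_smul] at this)
      ((hc'.comp continuousOn_neg hm).neg) (by simpa using h1) (by simpa using h2)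
    refine this.trans (le_of_eq ?_)
    have hmp := (Measure.measurePreserving_neg (volume : Measure ℝ))
    have hpre : {s ∈ Icc (-v) (-u) | a < ‖c (-s)‖ ∧ ‖c (-s)‖ < b} =
        Neg.neg ⁻¹' {s ∈ Icc u v | a < ‖c s‖ ∧ ‖c s‖ < b} := by
      ext s
      simp only [mem_ofPred_eq, mem_preimage, mem_Icc]
      constructor <;> rintro ⟨⟨h1, h2⟩, h3⟩ <;> exact ⟨⟨by linarith, by linarith⟩, h3⟩
    simp only [norm_neg]
    rw [hpre]
    exact hmp.setLIntegral_comp_preimage_emb (MeasurableEquiv.neg ℝ).measurableEmbedding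
      (fun s => ENNReal.ofReal (‖c' s‖ / ‖c s‖)) _

theorem lintegral_annulus {p : ℂ} {a b : ℝ} (ha : 0 < a) (hab : a < b) :
    ∫⁻ w in {w : ℂ | a < ‖w - p‖ ∧ ‖w - p‖ < b}, ENNReal.ofReal (1 / ‖w - p‖ ^ 2) =
      ENNReal.ofReal (2 * Real.pi * Real.log (b / a)) := by
  have hms : MeasurableSet {w : ℂ | a < ‖w‖ ∧ ‖w‖ < b} :=
    (measurableSet_lt measurable_const measurable_norm).inter
      (measurableSet_lt measurable_norm measurable_const)
  have htr : ∫⁻ w in {w : ℂ | a < ‖w - p‖ ∧ ‖w - p‖ < b}, ENNReal.ofReal (1 / ‖w - p‖ ^ 2) =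
      ∫⁻ w in {w : ℂ | a < ‖w‖ ∧ ‖w‖ < b}, ENNReal.ofReal (1 / ‖w‖ ^ 2) :=
    (measurePreserving_sub_right volume p).setLIntegral_comp_preimage_emb
      (MeasurableEquiv.subRight p).measurableEmbedding
      (fun w : ℂ => ENNReal.ofReal (1 / ‖w‖ ^ 2)) {w : ℂ | a < ‖w‖ ∧ ‖w‖ < b}
  rw [htr, ← lintegral_indicator hms, ← Complex.lintegral_comp_polarCoord_symm]
  have h1 : ∀ q ∈ polarCoord.target, ENNReal.ofReal q.1 •
      ({w : ℂ | a < ‖w‖ ∧ ‖w‖ < b}.indicator (fun w : ℂ => ENNReal.ofReal (1 / ‖w‖ ^ 2)))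
        (Complex.polarCoord.symm q) =
      (Ioo a b ×ˢ Ioo (-Real.pi) Real.pi).indicator (fun q : ℝ × ℝ => ENNReal.ofReal (1 / q.1)) q := by
    intro q hq
    rw [polarCoord_target] at hq
    have hq1 : 0 < q.1 := hq.1
    by_cases hm : q.1 ∈ Ioo a b
    · rw [indicator_of_mem, indicator_of_mem]
      · rw [Complex.norm_polarCoord_symm, abs_of_pos hq1, smul_eq_mul,
          ← ENNReal.ofReal_mul hq1.le]
        congr 1; field_simp
      · exact ⟨hm, hq.2⟩
      · simp only [mem_ofPred_eq]; rw [Complex.norm_polarCoord_symm, abs_of_pos hq1]; exact hm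
    · rw [indicator_of_notMem, indicator_of_notMem, smul_zero]
      · exact fun h => hm h.1
      · simp only [mem_ofPred_eq]; rw [Complex.norm_polarCoord_symm, abs_of_pos hq1]; exact hm
  rw [setLIntegral_congr_fun polarCoord.open_target.measurableSet h1, setLIntegral_indicator
    (measurableSet_Ioo.prod measurableSet_Ioo)]
  have h2 : Ioo a b ×ˢ Ioo (-Real.pi) Real.pi ∩ polarCoord.target
      = Ioo a b ×ˢ Ioo (-Real.pi) Real.pi := by
    rw [inter_eq_left, polarCoord_target]
    exact prod_mono (fun x hx => ha.trans hx.1) le_rfl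
  rw [h2, Measure.volume_eq_prod, ← Measure.prod_restrict,
    lintegral_prod _ (by fun_prop)]
  simp only [lintegral_const, Measure.restrict_apply MeasurableSet.univ, univ_inter,
    Real.volume_Ioo]
  rw [lintegral_mul_const _ (by fun_prop)]
  have hcont : ContinuousOn (fun x : ℝ => 1 / x) (Icc a b) :=
    continuousOn_const.div continuousOn_id fun x hx => (ha.trans_le hx.1).ne'
  rw [← ofReal_integral_eq_lintegral_ofReal (hcont.integrableOn_Icc.mono_set Ioo_subset_Icc_self)
    ((ae_restrict_mem measurableSet_Ioo).mono fun x hx => by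
      have := ha.trans hx.1
      simp only [Pi.zero_apply]; positivity),
    ← integral_Ioc_eq_integral_Ioo, ← intervalIntegral.integral_of_le hab.le,
    integral_one_div_of_pos ha (ha.trans hab), ← ENNReal.ofReal_mul]
  · congr 1; ring
  · exact Real.log_nonneg ((one_le_div ha).2 hab.le)

theorem det_restrictScalars_smulRight (d : ℂ) :
    ((ContinuousLinearMap.toSpanSingleton ℂ d).restrictScalars ℝ : ℂ →L[ℝ] ℂ).det = ‖d‖ ^ 2 := by
  have : (((ContinuousLinearMap.toSpanSingleton ℂ d).restrictScalars ℝ : ℂ →L[ℝ] ℂ) : ℂ →ₗ[ℝ] ℂ) =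
      (LinearMap.toSpanSingleton ℂ ℂ d).restrictScalars ℝ := rfl
  rw [ContinuousLinearMap.det, this, LinearMap.det_restrictScalars, Algebra.norm_complex_eq]
  simp [Complex.normSq_eq_norm_sq]

/-- The Jacobian of `Φ` is `|Φ'|²`, so the integral is the area of `Φ '' S` in the metric `|dw| / |w
- p|`. By injectivity nothing is counted twice, and the whole annulus has area `2π log (b / a)`. -/
theorem lintegral_logDeriv_sq_le {Φ : ℂ → ℂ} {Ω : Set ℂ} (hΩ : IsOpen Ω)
    (hd : DifferentiableOn ℂ Φ Ω) (hinj : InjOn Φ Ω) {p : ℂ} {a b : ℝ} (ha : 0 < a) (hab : a < b)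
    {S : Set ℂ} (hS : MeasurableSet S) (hSΩ : S ⊆ Ω)
    (hSab : ∀ z ∈ S, a < ‖Φ z - p‖ ∧ ‖Φ z - p‖ < b) :
    ∫⁻ z in S, ENNReal.ofReal ((‖deriv Φ z‖ / ‖Φ z - p‖) ^ 2) ≤
      ENNReal.ofReal (2 * Real.pi * Real.log (b / a)) := by
  have hf' : ∀ z ∈ S, HasFDerivWithinAt Φ
      ((ContinuousLinearMap.toSpanSingleton ℂ (deriv Φ z)).restrictScalars ℝ : ℂ →L[ℝ] ℂ) S z := by
    intro z hz
    exact (((hd.differentiableAt (hΩ.mem_nhds (hSΩ hz))).hasDerivAt).hasFDerivAt.restrictScalars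
      ℝ).hasFDerivWithinAt
  have := lintegral_image_eq_lintegral_abs_det_fderiv_mul volume hS hf' (hinj.mono hSΩ)
    (fun w => ENNReal.ofReal (1 / ‖w - p‖ ^ 2))
  have h2 : ∫⁻ z in S, ENNReal.ofReal ((‖deriv Φ z‖ / ‖Φ z - p‖) ^ 2) =
      ∫⁻ w in Φ '' S, ENNReal.ofReal (1 / ‖w - p‖ ^ 2) := by
    rw [this]
    refine lintegral_congr fun z => ?_
    rw [det_restrictScalars_smulRight, abs_of_nonneg (by positivity),
      ← ENNReal.ofReal_mul (by positivity)]
    congr 1; ring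
  rw [h2, ← lintegral_annulus ha hab (p := p)]
  exact lintegral_mono_set (by rintro _ ⟨z, hz, rfl⟩; exact hSab z hz)

/-- **Length-area estimate**: if each horizontal segment of a family of total height `θ₂ - θ₁`, of
length at most `s₂ - s₁`, is mapped to a path that crosses the annulus `a < |z - p| < b`. -/
theorem length_area {Φ : ℂ → ℂ} {Ω : Set ℂ} (hΩ : IsOpen Ω)
    (hd : DifferentiableOn ℂ Φ Ω) (hinj : InjOn Φ Ω) {p : ℂ} {a b θ₁ θ₂ s₁ s₂ : ℝ} (ha : 0 < a)
    (hab : a < b) (hθ : θ₁ < θ₂) (hs : s₁ ≤ s₂)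
    (h : ∀ θ ∈ Ioo θ₁ θ₂, ∃ u v, s₁ ≤ u ∧ u ≤ v ∧ v ≤ s₂ ∧ (∀ s ∈ Icc u v, (⟨s, θ⟩ : ℂ) ∈ Ω) ∧
      ((‖Φ ⟨u, θ⟩ - p‖ ≤ a ∧ b ≤ ‖Φ ⟨v, θ⟩ - p‖) ∨ (‖Φ ⟨v, θ⟩ - p‖ ≤ a ∧ b ≤ ‖Φ ⟨u, θ⟩ - p‖))) :
    (θ₂ - θ₁) * Real.log (b / a) ≤ 2 * Real.pi * (s₂ - s₁) := by
  set L := Real.log (b / a) with hL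
  have hLpos : 0 < L := Real.log_pos ((one_lt_div ha).2 hab)
  set Q : Set ℂ := {z | z.re ∈ Icc s₁ s₂ ∧ z.im ∈ Ioo θ₁ θ₂} with hQ
  have hQm : MeasurableSet Q :=
    (measurableSet_Icc.preimage Complex.measurable_re).inter
      (measurableSet_Ioo.preimage Complex.measurable_im)
  set U : Set ℂ := Ω ∩ (fun z => ‖Φ z - p‖) ⁻¹' Ioo a b with hU
  have hUo : IsOpen U := (hd.continuousOn.sub continuousOn_const).norm.isOpen_inter_preimage hΩ isOpen_Ioo
  set S : Set ℂ := U ∩ Q with hS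
  have hSm : MeasurableSet S := hUo.measurableSet.inter hQm
  set m : ℂ → ℝ := fun z => ‖deriv Φ z‖ / ‖Φ z - p‖ with hm
  have hmc : ContinuousOn m U := by
    refine (((hd.deriv hΩ).continuousOn.mono inter_subset_left).norm).div
      ((hd.continuousOn.sub continuousOn_const).norm.mono inter_subset_left) fun z hz => ?_
    exact (ha.trans hz.2.1).ne'
  set G : ℂ → ENNReal := S.indicator fun z => ENNReal.ofReal (m z) with hG
  have hGm : AEMeasurable G volume := by
    rw [hG, aemeasurable_indicator_iff hSm]
    exact ((hmc.mono inter_subset_left).aemeasurable hSm).ennreal_ofReal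
  have hQvol : volume Q = ENNReal.ofReal ((s₂ - s₁) * (θ₂ - θ₁)) := by
    have : Q = Complex.measurableEquivRealProd ⁻¹' (Icc s₁ s₂ ×ˢ Ioo θ₁ θ₂) := rfl
    rw [this, Complex.volume_preserving_equiv_real_prod.measure_preimage
      (measurableSet_Icc.prod measurableSet_Ioo).nullMeasurableSet, Measure.volume_eq_prod,
      Measure.prod_prod, Real.volume_Icc, Real.volume_Ioo, ENNReal.ofReal_mul (by linarith)]
  -- lower bound
  have hlow : ENNReal.ofReal ((θ₂ - θ₁) * L) ≤ ∫⁻ z, G z := by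
    have hmp := Complex.volume_preserving_equiv_real_prod.symm
    have h1 : ∫⁻ z, G z = ∫⁻ y : ℝ, ∫⁻ x : ℝ, G ⟨x, y⟩ := by
      rw [← hmp.lintegral_comp_emb Complex.measurableEquivRealProd.symm.measurableEmbedding,
        Measure.volume_eq_prod, lintegral_prod_symm]
      · rfl
      · exact hGm.comp_quasiMeasurePreserving hmp.quasiMeasurePreserving
    rw [h1, ENNReal.ofReal_mul (by linarith), ← Real.volume_Ioo, mul_comm,
      ← setLIntegral_const]
    refine le_trans ?_ (setLIntegral_le_lintegral (Ioo θ₁ θ₂) _)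
    refine setLIntegral_mono' measurableSet_Ioo fun θ hθ' => ?_
    obtain ⟨u, v, hu, huv, hv, hmem, hor⟩ := h θ hθ'
    have hder : ∀ s ∈ Icc u v, HasDerivAt (fun s : ℝ => Φ ⟨s, θ⟩ - p) (deriv Φ ⟨s, θ⟩) s := by
      intro s hs'
      have h2 : HasDerivAt (fun s : ℝ => (⟨s, θ⟩ : ℂ)) 1 s := by
        have : (fun s : ℝ => (⟨s, θ⟩ : ℂ)) = fun s : ℝ => (s : ℂ) + θ * Complex.I := by
          funext s; apply Complex.ext <;> simp
        rw [this]
        exact (Complex.ofRealCLM.hasDerivAt (x := s)).add_const _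
      have h3 := (hd.differentiableAt (hΩ.mem_nhds (hmem s hs'))).hasDerivAt
      simpa using (h3.comp s h2).sub_const p
    have hcont : ContinuousOn (fun s : ℝ => deriv Φ ⟨s, θ⟩) (Icc u v) := by
      refine (hd.deriv hΩ).continuousOn.comp ?_ fun s hs' => hmem s hs'
      have : (fun s : ℝ => (⟨s, θ⟩ : ℂ)) = fun s : ℝ => (s : ℂ) + θ * Complex.I := by
        funext s; apply Complex.ext <;> simp
      rw [this]; fun_prop
    have h4 := ofReal_log_le_lintegral ha hab huv hder hcont hor
    refine h4.trans ?_
    have h5 : MeasurableSet {s ∈ Icc u v | a < ‖Φ ⟨s, θ⟩ - p‖ ∧ ‖Φ ⟨s, θ⟩ - p‖ < b} := by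
      have hcn : ContinuousOn (fun s : ℝ => ‖Φ ⟨s, θ⟩ - p‖) (Icc u v) := fun s hs' =>
        (hder s hs').continuousAt.norm.continuousWithinAt
      have hx : MeasurableSet (Icc u v ∩ (fun s : ℝ => ‖Φ ⟨s, θ⟩ - p‖) ⁻¹' Ioo a b) := by
        obtain ⟨O, hO, hOe⟩ := (continuousOn_iff'.1 hcn) (Ioo a b) isOpen_Ioo
        rw [inter_comm, hOe]; exact hO.measurableSet.inter measurableSet_Icc
      exact hx
    rw [← lintegral_indicator h5]
    refine lintegral_mono fun s => ?_
    refine indicator_apply_le' (fun hs' => ?_) fun _ => bot_le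
    rw [hG, indicator_of_mem (show (⟨s, θ⟩ : ℂ) ∈ S from ⟨⟨hmem s hs'.1, hs'.2⟩,
      ⟨hu.trans hs'.1.1, hs'.1.2.trans hv⟩, hθ'⟩)]
  have hup : ∫⁻ z, G z ≤ ENNReal.ofReal ((θ₂ - θ₁) / (4 * Real.pi) * (2 * Real.pi * L) +
      Real.pi / (θ₂ - θ₁) * ((s₂ - s₁) * (θ₂ - θ₁))) := by
    have hθ' : 0 < θ₂ - θ₁ := by linarith
    have hpi := Real.pi_pos
    -- Weighted AM-GM in place of Cauchy–Schwarz. The weight makes the area term exactly half of the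
    -- lower bound `(θ₂ - θ₁) log (b / a)`, so it can be moved to the other side.
    have hpt : ∀ z, ENNReal.ofReal (m z) ≤
        ENNReal.ofReal ((θ₂ - θ₁) / (4 * Real.pi)) * ENNReal.ofReal (m z ^ 2) +
          ENNReal.ofReal (Real.pi / (θ₂ - θ₁)) := by
      intro z
      rw [← ENNReal.ofReal_mul (by positivity), ← ENNReal.ofReal_add (by positivity) (by positivity)]
      apply ENNReal.ofReal_le_ofReal
      have : (θ₂ - θ₁) / (4 * Real.pi) * m z ^ 2 + Real.pi / (θ₂ - θ₁) - m z =
          ((θ₂ - θ₁) * m z - 2 * Real.pi) ^ 2 / (4 * Real.pi * (θ₂ - θ₁)) := by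
        field_simp; ring
      have h2 : 0 ≤ ((θ₂ - θ₁) * m z - 2 * Real.pi) ^ 2 / (4 * Real.pi * (θ₂ - θ₁)) := by positivity
      linarith
    rw [hG, lintegral_indicator hSm]
    calc ∫⁻ z in S, ENNReal.ofReal (m z) ≤ ∫⁻ z in S,
          (ENNReal.ofReal ((θ₂ - θ₁) / (4 * Real.pi)) * ENNReal.ofReal (m z ^ 2) +
            ENNReal.ofReal (Real.pi / (θ₂ - θ₁))) := lintegral_mono fun z => hpt z
      _ = ENNReal.ofReal ((θ₂ - θ₁) / (4 * Real.pi)) * (∫⁻ z in S, ENNReal.ofReal (m z ^ 2)) +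
            ENNReal.ofReal (Real.pi / (θ₂ - θ₁)) * volume S := by
          rw [lintegral_add_right _ measurable_const, lintegral_const_mul' _ _ ENNReal.ofReal_ne_top,
            setLIntegral_const]
      _ ≤ ENNReal.ofReal ((θ₂ - θ₁) / (4 * Real.pi)) * ENNReal.ofReal (2 * Real.pi * L) +
            ENNReal.ofReal (Real.pi / (θ₂ - θ₁)) * ENNReal.ofReal ((s₂ - s₁) * (θ₂ - θ₁)) := by
          gcongr
          · exact lintegral_logDeriv_sq_le hΩ hd hinj ha hab hSm
              (inter_subset_left.trans inter_subset_left) fun z hz => hz.1.2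
          · rw [← hQvol]; exact measure_mono inter_subset_right
      _ = _ := by
          have : 0 ≤ s₂ - s₁ := by linarith
          rw [← ENNReal.ofReal_mul (by positivity), ← ENNReal.ofReal_mul (by positivity),
            ← ENNReal.ofReal_add (by positivity) (by positivity)]
  have hfin := hlow.trans hup
  have hθ' : 0 < θ₂ - θ₁ := by linarith
  have hpi := Real.pi_pos
  have hs' : 0 ≤ s₂ - s₁ := by linarith
  rw [ENNReal.ofReal_le_ofReal_iff (by positivity)] at hfin
  have e1 : (θ₂ - θ₁) / (4 * Real.pi) * (2 * Real.pi * L) = (θ₂ - θ₁) * L / 2 := by field_simp; ring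
  have e2 : Real.pi / (θ₂ - θ₁) * ((s₂ - s₁) * (θ₂ - θ₁)) = Real.pi * (s₂ - s₁) := by field_simp
  rw [e1, e2] at hfin
  linarith

end

/-! ### Weak Bloch, Koebe and growth theorems for univalent functions. -/

noncomputable section

open Metric

/-- Take a primitive `h` of `φ' / φ` with the right value at `c`; then `φ e^(-h)` has zero
derivative, hence is constant. -/
theorem exists_log_branch_ball {φ : ℂ → ℂ} {c : ℂ} {r : ℝ} (hr : 0 < r)
    (hd : DifferentiableOn ℂ φ (ball c r)) (h0 : ∀ z ∈ ball c r, φ z ≠ 0) {l : ℂ}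
    (hl : Complex.exp l = φ c) :
    ∃ h : ℂ → ℂ, h c = l ∧ ∀ z ∈ ball c r, HasDerivAt h (deriv φ z / φ z) z ∧
      Complex.exp (h z) = φ z := by
  have hd' : DifferentiableOn ℂ (fun z => deriv φ z / φ z) (ball c r) :=
    (hd.deriv isOpen_ball).div hd h0
  obtain ⟨h, hc, hh⟩ := hd'.isExactOn_ball.with_val_at c l
  refine ⟨h, hc, fun z hz => ⟨hh z hz, ?_⟩⟩
  have hder : ∀ w ∈ ball c r, HasDerivAt (fun w => φ w * Complex.exp (-h w)) 0 w := by
    intro w hw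
    have h1 := (hd.differentiableAt (isOpen_ball.mem_nhds hw)).hasDerivAt
    have h2 := h1.mul (hh w hw).neg.cexp
    refine h2.congr_deriv ?_
    have := h0 w hw
    field_simp
    ring
  have hconst := (convex_ball c r).is_const_of_fderivWithin_eq_zero (𝕜 := ℂ)
    (f := fun w => φ w * Complex.exp (-h w))
    (fun w hw => (hder w hw).differentiableAt.differentiableWithinAt)
    (fun w hw => by
      rw [fderivWithin_of_isOpen isOpen_ball hw]
      have := (hder w hw).hasFDerivAt.fderiv
      rw [this]; ext; simp)
    hz (mem_ball_self hr)
  simp only [hc] at hconst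
  rw [Complex.exp_neg l, hl, mul_inv_cancel₀ (h0 c (mem_ball_self hr)), Complex.exp_neg] at hconst
  have := Complex.exp_ne_zero (h z)
  field_simp at hconst
  exact hconst.symm

/-- A Bloch-type estimate: a holomorphic function on a disc that never takes two values differing by
`2πi` has bounded derivative at the centre. -/
theorem mul_norm_deriv_le_of_sub_ne {h : ℂ → ℂ} {c : ℂ} {r : ℝ} (hr : 0 < r)
    (hd : DifferentiableOn ℂ h (ball c r))
    (hne : ∀ z ∈ ball c r, ∀ w ∈ ball c r, h z - h w ≠ 2 * Real.pi * Complex.I) :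
    r * ‖deriv h c‖ ≤ 128 * Real.pi := by
  have hmain : ∀ r' ∈ Ioo 0 r, r' * ‖deriv h c‖ ≤ 128 * Real.pi := by
    intro r' hr'
    have hsub : closedBall c r' ⊆ ball c r := closedBall_subset_ball hr'.2
    have hdc := (hd.deriv isOpen_ball)
    -- Landau's trick: moving the centre to a maximum of distance-to-boundary times `|h'|` makes
    -- `|h'|` at most twice `|h' z₁|` on the disc of half that distance.
    obtain ⟨z₁, hz₁, hmax⟩ := (isCompact_closedBall c r').exists_isMaxOn
      ⟨c, mem_closedBall_self hr'.1.le⟩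
      (f := fun z => (r' - ‖z - c‖) * ‖deriv h z‖)
      ((by fun_prop : ContinuousOn (fun z => r' - ‖z - c‖) _).mul (hdc.continuousOn.norm.mono hsub))
    set M := (r' - ‖z₁ - c‖) * ‖deriv h z₁‖ with hM
    have hcM : r' * ‖deriv h c‖ ≤ M := by
      have := hmax (mem_closedBall_self hr'.1.le)
      simpa using this
    refine hcM.trans ?_
    by_contra hlt
    push Not at hlt
    have hpi := Real.pi_pos
    have hMpos : 0 < M := by linarith [Real.pi_pos]
    have hz₁' : ‖z₁ - c‖ ≤ r' := by simpa [dist_eq_norm] using hz₁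
    have ht : 0 < r' - ‖z₁ - c‖ := by
      rcases (sub_nonneg.2 hz₁').lt_or_eq with h1 | h1
      · exact h1
      · rw [hM, ← h1, zero_mul] at hMpos; exact absurd hMpos (lt_irrefl _)
    set s := (r' - ‖z₁ - c‖) / 2 with hs
    have hs0 : 0 < s := by positivity
    have hz1s : ‖deriv h z₁‖ = M / (2 * s) := by
      rw [hM, hs]; field_simp
    have hball : ∀ z, ‖z - z₁‖ ≤ s → z ∈ closedBall c r' ∧ ‖deriv h z‖ ≤ M / s := by
      intro z hz
      have h1 : ‖z - c‖ ≤ ‖z - z₁‖ + ‖z₁ - c‖ := norm_sub_le_norm_sub_add_norm_sub _ _ _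
      have h2 : s ≤ r' - ‖z - c‖ := by rw [hs] at *; linarith
      have hmem : z ∈ closedBall c r' := by
        rw [mem_closedBall, dist_eq_norm]; linarith
      refine ⟨hmem, ?_⟩
      have h3 : (r' - ‖z - c‖) * ‖deriv h z‖ ≤ M := hmax hmem
      rw [le_div_iff₀ hs0]
      nlinarith [norm_nonneg (deriv h z)]
    have hd2 : ∀ z, ‖z - z₁‖ ≤ s / 2 → ‖deriv (deriv h) z‖ ≤ M / s / (s / 2) := by
      intro z hz
      have hcl : closedBall z (s / 2) ⊆ ball c r := fun w hw => hsub (hball w (by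
        rw [mem_closedBall, dist_eq_norm] at hw
        have := norm_sub_le_norm_sub_add_norm_sub w z z₁
        linarith)).1
      refine Complex.norm_deriv_le_of_forall_mem_sphere_norm_le (by positivity)
        ((hdc.mono (hcl.trans' closure_ball_subset_closedBall)).diffContOnCl) ?_
      intro w hw
      refine (hball w ?_).2
      rw [mem_sphere, dist_eq_norm] at hw
      have := norm_sub_le_norm_sub_add_norm_sub w z z₁
      linarith
    have hd1 : ∀ z ∈ closedBall z₁ (s / 8), ‖deriv h z - deriv h z₁‖ ≤ M / (4 * s) := by
      intro z hz
      have h1 := (convex_closedBall z₁ (s / 8)).norm_image_sub_le_of_norm_deriv_le (𝕜 := ℂ)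
        (f := deriv h) (C := M / s / (s / 2)) (x := z₁) (y := z)
        (fun w hw => hdc.differentiableAt (isOpen_ball.mem_nhds (hsub (hball w (by
          rw [mem_closedBall, dist_eq_norm] at hw; linarith)).1)))
        (fun w hw => hd2 w (by rw [mem_closedBall, dist_eq_norm] at hw; linarith))
        (mem_closedBall_self (by positivity)) hz
      rw [mem_closedBall, dist_eq_norm] at hz
      refine h1.trans ?_
      calc M / s / (s / 2) * ‖z - z₁‖ ≤ M / s / (s / 2) * (s / 8) := by gcongr
        _ = M / (4 * s) := by field_simp; norm_num
    -- The linear part has modulus `(M / 2s)(s / 8) = M / 16`, and the remainder at most `(M / 4s)(s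
    -- / 8) = M / 32`.
    have hlow : ∀ z ∈ sphere z₁ (s / 8), M / 32 ≤ ‖h z - h z₁‖ := by
      intro z hz
      have hz' : z ∈ closedBall z₁ (s / 8) := sphere_subset_closedBall hz
      have h1 := (convex_closedBall z₁ (s / 8)).norm_image_sub_le_of_norm_hasDerivWithin_le (𝕜 := ℂ)
        (f := fun w => h w - deriv h z₁ * w) (f' := fun w => deriv h w - deriv h z₁)
        (C := M / (4 * s)) (x := z₁) (y := z)
        (fun w hw => by
          have hw' : w ∈ ball c r := hsub (hball w (by
            rw [mem_closedBall, dist_eq_norm] at hw; linarith)).1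
          have := ((hd.differentiableAt (isOpen_ball.mem_nhds hw')).hasDerivAt.sub
            ((hasDerivAt_id w).const_mul (deriv h z₁)))
          rw [mul_one] at this
          exact this.hasDerivWithinAt)
        hd1 (mem_closedBall_self (by positivity)) hz'
      rw [mem_sphere, dist_eq_norm] at hz
      rw [hz] at h1
      have h2 : h z - h z₁ = (h z - deriv h z₁ * z - (h z₁ - deriv h z₁ * z₁)) +
          deriv h z₁ * (z - z₁) := by ring
      have h3 : ‖deriv h z₁ * (z - z₁)‖ = M / 16 := by
        rw [norm_mul, hz, hz1s]; field_simp; norm_num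
      have h4 : M / (4 * s) * (s / 8) = M / 32 := by field_simp; norm_num
      have h5 := norm_sub_le_norm_add (deriv h z₁ * (z - z₁))
        (h z - deriv h z₁ * z - (h z₁ - deriv h z₁ * z₁))
      rw [h2, add_comm]
      linarith
    have hz₁b : z₁ ∈ ball c r := hsub hz₁
    have hcl : closedBall z₁ (s / 8) ⊆ ball c r := fun w hw => hsub (hball w (by
      rw [mem_closedBall, dist_eq_norm] at hw; linarith)).1
    have hder := (hd.differentiableAt (isOpen_ball.mem_nhds hz₁b)).hasDerivAt
    have hne1 : deriv h z₁ ≠ 0 := by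
      rw [← norm_pos_iff, hz1s]; positivity
    have hfreq : ∃ᶠ z in 𝓝 z₁, h z ≠ h z₁ := by
      have := (hder.eventually_ne hne1 (c := h z₁))
      exact this.frequently.filter_mono nhdsWithin_le_nhds
    -- The image covers a disc of radius `M / 64` about `h z₁`. If `M > 128π` this radius exceeds
    -- `2π`, so `h z₁ + 2πi` is a value too.
    have himg := DiffContOnCl.ball_subset_image_closedBall
      ((hd.mono (hcl.trans' closure_ball_subset_closedBall)).diffContOnCl) (by positivity) hlow hfreq
    have hmem : h z₁ + 2 * Real.pi * Complex.I ∈ ball (h z₁) (M / 32 / 2) := by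
      rw [mem_ball, dist_eq_norm, add_sub_cancel_left]
      simp only [norm_mul, Complex.norm_I, mul_one, Complex.norm_real, Real.norm_eq_abs,
        abs_of_pos hpi, Complex.norm_ofNat]
      linarith
    obtain ⟨z₂, hz₂, he⟩ := himg hmem
    exact hne z₂ (hcl hz₂) z₁ hz₁b (by rw [he]; ring)
  have hlim : Tendsto (fun r' : ℝ => r' * ‖deriv h c‖) (𝓝[<] r) (𝓝 (r * ‖deriv h c‖)) :=
    ((continuous_id.mul continuous_const).tendsto r).mono_left nhdsWithin_le_nhds
  refine le_of_tendsto hlim ?_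
  filter_upwards [Ioo_mem_nhdsLT hr] with r' hr'
  exact hmain r' hr'

/-- A weak form of the Koebe quarter theorem. -/
theorem mul_norm_deriv_le_of_injOn {f : ℂ → ℂ} {c : ℂ} {r : ℝ} (hr : 0 < r)
    (hd : DifferentiableOn ℂ f (ball c r)) (hinj : InjOn f (ball c r)) {p : ℂ}
    (hp : ∀ z ∈ ball c r, f z ≠ p) : r * ‖deriv f c‖ ≤ 404 * ‖f c - p‖ := by
  have h0 : ∀ z ∈ ball c r, f z - p ≠ 0 := fun z hz => sub_ne_zero.2 (hp z hz)
  have hc := mem_ball_self (x := c) hr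
  obtain ⟨h, -, hh⟩ := exists_log_branch_ball hr (hd.sub_const p) h0 (Complex.exp_log (h0 c hc))
  -- Two values of `log (f - p)` differing by `2πi` would come from equal values of `f`, hence from
  -- the same point.
  have hb := mul_norm_deriv_le_of_sub_ne hr
    (fun z hz => (hh z hz).1.differentiableAt.differentiableWithinAt) (fun z hz w hw he => by
      have h1 : h z = h w + 2 * Real.pi * Complex.I := by linear_combination he
      have h2 : f z - p = f w - p := by
        rw [← (hh z hz).2, ← (hh w hw).2, h1, Complex.exp_add, Complex.exp_two_pi_mul_I, mul_one]
      have h3 : z = w := hinj hz hw (by linear_combination h2)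
      rw [h3, sub_self] at he
      exact Complex.two_pi_I_ne_zero he.symm)
  rw [(hh c hc).1.deriv, norm_div, deriv_sub_const, ← mul_div_assoc,
    div_le_iff₀ (norm_pos_iff.2 (h0 c hc))] at hb
  refine hb.trans ?_
  -- `128 π < 128 · 3.15 = 403.2`, the source of the constant 404.
  have := Real.pi_lt_d2
  gcongr
  linarith

/-- A weak form of the growth theorem for univalent functions. -/
theorem norm_sub_le_of_injOn {f : ℂ → ℂ} {c : ℂ} {r : ℝ} (hr : 0 < r)
    (hd : DifferentiableOn ℂ f (ball c r)) (hinj : InjOn f (ball c r)) (hf' : deriv f c ≠ 0) {w : ℂ}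
    (hw : ‖w - c‖ ≤ r / 2) : ‖f w - f c‖ ≤ 404 ^ 2 * ‖deriv f c‖ * ‖w - c‖ := by
  have hc := mem_ball_self (x := c) hr
  have hf0 : 0 < ‖deriv f c‖ := norm_pos_iff.2 hf'
  set q : ℂ → ℂ := fun z => dslope f c z / deriv f c with hq
  have hqd : DifferentiableOn ℂ q (ball c r) :=
    ((Complex.differentiableOn_dslope (isOpen_ball.mem_nhds hc)).2 hd).div_const _
  have hqc : q c = 1 := by simp [hq, hf']
  -- On the disc of radius `‖z - c‖` the value `f z` is omitted, so the weak Koebe theorem with `p =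
  -- f z` bounds the difference quotient below.
  have hlow : ∀ z ∈ ball c r, 1 / 404 ≤ ‖q z‖ := by
    intro z hz
    by_cases hzc : z = c
    · rw [hzc, hqc]; norm_num
    have hpos : 0 < ‖z - c‖ := norm_pos_iff.2 (sub_ne_zero.2 hzc)
    have hsub : ball c ‖z - c‖ ⊆ ball c r := ball_subset_ball (by
      rw [mem_ball, dist_eq_norm] at hz; exact hz.le)
    have := mul_norm_deriv_le_of_injOn hpos (hd.mono hsub) (hinj.mono hsub) (p := f z)
      (fun x hx he => by
        have := hinj (hsub hx) hz he
        rw [this, mem_ball, dist_eq_norm] at hx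
        exact lt_irrefl _ hx)
    simp only [hq]
    rw [dslope_of_ne _ hzc, slope_def_field, norm_div, norm_div, div_div,
      div_le_div_iff₀ (by norm_num) (by positivity), norm_sub_rev (f z)]
    linarith
  have hq0 : ∀ z ∈ ball c r, q z ≠ 0 := fun z hz h => by
    have := hlow z hz
    rw [h, norm_zero] at this
    norm_num at this
  obtain ⟨h, hhc, hh⟩ := exists_log_branch_ball hr hqd hq0 (l := 0) (by rw [hqc, Complex.exp_zero])
  have hlog : 0 < Real.log 404 := Real.log_pos (by norm_num)
  have hshift : ∀ x ∈ ball (0 : ℂ) r, c + x ∈ ball c r := fun x hx => by simpa using hx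
  -- The lower bound on `|q|` is an upper bound on the real part of `-log q`; Borel–Carathéodory
  -- turns it into a two-sided bound at half the radius.
  have hbc := Complex.borelCaratheodory_zero (f := fun x => -h (c + x)) (M := Real.log 404) (R := r)
    (z := w - c) hlog
    (fun x hx => by
      have h1 := (hh (c + x) (hshift x hx)).1.differentiableAt
      exact ((h1.comp x (by fun_prop)).neg).differentiableWithinAt)
    (fun x hx => by
      have h1 := hlow _ (hshift x hx)
      rw [← (hh _ (hshift x hx)).2, Complex.norm_exp, one_div, ← Real.exp_log (show (0:ℝ) < 404 by norm_num),
        ← Real.exp_neg, Real.exp_le_exp] at h1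
      simp only [mem_ofPred_eq, Complex.neg_re]
      linarith)
    hr (by rw [mem_ball_zero_iff]; linarith) (by simp [hhc])
  have hwb : w ∈ ball c r := by rw [mem_ball, dist_eq_norm]; linarith
  have hle : ‖h w‖ ≤ 2 * Real.log 404 := by
    have e : c + (w - c) = w := by ring
    rw [norm_neg, e] at hbc
    refine hbc.trans ?_
    rw [div_le_iff₀ (by linarith)]
    nlinarith
  have hqw : ‖q w‖ ≤ 404 ^ 2 := by
    rw [← (hh w hwb).2, Complex.norm_exp]
    calc Real.exp (h w).re ≤ Real.exp (2 * Real.log 404) :=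
          Real.exp_le_exp.2 ((Complex.re_le_norm _).trans hle)
      _ = 404 ^ 2 := by
          rw [two_mul, Real.exp_add, Real.exp_log (by norm_num)]; norm_num
  by_cases hwc : w = c
  · simp [hwc]
  have hpos : 0 < ‖w - c‖ := norm_pos_iff.2 (sub_ne_zero.2 hwc)
  simp only [hq] at hqw
  rw [dslope_of_ne _ hwc, slope_def_field, norm_div, norm_div, div_div,
    div_le_iff₀ (by positivity)] at hqw
  linarith

/-- Cauchy's estimate on the circle of radius `r / 4` about `w`, which stays within `r / 2` of `c`,
where the growth bound holds. -/
theorem norm_deriv_le_of_injOn {f : ℂ → ℂ} {c : ℂ} {r : ℝ} (hr : 0 < r)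
    (hd : DifferentiableOn ℂ f (ball c r)) (hinj : InjOn f (ball c r)) (hf' : deriv f c ≠ 0) {w : ℂ}
    (hw : ‖w - c‖ ≤ r / 4) : ‖deriv f w‖ ≤ 2 * 404 ^ 2 * ‖deriv f c‖ := by
  have hsub : closedBall w (r / 4) ⊆ ball c r := fun z hz => by
    rw [mem_closedBall, dist_eq_norm] at hz
    rw [mem_ball, dist_eq_norm]
    have := norm_sub_le_norm_sub_add_norm_sub z w c
    linarith
  have := Complex.norm_deriv_le_of_forall_mem_sphere_norm_le (f := fun z => f z - f c) (c := w)
    (R := r / 4) (C := 404 ^ 2 * ‖deriv f c‖ * (r / 2)) (by positivity)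
    (((hd.sub_const _).mono (hsub.trans' closure_ball_subset_closedBall)).diffContOnCl) (by
      intro z hz
      rw [mem_sphere, dist_eq_norm] at hz
      have h1 := norm_sub_le_norm_sub_add_norm_sub z w c
      have h2 : ‖z - c‖ ≤ r / 2 := by linarith
      refine (norm_sub_le_of_injOn hr hd hinj hf' h2).trans ?_
      gcongr)
  rw [deriv_sub_const] at this
  refine this.trans (le_of_eq ?_)
  field_simp; ring

end

/-! ### Distortion in the upper half-plane and length-area for circular arcs. -/

noncomputable section

open Metric

theorem isOpen_upperHalf : IsOpen upperHalf := isOpen_lt continuous_const Complex.continuous_im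

theorem convex_upperHalf : Convex ℝ upperHalf := convex_halfSpace_im_gt 0

theorem ball_im_subset_upperHalf (w : ℂ) : ball w w.im ⊆ upperHalf := by
  intro z hz
  rw [mem_ball, dist_eq_norm] at hz
  have := (Complex.abs_im_le_norm (z - w)).trans_lt hz
  rw [Complex.sub_im, abs_lt] at this
  change 0 < z.im
  linarith

theorem ofReal_mul_I_mem_upperHalf {y : ℝ} (hy : 0 < y) : (y * Complex.I : ℂ) ∈ upperHalf := by
  simpa [upperHalf] using hy

theorem exists_mem_eq_of_closure {X : Type*} [TopologicalSpace X] {S : Set X}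
    (hS : IsPreconnected S) {φ : X → ℝ}
    (hφ : Continuous φ) {p q : X} (hp : p ∈ closure S) (hq : q ∈ closure S) {c : ℝ}
    (hpc : φ p < c) (hcq : c < φ q) : ∃ w ∈ S, φ w = c := by
  obtain ⟨p', hp', hpS⟩ := mem_closure_iff.1 hp _ (isOpen_lt hφ continuous_const) hpc
  obtain ⟨q', hq', hqS⟩ := mem_closure_iff.1 hq _ (isOpen_lt continuous_const hφ) hcq
  exact hS.intermediate_value hpS hqS hφ.continuousOn ⟨le_of_lt hp', le_of_lt hq'⟩

/-- The constant in the distortion estimates. -/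
def distortionConst : ℝ := 2 * 404 ^ 2

theorem one_le_distortionConst : 1 ≤ distortionConst := by
  unfold distortionConst; norm_num

/-- A conformal map of the upper half-plane onto its image. -/
structure IsUnivalent (F : ℂ → ℂ) : Prop where
  differentiableOn : DifferentiableOn ℂ F upperHalf
  injOn : InjOn F upperHalf
  deriv_ne_zero : ∀ w ∈ upperHalf, deriv F w ≠ 0

namespace IsUnivalent

theorem im_mul_norm_deriv_le {F : ℂ → ℂ} (hF : IsUnivalent F) {p : ℂ} (hp : p ∉ F '' upperHalf)
    {w : ℂ} (hw : w ∈ upperHalf) : w.im * ‖deriv F w‖ ≤ 404 * ‖F w - p‖ :=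
  mul_norm_deriv_le_of_injOn hw (hF.differentiableOn.mono (ball_im_subset_upperHalf w))
    (hF.injOn.mono (ball_im_subset_upperHalf w))
    fun z hz he => hp ⟨z, ball_im_subset_upperHalf w hz, he⟩

theorem norm_deriv_le {F : ℂ → ℂ} (hF : IsUnivalent F) {w w₀ : ℂ} (hw₀ : w₀ ∈ upperHalf)
    (h : ‖w - w₀‖ ≤ w₀.im / 4) : ‖deriv F w‖ ≤ distortionConst * ‖deriv F w₀‖ :=
  norm_deriv_le_of_injOn hw₀ (hF.differentiableOn.mono (ball_im_subset_upperHalf w₀))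
    (hF.injOn.mono (ball_im_subset_upperHalf w₀)) (hF.deriv_ne_zero w₀ hw₀) h

/-- Chain `n` one-step distortion estimates along the segment from `w₀` to `w`, which stays at
height at least `m`. -/
theorem norm_deriv_le_pow {F : ℂ → ℂ} (hF : IsUnivalent F) {m : ℝ} (hm : 0 < m) (n : ℕ) {w₀ : ℂ}
    (hw₀ : m ≤ w₀.im) {w : ℂ} (hw : m ≤ w.im) (h : ‖w - w₀‖ ≤ n * (m / 4)) :
    ‖deriv F w‖ ≤ distortionConst ^ n * ‖deriv F w₀‖ := by
  induction n generalizing w with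
  | zero =>
    have : w = w₀ := by simpa [sub_eq_zero] using h
    simp [this]
  | succ n ih =>
    -- The remaining fraction `1 / (n + 1)` of the segment has length at most `m / 4`, one
    -- admissible step.
    set t : ℝ := n / (n + 1) with ht
    have ht0 : 0 ≤ t := by positivity
    have ht1 : t ≤ 1 := by rw [ht, div_le_one (by positivity)]; linarith
    have h1t : 1 - t = 1 / (n + 1) := by rw [ht]; field_simp; ring
    set w' : ℂ := w₀ + (t : ℂ) * (w - w₀) with hw'
    have him : w'.im = (1 - t) * w₀.im + t * w.im := by
      simp [hw']; ring
    have hm' : m ≤ w'.im := by rw [him]; nlinarith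
    have hd0 : w' - w₀ = (t : ℂ) * (w - w₀) := by rw [hw']; ring
    have hd1 : w - w' = ((1 - t : ℝ) : ℂ) * (w - w₀) := by rw [hw']; push_cast; ring
    have hn : (0 : ℝ) < n + 1 := by positivity
    push_cast at h
    have h1 : ‖w' - w₀‖ ≤ n * (m / 4) := by
      rw [hd0, norm_mul, Complex.norm_real, Real.norm_eq_abs, abs_of_nonneg ht0, ht,
        div_mul_eq_mul_div, div_le_iff₀ hn]
      nlinarith [mul_le_mul_of_nonneg_left h (Nat.cast_nonneg (α := ℝ) n)]
    have h2 : ‖w - w'‖ ≤ w'.im / 4 := by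
      rw [hd1, norm_mul, Complex.norm_real, Real.norm_eq_abs, abs_of_nonneg (by linarith), h1t,
        div_mul_eq_mul_div, one_mul, div_le_iff₀ hn]
      nlinarith
    have h3 := ih hm' h1
    have h4 := hF.norm_deriv_le (hm.trans_le hm') h2
    have h5 := one_le_distortionConst
    calc _ ≤ _ := h4
      _ ≤ distortionConst * (distortionConst ^ n * ‖deriv F w₀‖) := by gcongr
      _ = _ := by ring

theorem norm_sub_le_pow {F : ℂ → ℂ} (hF : IsUnivalent F) {m : ℝ} (hm : 0 < m) (n : ℕ) {w₀ : ℂ}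
    (hw₀ : m ≤ w₀.im) {w : ℂ} (hw : m ≤ w.im) (h : ‖w - w₀‖ ≤ n * (m / 4)) :
    ‖F w - F w₀‖ ≤ distortionConst ^ n * ‖deriv F w₀‖ * ‖w - w₀‖ := by
  have hconv : Convex ℝ ({z : ℂ | m ≤ z.im} ∩ closedBall w₀ (n * (m / 4))) :=
    (convex_halfSpace_im_ge m).inter (convex_closedBall _ _)
  refine hconv.norm_image_sub_le_of_norm_deriv_le (𝕜 := ℂ) ?_ ?_ ?_ ?_
  · intro z hz
    exact hF.differentiableOn.differentiableAt (isOpen_upperHalf.mem_nhds (hm.trans_le hz.1))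
  · intro z hz
    exact hF.norm_deriv_le_pow hm n hw₀ hz.1 (by simpa [dist_eq_norm] using hz.2)
  · exact ⟨hw₀, mem_closedBall_self (by positivity)⟩
  · exact ⟨hw, by simpa [dist_eq_norm] using h⟩

/-- Along the imaginary axis, `|F'|` changes at most polynomially. -/
theorem exists_norm_deriv_le_rpow {F : ℂ → ℂ} (hF : IsUnivalent F) :
    ∃ κ : ℝ, 0 ≤ κ ∧ ∀ y ρ r : ℝ, 0 < y → 0 < ρ → ρ ≤ r * y → y ≤ r * ρ →
      ‖deriv F (ρ * Complex.I)‖ ≤ distortionConst * r ^ κ * ‖deriv F (y * Complex.I)‖ := by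
  have hC := one_le_distortionConst
  have hC0 : 0 < distortionConst := by linarith
  have hstep : ∀ (y q : ℝ), 0 < y → 4 / 5 ≤ q → q ≤ 5 / 4 → ∀ k : ℕ,
      ‖deriv F ((y * q ^ k : ℝ) * Complex.I)‖ ≤
        distortionConst ^ k * ‖deriv F (y * Complex.I)‖ := by
    intro y q hy hq1 hq2 k
    have hq0 : 0 < q := by linarith
    induction k with
    | zero => simp
    | succ k ih =>
      have hyk : 0 < y * q ^ k := by positivity
      have h1 := hF.norm_deriv_le (w := ((y * q ^ (k + 1) : ℝ) * Complex.I))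
        (w₀ := ((y * q ^ k : ℝ) * Complex.I)) (ofReal_mul_I_mem_upperHalf hyk) (by
          rw [← sub_mul, norm_mul, Complex.norm_I, mul_one, ← Complex.ofReal_sub,
            Complex.norm_real, Real.norm_eq_abs]
          have e : (((y * q ^ k : ℝ) : ℂ) * Complex.I).im = y * q ^ k := by
            rw [Complex.mul_I_im, Complex.ofReal_re]
          rw [e, pow_succ, ← mul_assoc, ← mul_sub_one, abs_mul, abs_of_pos hyk, div_eq_mul_inv]
          gcongr
          rw [abs_le]; constructor <;> linarith)
      calc _ ≤ _ := h1
        _ ≤ distortionConst * (distortionConst ^ k * ‖deriv F (y * Complex.I)‖) := by gcongr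
        _ = _ := by ring
  -- Chosen so that `(5 / 4) ^ κ = distortionConst`: each step of ratio up to `5 / 4` costs one
  -- factor of the constant.
  set κ := Real.log distortionConst / Real.log (5 / 4) with hκ
  have hlog : 0 < Real.log (5 / 4) := Real.log_pos (by norm_num)
  have hκ0 : 0 ≤ κ := div_nonneg (Real.log_nonneg hC) hlog.le
  refine ⟨κ, hκ0, fun y ρ r hy hρ h1 h2 => ?_⟩
  have hr : 1 ≤ r := by
    by_contra hr
    push Not at hr
    have : r * y < y := by nlinarith
    have : r * ρ < ρ := by nlinarith
    linarith
  obtain ⟨n, hn1, hn2⟩ := exists_nat_pow_near hr (show (1 : ℝ) < 5 / 4 by norm_num)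
  -- Going from `y` to `ρ` in `n + 1` equal geometric steps, where `(5/4)^n ≤ r < (5/4)^(n+1)`,
  -- keeps the ratio within `[4/5, 5/4]`. The extra step is the factor `distortionConst` outside `r
  -- ^ κ`.
  set q : ℝ := (ρ / y) ^ (1 / ((n : ℝ) + 1)) with hq
  have hn0 : (0 : ℝ) < (n : ℝ) + 1 := by positivity
  have hqpow : q ^ (n + 1) = ρ / y := by
    rw [hq, ← Real.rpow_natCast, ← Real.rpow_mul (by positivity)]
    push_cast
    rw [one_div_mul_cancel hn0.ne', Real.rpow_one]
  have hq0 : 0 < q := by positivity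
  have hq2 : q ≤ 5 / 4 := by
    by_contra hcon
    push Not at hcon
    have := pow_lt_pow_left₀ hcon (by norm_num) (Nat.succ_ne_zero n)
    rw [Nat.succ_eq_add_one, hqpow, lt_div_iff₀ hy] at this
    nlinarith
  have hq1 : 4 / 5 ≤ q := by
    by_contra hcon
    push Not at hcon
    have h3 := pow_lt_pow_left₀ hcon hq0.le (Nat.succ_ne_zero n)
    rw [Nat.succ_eq_add_one, hqpow, div_lt_iff₀ hy] at h3
    have h4 : (4 / 5 : ℝ) ^ (n + 1) * (5 / 4) ^ (n + 1) = 1 := by rw [← mul_pow]; norm_num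
    have h5 : 0 < (4 / 5 : ℝ) ^ (n + 1) := by positivity
    have h6 : y < (5 / 4) ^ (n + 1) * ρ := h2.trans_lt (by gcongr)
    have h7 : (4 / 5 : ℝ) ^ (n + 1) * y < (4 / 5 : ℝ) ^ (n + 1) * ((5 / 4) ^ (n + 1) * ρ) := by
      gcongr
    rw [← mul_assoc, h4] at h7
    linarith
  have h3 := hstep y q hy hq1 hq2 (n + 1)
  have h4 : y * q ^ (n + 1) = ρ := by rw [hqpow]; field_simp
  rw [h4] at h3
  refine h3.trans ?_
  gcongr
  rw [pow_succ, mul_comm]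
  gcongr
  have h5 : distortionConst = (5 / 4 : ℝ) ^ κ := by
    rw [Real.rpow_def_of_pos (by norm_num), hκ, mul_div_cancel₀ _ hlog.ne', Real.exp_log hC0]
  calc distortionConst ^ n = ((5 / 4 : ℝ) ^ n) ^ κ := by
        rw [h5, ← Real.rpow_natCast, ← Real.rpow_mul (by norm_num), ← Real.rpow_natCast,
          ← Real.rpow_mul (by norm_num), mul_comm]
    _ ≤ r ^ κ := by gcongr

/-- Length-area estimate for arcs of circles about `0` joining a set `S` to the imaginary axis. -/
theorem log_mul_log_le_of_arcs {F : ℂ → ℂ} (hF : IsUnivalent F) {S : Set ℂ} (hS : S ⊆ upperHalf)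
    {p : ℂ} {a b r₁ r₂ : ℝ} (ha : 0 < a) (hab : a < b) (hr₁ : 0 < r₁) (hr : r₁ < r₂)
    (hit : ∀ ρ ∈ Ioo r₁ r₂, ∃ w ∈ S, ‖w‖ = ρ)
    (h : ((∀ w ∈ S, ‖F w - p‖ ≤ a) ∧ ∀ ρ ∈ Ioo r₁ r₂, b ≤ ‖F (ρ * Complex.I) - p‖) ∨
      ((∀ w ∈ S, b ≤ ‖F w - p‖) ∧ ∀ ρ ∈ Ioo r₁ r₂, ‖F (ρ * Complex.I) - p‖ ≤ a)) :
    Real.log (r₂ / r₁) * Real.log (b / a) ≤ 2 * Real.pi ^ 2 := by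
  -- Under `z ↦ exp (i z)` the horizontal line at height `θ` in this strip becomes the semicircle of
  -- radius `e^(-θ)`. The strip has width `π`, and the radii `(r₁, r₂)` fill height `log (r₂ / r₁)`.
  set Ω : Set ℂ := {z | 0 < z.re ∧ z.re < Real.pi} with hΩ
  have hΩo : IsOpen Ω := (isOpen_lt continuous_const Complex.continuous_re).inter
    (isOpen_lt Complex.continuous_re continuous_const)
  set e : ℂ → ℂ := fun z => Complex.exp (Complex.I * z) with he
  have hmaps : MapsTo e Ω upperHalf := by
    intro z hz
    change 0 < (Complex.exp (Complex.I * z)).im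
    rw [Complex.exp_im]
    have : (Complex.I * z).im = z.re := by simp
    rw [this]
    exact mul_pos (Real.exp_pos _) (Real.sin_pos_of_pos_of_lt_pi hz.1 hz.2)
  have hed : Differentiable ℂ e := by fun_prop
  have heinj : InjOn e Ω := by
    intro z hz w hw hzw
    obtain ⟨k, hk⟩ := Complex.exp_eq_exp_iff_exists_int.1 hzw
    have h1 : z = w + k * (2 * Real.pi) := by
      have : Complex.I * (z - (w + k * (2 * Real.pi))) = 0 := by linear_combination hk
      rcases mul_eq_zero.1 this with h0 | h0
      · exact absurd h0 Complex.I_ne_zero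
      · linear_combination h0
    have h2 : z.re = w.re + k * (2 * Real.pi) := by
      have := congrArg Complex.re h1
      simpa using this
    have hpi := Real.pi_pos
    have hk0 : k = 0 := by
      have h3 : (k : ℝ) * (2 * Real.pi) < Real.pi := by linarith [hz.2, hw.1]
      have h4 : -Real.pi < (k : ℝ) * (2 * Real.pi) := by linarith [hz.1, hw.2]
      have h5 : (k : ℝ) < 1 := by nlinarith
      have h6 : (-1 : ℝ) < k := by nlinarith
      have h7 : k < 1 := by exact_mod_cast h5
      have h8 : -1 < k := by exact_mod_cast h6
      omega
    rw [h1, hk0]; simp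
  have hpi := Real.pi_pos
  have hr₂ : 0 < r₂ := hr₁.trans hr
  have hpolar : ∀ ρ φ : ℝ, 0 < ρ → e ⟨φ, -Real.log ρ⟩ = ρ * Complex.exp (φ * Complex.I) := by
    intro ρ φ hρ
    have : Complex.I * (⟨φ, -Real.log ρ⟩ : ℂ) = (Real.log ρ : ℝ) + φ * Complex.I := by
      apply Complex.ext <;> simp
    rw [he]; simp only
    rw [this, Complex.exp_add, ← Complex.ofReal_exp, Real.exp_log hρ]
  have key := length_area (Φ := F ∘ e) hΩo (hF.differentiableOn.comp hed.differentiableOn hmaps)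
    (hF.injOn.comp heinj hmaps) (p := p) (a := a) (b := b) (θ₁ := -Real.log r₂)
    (θ₂ := -Real.log r₁) (s₁ := 0) (s₂ := Real.pi) ha hab
    (neg_lt_neg (Real.log_lt_log hr₁ hr)) hpi.le (by
      intro θ hθ
      set ρ := Real.exp (-θ) with hρ
      have hρ0 : 0 < ρ := Real.exp_pos _
      have hρm : ρ ∈ Ioo r₁ r₂ := by
        constructor
        · rw [hρ, ← Real.log_lt_iff_lt_exp hr₁]; linarith [hθ.2]
        · rw [hρ, ← Real.lt_log_iff_exp_lt hr₂]; linarith [hθ.1]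
      have hθρ : θ = -Real.log ρ := by rw [hρ, Real.log_exp, neg_neg]
      obtain ⟨w, hwS, hwρ⟩ := hit ρ hρm
      have hw0 : 0 < w.im := hS hwS
      have harg : w.arg ∈ Ioo 0 Real.pi := by
        have h0 : 0 ≤ w.arg := Complex.arg_nonneg_iff.2 hw0.le
        refine ⟨h0.lt_of_ne fun h0 => ?_, (Complex.arg_le_pi w).lt_of_ne fun h0 => ?_⟩
        · have := (Complex.arg_eq_zero_iff.1 h0.symm).2; linarith
        · have := (Complex.arg_eq_pi_iff.1 h0).2; linarith
      have hew : e ⟨w.arg, θ⟩ = w := by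
        rw [hθρ, hpolar ρ _ hρ0, ← hwρ, Complex.norm_mul_exp_arg_mul_I]
      have hei : e ⟨Real.pi / 2, θ⟩ = ρ * Complex.I := by
        rw [hθρ, hpolar ρ _ hρ0]
        congr 1
        push_cast
        exact Complex.exp_pi_div_two_mul_I
      have hseg : ∀ s ∈ Icc (min w.arg (Real.pi / 2)) (max w.arg (Real.pi / 2)),
          (⟨s, θ⟩ : ℂ) ∈ Ω := fun s hs =>
        ⟨(lt_min harg.1 (by positivity)).trans_le hs.1, hs.2.trans_lt (max_lt harg.2 (by linarith))⟩
      refine ⟨min w.arg (Real.pi / 2), max w.arg (Real.pi / 2),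
        (lt_min harg.1 (by positivity)).le, min_le_max, (max_lt harg.2 (by linarith)).le, hseg, ?_⟩
      rcases le_total w.arg (Real.pi / 2) with hle | hle
      · rw [min_eq_left hle, max_eq_right hle]
        simp only [Function.comp_apply, hew, hei]
        rcases h with ⟨h1, h2⟩ | ⟨h1, h2⟩
        · exact Or.inl ⟨h1 w hwS, h2 ρ hρm⟩
        · exact Or.inr ⟨h2 ρ hρm, h1 w hwS⟩
      · rw [min_eq_right hle, max_eq_left hle]
        simp only [Function.comp_apply, hew, hei]
        rcases h with ⟨h1, h2⟩ | ⟨h1, h2⟩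
        · exact Or.inr ⟨h1 w hwS, h2 ρ hρm⟩
        · exact Or.inl ⟨h2 ρ hρm, h1 w hwS⟩)
  have e1 : -Real.log r₁ - -Real.log r₂ = Real.log (r₂ / r₁) := by
    rw [Real.log_div hr₂.ne' hr₁.ne']; ring
  rw [e1] at key
  linarith

end IsUnivalent

end

/-! ### Three estimates relating a crosscut to the derivative on the axis. -/

noncomputable section

open Metric

namespace IsUnivalent

/-- With `2π² < 20`, arcs filling radii of ratio `2` can only cross annuli with `log (b / a) < 30`.
This is where `exp 30` comes from. -/
theorem log_two_gt : (0.69 : ℝ) < Real.log 2 := by linarith [Real.log_two_gt_d9]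

theorem pi_sq_lt : Real.pi ^ 2 < 10 := by nlinarith [Real.pi_lt_d2, Real.pi_pos]

theorem le_exp_thirty : (256 : ℝ) ≤ Real.exp 30 := by
  have := Real.add_one_le_exp (15 : ℝ)
  have h8 : Real.exp 30 = Real.exp 15 * Real.exp 15 := by rw [← Real.exp_add]; norm_num
  rw [h8]
  nlinarith only [this]

theorem le_exp_mul_of_log_le {a b C : ℝ} (ha : 0 < a) (hb : 0 < b) (h : Real.log (b / a) ≤ C) :
    b ≤ Real.exp C * a := by
  rw [Real.log_le_iff_le_exp (by positivity), div_le_iff₀ ha] at h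
  exact h

theorem exists_norm_eq_of_closure {S : Set ℂ} (hS : IsPreconnected S) {r₁ r₂ : ℝ} {x w : ℂ}
    (hx : x ∈ closure S) (hxr : ‖x‖ ≤ r₁) (hw : w ∈ S) (hwr : r₂ ≤ ‖w‖) :
    ∀ ρ ∈ Ioo r₁ r₂, ∃ w ∈ S, ‖w‖ = ρ := fun _ hρ =>
  exists_mem_eq_of_closure hS continuous_norm hx (subset_closure hw) (hxr.trans_lt hρ.1)
    (hρ.2.trans_le hwr)

/-- A crosscut with endpoints `x₁ ≤ 0 ≤ x₂` at distance `R`, whose image is within `ε` of an omitted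
value, forces `R |F'(iR)| ≲ ε`. -/
theorem mul_norm_deriv_le_of_crosscut {F : ℂ → ℂ} (hF : IsUnivalent F) {p : ℂ}
    (hp : p ∉ F '' upperHalf) {S : Set ℂ} (hS : S ⊆ upperHalf) (hSc : IsPreconnected S)
    {ε x₁ x₂ : ℝ} (hε : 0 < ε) (hSε : ∀ w ∈ S, ‖F w - p‖ ≤ ε) (hx₁ : x₁ ≤ 0) (hx₂ : 0 ≤ x₂)
    (hx : x₁ < x₂) (h₁ : (x₁ : ℂ) ∈ closure S) (h₂ : (x₂ : ℂ) ∈ closure S) :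
    (x₂ - x₁) * ‖deriv F ((x₂ - x₁ : ℝ) * Complex.I)‖ ≤
      404 * distortionConst ^ 16 * Real.exp 30 * ε := by
  set R := x₂ - x₁ with hR
  have hR0 : 0 < R := by linarith
  have hC := one_le_distortionConst
  set b := R * ‖deriv F (R * Complex.I)‖ / (404 * distortionConst ^ 16) with hb
  have hRm := ofReal_mul_I_mem_upperHalf hR0
  have hd0 : 0 < ‖deriv F (R * Complex.I)‖ := norm_pos_iff.2 (hF.deriv_ne_zero _ hRm)
  have hb0 : 0 < b := by positivity
  suffices hmain : b ≤ Real.exp 30 * ε by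
    rw [hb, div_le_iff₀ (by positivity)] at hmain
    linarith
  -- Koebe at `w` for the omitted value `p`, after comparing `F'(iR)` with `F'(w)`: the distance
  -- `4R` is 16 steps of length `R / 4`.
  have hlow : ∀ w : ℂ, R ≤ w.im → ‖w - R * Complex.I‖ ≤ 4 * R → b ≤ ‖F w - p‖ := by
    intro w hw hwR
    have h1 := hF.norm_deriv_le_pow hR0 16 (w₀ := w) hw (w := R * Complex.I) (by simp)
      (by rw [norm_sub_rev]; push_cast; linarith)
    have h2 := hF.im_mul_norm_deriv_le hp (w := w) (hR0.trans_le hw)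
    rw [hb, div_le_iff₀ (by positivity)]
    have hw0 : 0 < w.im := hR0.trans_le hw
    calc R * ‖deriv F (R * Complex.I)‖ ≤ w.im * (distortionConst ^ 16 * ‖deriv F w‖) := by gcongr
      _ = distortionConst ^ 16 * (w.im * ‖deriv F w‖) := by ring
      _ ≤ distortionConst ^ 16 * (404 * ‖F w - p‖) := by gcongr
      _ = _ := by ring
  rcases le_or_gt b ε with hbε | hεb
  · exact hbε.trans (le_mul_of_one_le_left hε.le (Real.one_le_exp (by norm_num)))
  refine le_exp_mul_of_log_le hε hb0 ?_
  have hLpos : 0 < Real.log (b / ε) := Real.log_pos ((one_lt_div hε).2 hεb)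
  have hpi := pi_sq_lt
  -- A crosscut reaching radius `2R` meets all circles of radius in `(R, 2R)`. Otherwise it lies
  -- below height `2R` and every vertical line over `(x₁, x₂)` meets it.
  by_cases hcase : ∃ w ∈ S, 2 * R ≤ ‖w‖
  · obtain ⟨w, hw, hwR⟩ := hcase
    have hhit := exists_norm_eq_of_closure hSc (r₁ := R) h₂ (by
      rw [Complex.norm_real, Real.norm_eq_abs, abs_of_nonneg hx₂]; linarith) hw hwR
    have := hF.log_mul_log_le_of_arcs hS (p := p) hε hεb hR0 (by linarith) hhit
      (Or.inl ⟨hSε, fun ρ hρ => hlow _ (by simpa using hρ.1.le) (by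
        rw [← sub_mul, norm_mul, Complex.norm_I, mul_one, ← Complex.ofReal_sub, Complex.norm_real,
          Real.norm_eq_abs, abs_of_pos (by linarith [hρ.1])]
        linarith [hρ.2])⟩)
    have e : 2 * R / R = 2 := by field_simp
    rw [e] at this
    nlinarith [log_two_gt]
  · push Not at hcase
    have hmaps : MapsTo (fun z => Complex.I * z) {z : ℂ | 0 < z.re} upperHalf := fun z hz => by
      change 0 < (Complex.I * z).im
      simpa using hz
    -- Multiplication by `i` turns horizontal segments into the vertical ones from the crosscut up
    -- to height `2R`; the family has total width `R`, whence `log (b / ε) ≤ 4π`.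
    have key := length_area (Φ := F ∘ fun z => Complex.I * z) (Ω := {z : ℂ | 0 < z.re})
      (isOpen_lt continuous_const Complex.continuous_re)
      (hF.differentiableOn.comp (by fun_prop) hmaps)
      (hF.injOn.comp (fun z _ w _ h => mul_left_cancel₀ Complex.I_ne_zero h) hmaps)
      (p := p) (θ₁ := -x₂) (θ₂ := -x₁) (s₁ := 0) (s₂ := 2 * R) hε hεb (by linarith) (by linarith) (by
        intro θ hθ
        obtain ⟨w, hwS, hwθ⟩ := exists_mem_eq_of_closure hSc Complex.continuous_re h₁ h₂ (c := -θ)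
          (by rw [Complex.ofReal_re]; linarith [hθ.2]) (by rw [Complex.ofReal_re]; linarith [hθ.1])
        have hw0 : 0 < w.im := hS hwS
        have hw1 : w.im ≤ 2 * R :=
          ((le_abs_self _).trans (Complex.abs_im_le_norm w)).trans (hcase w hwS).le
        have e1 : Complex.I * (⟨w.im, θ⟩ : ℂ) = w := by
          apply Complex.ext <;> simp [hwθ]
        refine ⟨w.im, 2 * R, hw0.le, hw1, le_rfl, fun s hs => hw0.trans_le hs.1, Or.inl ⟨?_, ?_⟩⟩
        · simp only [Function.comp_apply, e1]; exact hSε w hwS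
        · simp only [Function.comp_apply]
          refine hlow _ (by simp; linarith) ?_
          have e2 : Complex.I * (⟨2 * R, θ⟩ : ℂ) - R * Complex.I =
              ((-θ : ℝ) : ℂ) + ((R : ℝ) : ℂ) * Complex.I := by
            apply Complex.ext <;> simp
            ring
          rw [e2]
          refine (norm_add_le _ _).trans ?_
          rw [norm_mul, Complex.norm_I, Complex.norm_real, Complex.norm_real, Real.norm_eq_abs,
            Real.norm_eq_abs, abs_of_pos hR0]
          have : |(-θ)| ≤ R := by rw [abs_le]; constructor <;> linarith [hθ.1, hθ.2]
          linarith)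
    have e3 : -x₁ - -x₂ = R := by rw [hR]; ring
    rw [e3, sub_zero] at key
    have h4 : Real.log (b / ε) ≤ 4 * Real.pi := by
      have : R * Real.log (b / ε) ≤ R * (4 * Real.pi) := by linarith
      exact le_of_mul_le_mul_left this hR0
    linarith [Real.pi_lt_d2]

/-- If `F(is)` is within `e⁻³⁰ ε` of `p` for `s ≤ y`, then a crosscut on which `|F - p| = ε` and that
meets the imaginary axis has size at least `y / 2`. -/
theorem half_le_of_crosscut {F : ℂ → ℂ} (hF : IsUnivalent F) {p : ℂ}
    {S : Set ℂ} (hS : S ⊆ upperHalf) (hSc : IsPreconnected S)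
    {ε x y : ℝ} (hε : 0 < ε) (hSε : ∀ w ∈ S, ‖F w - p‖ = ε)
    (hx : (x : ℂ) ∈ closure S) {y₀ : ℝ} (hy₀ : 0 < y₀) (hy₀S : (y₀ * Complex.I : ℂ) ∈ S) (hy : 0 < y)
    (hc : ∀ s ∈ Ioc 0 y, ‖F (s * Complex.I) - p‖ ≤ Real.exp (-30) * ε) : y / 2 ≤ |x| := by
  by_contra hlt
  push Not at hlt
  have hexp : Real.exp (-30) < 1 := by
    simp
  have hy₀y : y < y₀ := by
    by_contra hle
    have h1 := hc y₀ ⟨hy₀, not_lt.1 hle⟩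
    rw [hSε _ hy₀S] at h1
    nlinarith
  have hhit := exists_norm_eq_of_closure hSc (r₁ := y / 2) (r₂ := y) hx (by
    rw [Complex.norm_real, Real.norm_eq_abs]; exact hlt.le) hy₀S (by
      rw [norm_mul, Complex.norm_I, Complex.norm_real, mul_one, Real.norm_eq_abs,
        abs_of_pos hy₀]; exact hy₀y.le)
  have := hF.log_mul_log_le_of_arcs hS (p := p) (a := Real.exp (-30) * ε) (b := ε) (by positivity)
    (by nlinarith) (by positivity) (by linarith) hhit
    (Or.inr ⟨fun w hw => (hSε w hw).ge, fun ρ hρ => hc ρ ⟨by linarith [hρ.1], hρ.2.le⟩⟩)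
  have e1 : y / (y / 2) = 2 := by field_simp
  have e2 : ε / (Real.exp (-30) * ε) = Real.exp 30 := by
    rw [Real.exp_neg]; field_simp
  rw [e1, e2, Real.log_exp] at this
  -- `30 log 2 > 20 > 2π²`.
  nlinarith [log_two_gt, pi_sq_lt]

/-- If the crosscut is mapped outside the disc of radius `ε` about `F(iy)`, then `y |F'(iy)|` cannot
be too small. -/
theorem mul_pow_le_of_crosscut {F : ℂ → ℂ} (hF : IsUnivalent F) {S : Set ℂ} (hS : S ⊆ upperHalf)
    (hSc : IsPreconnected S) {ε x₁ x₂ y : ℝ} (hε : 0 < ε) (hy : 0 < y)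
    (hSε : ∀ w ∈ S, ε ≤ ‖F w - F (y * Complex.I)‖) (hx₁ : x₁ ≤ 0) (hx₂ : 0 ≤ x₂)
    (hx : x₁ < x₂) (hxy : x₂ - x₁ ≤ y / 2)
    (h₁ : (x₁ : ℂ) ∈ closure S) (h₂ : (x₂ : ℂ) ∈ closure S) :
    ε * (x₂ - x₁) ^ 4 ≤
      4 * distortionConst ^ 32 * Real.exp 30 * (y * ‖deriv F (y * Complex.I)‖) * y ^ 4 := by
  set R := x₂ - x₁ with hR
  have hR0 : 0 < R := by linarith
  have hC := one_le_distortionConst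
  set a := 4 * distortionConst ^ 32 * (y * ‖deriv F (y * Complex.I)‖) with ha
  have hd0 : 0 < ‖deriv F (y * Complex.I)‖ :=
    norm_pos_iff.2 (hF.deriv_ne_zero _ (ofReal_mul_I_mem_upperHalf hy))
  have ha0 : 0 < a := by positivity
  suffices hmain : ε * R ^ 4 ≤ Real.exp 30 * a * y ^ 4 by
    refine hmain.trans (le_of_eq ?_)
    rw [ha]; ring
  have hRy : R ^ 4 ≤ y ^ 4 := by gcongr; linarith
  have hsimple : ε ≤ Real.exp 30 * a → ε * R ^ 4 ≤ Real.exp 30 * a * y ^ 4 := fun h => by gcongr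
  rcases le_or_gt ε a with hle | hlt
  · exact hsimple (hle.trans (le_mul_of_one_le_left ha0.le (Real.one_le_exp (by norm_num))))
  -- At height at least `y / 2`, the distance `4y` is 32 steps of length `y / 8`.
  have hup : ∀ w : ℂ, y / 2 ≤ w.im → ‖w - y * Complex.I‖ ≤ 4 * y → ‖F w - F (y * Complex.I)‖ ≤ a := by
    intro w hw hwy
    refine (hF.norm_sub_le_pow (half_pos hy) 32 (w₀ := y * Complex.I) (by simp; linarith) hw
      (by push_cast; linarith)).trans ?_
    calc _ ≤ distortionConst ^ 32 * ‖deriv F (y * Complex.I)‖ * (4 * y) := by gcongr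
      _ = a := by rw [ha]; ring
  by_cases hcase : ∃ w ∈ S, y ≤ ‖w‖
  · obtain ⟨w, hw, hwy⟩ := hcase
    have hhit := exists_norm_eq_of_closure hSc (r₁ := y / 2) h₂ (by
      rw [Complex.norm_real, Real.norm_eq_abs, abs_of_nonneg hx₂]; linarith) hw hwy
    have := hF.log_mul_log_le_of_arcs hS (p := F (y * Complex.I)) ha0 hlt (by positivity)
      (by linarith) hhit
      (Or.inr ⟨hSε, fun ρ hρ => hup _ (by simpa using hρ.1.le) (by
        rw [← sub_mul, norm_mul, Complex.norm_I, mul_one, ← Complex.ofReal_sub, Complex.norm_real,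
          Real.norm_eq_abs]
        rw [abs_le]; constructor <;> linarith [hρ.1, hρ.2])⟩)
    have e : y / (y / 2) = 2 := by field_simp
    rw [e] at this
    have hLpos : 0 < Real.log (ε / a) := Real.log_pos ((one_lt_div ha0).2 hlt)
    refine hsimple (le_exp_mul_of_log_le ha0 hε ?_)
    nlinarith [log_two_gt, pi_sq_lt]
  · push Not at hcase
    -- The apex of a right-angled cone whose sides pass through `x₁` and `x₂`: every ray from it
    -- with angle in `(π/4, 3π/4)` separates these points, so it meets the crosscut. Rays are
    -- followed out to distance `2y`, where `F` is controlled.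
    set c₀ : ℂ := ⟨(x₁ + x₂) / 2, -(R / 2)⟩ with hc₀
    have hc₀n : ‖c₀‖ ≤ y / 2 := by
      refine (Complex.norm_le_abs_re_add_abs_im c₀).trans ?_
      have h3 : |c₀.re| ≤ R / 2 := by simp only [hc₀]; rw [abs_le]; constructor <;> linarith
      have h4 : |c₀.im| = R / 2 := by simp only [hc₀]; rw [abs_neg, abs_of_pos (by positivity)]
      linarith
    have hpi := Real.pi_pos
    set Ω : Set ℂ := {z | (Real.pi / 4 < z.im ∧ z.im < 3 * Real.pi / 4) ∧
      0 < (c₀ + Complex.exp z).im} with hΩ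
    have hΩo : IsOpen Ω := ((isOpen_lt continuous_const Complex.continuous_im).inter
      (isOpen_lt Complex.continuous_im continuous_const)).inter
      (isOpen_lt continuous_const
        (Complex.continuous_im.comp (continuous_const.add Complex.continuous_exp)))
    have hmaps : MapsTo (fun z => c₀ + Complex.exp z) Ω upperHalf := fun z hz => hz.2
    have heinj : InjOn (fun z => c₀ + Complex.exp z) Ω := by
      intro z hz w hw hzw
      have h3 : Complex.exp z = Complex.exp w := add_left_cancel hzw
      have h4 := Complex.exp_inj_of_neg_pi_lt_of_le_pi (x := z) (y := w)
      exact h4 (by linarith [hz.1.1]) (by linarith [hz.1.2]) (by linarith [hw.1.1])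
        (by linarith [hw.1.2]) h3
    have hsin : ∀ θ ∈ Ioo (Real.pi / 4) (3 * Real.pi / 4), 1 / 2 < Real.sin θ ∧
        |Real.cos θ| < Real.sin θ := by
      intro θ hθ
      have h3 : Real.cos θ ^ 2 < 1 / 2 := by
        have h5 : Real.cos (2 * θ) < 0 :=
          Real.cos_neg_of_pi_div_two_lt_of_lt (by linarith [hθ.1]) (by linarith [hθ.2])
        rw [Real.cos_two_mul] at h5; linarith
      have h4 := Real.sin_sq_add_cos_sq θ
      have h5 : 0 < Real.sin θ :=
        Real.sin_pos_of_pos_of_lt_pi (by linarith [hθ.1]) (by linarith [hθ.2])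
      exact ⟨by nlinarith, abs_lt_of_sq_lt_sq (by linarith) h5.le⟩
    have key := length_area (Φ := F ∘ fun z => c₀ + Complex.exp z) hΩo
      (hF.differentiableOn.comp (by fun_prop) hmaps) (hF.injOn.comp heinj hmaps)
      (p := F (y * Complex.I)) (θ₁ := Real.pi / 4) (θ₂ := 3 * Real.pi / 4)
      (s₁ := Real.log (R / 2)) (s₂ := Real.log (2 * y)) ha0 hlt (by linarith)
      (Real.log_le_log (by positivity) (by linarith)) (by
        intro θ hθ
        obtain ⟨hsθ, hcθ⟩ := hsin θ hθ
        rw [abs_lt] at hcθ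
        obtain ⟨w, hwS, hw⟩ := exists_mem_eq_of_closure hSc
          (φ := fun w : ℂ => (w.re - c₀.re) * Real.sin θ - (w.im - c₀.im) * Real.cos θ)
          (by fun_prop) h₁ h₂ (c := 0) (by
            have e : ((x₁ : ℂ).re - c₀.re) * Real.sin θ - ((x₁ : ℂ).im - c₀.im) * Real.cos θ =
                -(R / 2 * (Real.sin θ + Real.cos θ)) := by simp [hc₀, hR]; ring
            rw [e]
            have : 0 < R / 2 * (Real.sin θ + Real.cos θ) := mul_pos (by linarith) (by linarith)
            linarith) (by
            have e : ((x₂ : ℂ).re - c₀.re) * Real.sin θ - ((x₂ : ℂ).im - c₀.im) * Real.cos θ =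
                R / 2 * (Real.sin θ - Real.cos θ) := by simp [hc₀, hR]; ring
            rw [e]
            exact mul_pos (by linarith) (by linarith))
        set t := (w.re - c₀.re) * Real.cos θ + (w.im - c₀.im) * Real.sin θ with ht
        have hw0 : 0 < w.im := hS hwS
        have hsc := Real.sin_sq_add_cos_sq θ
        have him : w.im - c₀.im = t * Real.sin θ := by
          rw [ht]; linear_combination (-(w.im - c₀.im)) * hsc - Real.cos θ * hw
        have hre : w.re - c₀.re = t * Real.cos θ := by
          rw [ht]; linear_combination (-(w.re - c₀.re)) * hsc + Real.sin θ * hw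
        have him' : w.im - c₀.im = w.im + R / 2 := by simp [hc₀]
        have ht0 : R / 2 < t := by
          have h3 : Real.sin θ ≤ 1 := Real.sin_le_one θ
          by_contra hcon
          push Not at hcon
          rw [him'] at him
          rcases le_or_gt t 0 with h4 | h4 <;> nlinarith
        have htpos : 0 < t := by linarith
        have hexp : ∀ s : ℝ, c₀ + Complex.exp ⟨s, θ⟩ =
            ⟨c₀.re + Real.exp s * Real.cos θ, c₀.im + Real.exp s * Real.sin θ⟩ := fun s => by
          apply Complex.ext <;> simp [Complex.exp_re, Complex.exp_im]
        have hwt : c₀ + Complex.exp ⟨Real.log t, θ⟩ = w := by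
          rw [hexp, Real.exp_log htpos, ← hre, ← him]
          apply Complex.ext <;> simp
        have ht2 : t ≤ 2 * y := by
          have h3 : ‖w - c₀‖ ≤ y + y / 2 :=
            (norm_sub_le _ _).trans (add_le_add (hcase w hwS).le hc₀n)
          have h4 : w - c₀ = Complex.exp ⟨Real.log t, θ⟩ := by rw [← hwt]; ring
          rw [h4, Complex.norm_exp] at h3
          simp only [Real.exp_log htpos] at h3
          linarith
        refine ⟨Real.log t, Real.log (2 * y), Real.log_le_log (by positivity) ht0.le,
          Real.log_le_log htpos ht2, le_rfl, fun s hs => ⟨hθ, ?_⟩, Or.inr ⟨?_, ?_⟩⟩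
        · rw [hexp]
          have h3 : t ≤ Real.exp s := (Real.log_le_iff_le_exp htpos).1 hs.1
          have h4 : w.im = c₀.im + t * Real.sin θ := by linarith
          simp only
          nlinarith
        · simp only [Function.comp_apply]
          rw [hexp, Real.exp_log (by positivity)]
          refine hup _ ?_ ?_
          · simp only
            have : c₀.im = -(R / 2) := rfl
            rw [this]; nlinarith
          · rw [← Real.exp_log (show 0 < 2 * y by positivity), ← hexp]
            have h3 : ‖Complex.exp ⟨Real.log (2 * y), θ⟩‖ = 2 * y := by
              rw [Complex.norm_exp]; simp only; rw [Real.exp_log (by positivity)]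
            refine (norm_sub_le _ _).trans ?_
            have h4 := norm_add_le c₀ (Complex.exp ⟨Real.log (2 * y), θ⟩)
            have h5 : ‖(y * Complex.I : ℂ)‖ = y := by
              rw [norm_mul, Complex.norm_I, Complex.norm_real, Real.norm_eq_abs, abs_of_pos hy,
                mul_one]
            linarith
        · simp only [Function.comp_apply, hwt]; exact hSε w hwS)
    have e1 : 3 * Real.pi / 4 - Real.pi / 4 = Real.pi / 2 := by ring
    have e2 : Real.log (2 * y) - Real.log (R / 2) = Real.log (4 * y / R) := by
      rw [← Real.log_div (by positivity) (by positivity)]; congr 1; field_simp; norm_num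
    rw [e1, e2] at key
    -- The exponent 4 is `2π` divided by the opening angle `π / 2` of the cone.
    have h5 : Real.log (ε / a) ≤ 4 * Real.log (4 * y / R) := by
      have : Real.pi / 2 * Real.log (ε / a) ≤ Real.pi / 2 * (4 * Real.log (4 * y / R)) := by linarith
      exact le_of_mul_le_mul_left this (by positivity)
    have h6 : Real.log (ε / a) ≤ Real.log ((4 * y / R) ^ 4) := by
      rw [Real.log_pow]; exact_mod_cast h5
    rw [Real.log_le_log_iff (by positivity) (by positivity), div_le_iff₀ ha0, div_pow,
      div_mul_eq_mul_div, le_div_iff₀ (by positivity)] at h6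
    refine h6.trans ?_
    have h7 := le_exp_thirty
    calc (4 * y) ^ 4 * a = 256 * a * y ^ 4 := by ring
      _ ≤ _ := mul_le_mul_of_nonneg_right (mul_le_mul_of_nonneg_right h7 ha0.le) (by positivity)

end IsUnivalent

end

/-! ### Plane topology: unicoherence and circular arcs. -/

noncomputable section

open Metric

/-- The values lie in `2πiℤ`; two different ones would force an intermediate imaginary part that is
an odd multiple of `π`. -/
theorem eq_of_exp_eq_one {X : Type*} [TopologicalSpace X] {S : Set X} (hS : IsPreconnected S)
    {k : X → ℂ} (hk : ContinuousOn k S) (h1 : ∀ x ∈ S, Complex.exp (k x) = 1) {x y : X}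
    (hx : x ∈ S) (hy : y ∈ S) : k x = k y := by
  have hpi := Real.pi_pos
  have hform : ∀ z ∈ S, ∃ n : ℤ, k z = n * (2 * Real.pi * Complex.I) := fun z hz =>
    Complex.exp_eq_one_iff.1 (h1 z hz)
  have him : ∀ z ∈ S, ∀ n : ℤ, k z = n * (2 * Real.pi * Complex.I) →
      (k z).im = n * (2 * Real.pi) := fun z hz n hn => by rw [hn]; simp
  have key : ∀ x ∈ S, ∀ y ∈ S, ¬ (k x).im < (k y).im := by
    intro x hx y hy hlt
    obtain ⟨m, hm⟩ := hform x hx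
    obtain ⟨n, hn⟩ := hform y hy
    have hm' := him x hx m hm
    have hn' := him y hy n hn
    have hmn : m < n := by
      rw [hm', hn'] at hlt
      have : (m : ℝ) < n := by nlinarith
      exact_mod_cast this
    have hmn' : (m : ℝ) + 1 ≤ n := by exact_mod_cast hmn
    obtain ⟨z, hz, hzv⟩ := hS.intermediate_value hx hy (Complex.continuous_im.comp_continuousOn hk)
      (show (k x).im + Real.pi ∈ Icc (k x).im (k y).im from
        ⟨by linarith, by rw [hm', hn']; nlinarith⟩)
    obtain ⟨l, hl⟩ := hform z hz
    have hl' := him z hz l hl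
    simp only [Function.comp_apply] at hzv
    rw [hl', hm'] at hzv
    have h2 : ((2 * l : ℤ) : ℝ) = ((2 * m + 1 : ℤ) : ℝ) := by
      push_cast
      have : Real.pi * (2 * l) = Real.pi * (2 * m + 1) := by linarith
      exact mul_left_cancel₀ hpi.ne' this
    have h3 : 2 * l = 2 * m + 1 := by exact_mod_cast h2
    omega
  obtain ⟨m, hm⟩ := hform x hx
  obtain ⟨n, hn⟩ := hform y hy
  have heq : (k x).im = (k y).im := le_antisymm (not_lt.1 (key y hy x hx)) (not_lt.1 (key x hx y hy))
  rw [him x hx m hm, him y hy n hn] at heq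
  have : (m : ℝ) = n := mul_right_cancel₀ (by positivity) heq
  rw [hm, hn]
  have : m = n := by exact_mod_cast this
  rw [this]

/-- Every non-vanishing continuous function on `X` has a continuous logarithm. -/
def HasContinuousLog (X : Set ℂ) : Prop :=
  ∀ φ : ℂ → ℂ, ContinuousOn φ X → (∀ z ∈ X, φ z ≠ 0) →
    ∃ h : ℂ → ℂ, ContinuousOn h X ∧ ∀ z ∈ X, Complex.exp (h z) = φ z

theorem hasContinuousLog_upperHalf : HasContinuousLog upperHalf := by
  intro φ hφ h0
  have hne : upperHalf.Nonempty := ⟨Complex.I, by simp [upperHalf]⟩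
  have hsc : IsSimplyConnected upperHalf := by
    have : ContractibleSpace upperHalf := convex_upperHalf.contractibleSpace hne
    exact SimplyConnectedSpace.ofContractible upperHalf
  obtain ⟨h, hc, hh⟩ := Complex.exists_continuousOn_eqOn_exp_comp hsc isOpen_upperHalf hφ
    (by rintro ⟨z, hz, he⟩; exact h0 z hz he)
  exact ⟨h, hc, hh⟩

/-- Unicoherence: the boundary of a complementary domain of a connected closed subset of a simply
connected domain is connected. -/
theorem HasContinuousLog.isPreconnected_frontier {X C W : Set ℂ} (hX : HasContinuousLog X)
    (hC : IsPreconnected C) (hCX : C ⊆ X) (hW : IsPreconnected W) (hWX : W ⊆ X)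
    (hWC : Disjoint W C) (hfr : frontier W ∩ X ⊆ C) : IsPreconnected (frontier W ∩ X) := by
  rw [isPreconnected_closed_iff]
  intro Z₁ Z₂ hZ₁ hZ₂ hcov hne₁ hne₂
  by_contra hemp
  rw [not_nonempty_iff_eq_empty] at hemp
  set P := frontier W ∩ X ∩ Z₁ with hP
  set Q := frontier W ∩ X ∩ Z₂ with hQ
  have hclosed : ∀ Z, IsClosed Z → ∀ x ∈ X, x ∈ closure (frontier W ∩ X ∩ Z) →
      x ∈ frontier W ∩ X ∩ Z := by
    intro Z hZ x hx hxc
    have : closure (frontier W ∩ X ∩ Z) ⊆ frontier W ∩ Z :=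
      closure_minimal (fun y hy => ⟨hy.1.1, hy.2⟩) (isClosed_frontier.inter hZ)
    exact ⟨⟨(this hxc).1, hx⟩, (this hxc).2⟩
  have hdisj : ∀ x, x ∈ P → x ∈ Q → False := fun x h1 h2 => by
    have : x ∈ frontier W ∩ X ∩ (Z₁ ∩ Z₂) := ⟨h1.1, h1.2, h2.2⟩
    rw [hemp] at this; exact this
  have hpos : ∀ x ∈ X, 0 < infDist x P + infDist x Q := by
    intro x hx
    by_contra hle
    have h1 := infDist_nonneg (x := x) (s := P)
    have h2 := infDist_nonneg (x := x) (s := Q)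
    have h3 : infDist x P = 0 := by linarith
    have h4 : infDist x Q = 0 := by linarith
    exact hdisj x (hclosed _ hZ₁ x hx ((mem_closure_iff_infDist_zero hne₁).2 h3))
      (hclosed _ hZ₂ x hx ((mem_closure_iff_infDist_zero hne₂).2 h4))
  -- A Urysohn function on `X`, equal to `0` on one supposed piece of the frontier and to `1` on the
  -- other.
  set u : ℂ → ℝ := fun x => infDist x P / (infDist x P + infDist x Q) with hu
  have huc : ContinuousOn u X :=
    (continuous_infDist_pt P).continuousOn.div
      ((continuous_infDist_pt P).add (continuous_infDist_pt Q)).continuousOn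
      fun x hx => (hpos x hx).ne'
  have huP : ∀ x ∈ P, u x = 0 := fun x hx => by
    simp only [hu]; rw [infDist_zero_of_mem hx, zero_div]
  have huQ : ∀ x ∈ Q, u x = 1 := fun x hx => by
    have := hpos x hx.1.2
    simp only [hu]
    rw [infDist_zero_of_mem hx, add_zero] at this ⊢
    exact div_self this.ne'
  set v : ℂ → ℂ := fun x => u x * (Real.pi * Complex.I) with hv
  have hvc : ContinuousOn v X :=
    (Complex.continuous_ofReal.comp_continuousOn huc).mul continuousOn_const
  have hagree : ∀ x ∈ frontier W ∩ X, Complex.exp (v x) = Complex.exp (-v x) := by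
    intro x hx
    rcases hcov hx with h | h
    · have := huP x ⟨hx, h⟩
      simp [hv, this]
    · have := huQ x ⟨hx, h⟩
      simp [hv, this, Complex.exp_neg, Complex.exp_pi_mul_I]
  classical
  -- Since `v` is `0` or `πi` on the frontier, `e^v` and `e^(-v)` agree there and glue continuously.
  set φ : ℂ → ℂ := fun x => if x ∈ closure W then Complex.exp (v x) else Complex.exp (-v x) with hφ
  have hφc : ContinuousOn φ X := by
    refine ContinuousOn.if (p := fun x => x ∈ closure W) ?_ ?_ ?_
    · intro x hx
      exact hagree x ⟨frontier_closure_subset hx.2, hx.1⟩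
    · exact (hvc.mono inter_subset_left).cexp
    · exact (hvc.neg.mono inter_subset_left).cexp
  obtain ⟨θ, hθc, hθ⟩ := hX φ hφc fun z _ => by
    simp only [hφ]; split_ifs <;> exact Complex.exp_ne_zero _
  have hA : IsPreconnected (closure W ∩ X) :=
    hW.subset_closure (fun x hx => ⟨subset_closure hx, hWX hx⟩) inter_subset_left
  have hkA : ∀ x ∈ closure W ∩ X, Complex.exp (θ x - v x) = 1 := fun x hx => by
    rw [Complex.exp_sub, hθ x hx.2]
    simp only [hφ]
    rw [if_pos hx.1, div_self (Complex.exp_ne_zero _)]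
  have hkC : ∀ x ∈ C, Complex.exp (θ x + v x) = 1 := fun x hx => by
    have hφx : φ x = Complex.exp (-v x) := by
      simp only [hφ]
      split_ifs with hcl
      · refine hagree x ⟨⟨hcl, fun hint => ?_⟩, hCX hx⟩
        exact disjoint_left.1 hWC (interior_subset hint) hx
      · rfl
    rw [Complex.exp_add, hθ x (hCX hx), hφx, ← Complex.exp_add, neg_add_cancel, Complex.exp_zero]
  obtain ⟨a, ha⟩ := hne₁
  obtain ⟨b, hb⟩ := hne₂
  have hmemA : ∀ x ∈ frontier W ∩ X, x ∈ closure W ∩ X := fun x hx =>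
    ⟨frontier_subset_closure hx.1, hx.2⟩
  -- A logarithm `θ` of `φ` makes `θ - v` constant on `closure W ∩ X` and `θ + v` constant on `C`.
  -- Both sets contain `a` and `b`, so `v a = v b`, although `v` is `0` at `a` and `πi` at `b`.
  have e1 := eq_of_exp_eq_one hA ((hθc.sub hvc).mono inter_subset_right) hkA
    (hmemA a ha.1) (hmemA b hb.1)
  have e2 := eq_of_exp_eq_one hC ((hθc.add hvc).mono hCX) hkC (hfr ha.1) (hfr hb.1)
  have va : v a = 0 := by simp [hv, huP a ha]
  have vb : v b = Real.pi * Complex.I := by simp [hv, huQ b hb]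
  simp only [Pi.sub_apply, Pi.add_apply, va, vb] at e1 e2
  have : (Real.pi : ℂ) * Complex.I = 0 := by linear_combination (e1 - e2) / 2
  rcases mul_eq_zero.1 this with h | h
  · exact Real.pi_ne_zero (by exact_mod_cast h)
  · exact Complex.I_ne_zero h

theorem connectedComponentIn_mem_of_closure {X : Type*} [TopologicalSpace X] {U : Set X} {z x : X}
    (hz : z ∈ U) (hx : x ∈ closure (connectedComponentIn U z)) (hxU : x ∈ U) :
    x ∈ connectedComponentIn U z := by
  have h1 : IsPreconnected (insert x (connectedComponentIn U z)) :=
    isPreconnected_connectedComponentIn.subset_closure (subset_insert _ _)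
      (insert_subset hx subset_closure)
  exact h1.subset_connectedComponentIn (mem_insert_of_mem _ (mem_connectedComponentIn hz))
    (insert_subset hxU (connectedComponentIn_subset _ _)) (mem_insert _ _)

/-- Components of a relatively open subset of a circle are relatively open. -/
theorem eventually_mem_connectedComponentIn_sphere {c x : ℂ} {ε : ℝ} (hε : 0 < ε) {H : Set ℂ}
    (hH : IsOpen H) (hx : x ∈ sphere c ε ∩ H) :
    ∀ᶠ y in 𝓝 x, y ∈ sphere c ε → y ∈ connectedComponentIn (sphere c ε ∩ H) x := by
  have hxc : x - c ≠ 0 := by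
    rw [← norm_pos_iff, ← dist_eq_norm, mem_sphere.1 hx.1]; exact hε
  set e : ℝ → ℂ := fun θ => c + (x - c) * Complex.exp (θ * Complex.I) with he
  have hec : Continuous e := by fun_prop
  have he0 : e 0 = x := by simp [he]
  have hnear : ∀ᶠ θ in 𝓝 (0 : ℝ), e θ ∈ H :=
    hec.continuousAt.eventually (by rw [he0]; exact hH.mem_nhds hx.2)
  obtain ⟨δ, hδ, hδH⟩ := Metric.eventually_nhds_iff_ball.1 hnear
  have hsph : ∀ θ, e θ ∈ sphere c ε := fun θ => by
    rw [mem_sphere, dist_eq_norm]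
    simp only [he, add_sub_cancel_left, norm_mul, Complex.norm_exp_ofReal_mul_I, mul_one]
    rw [← dist_eq_norm]; exact hx.1
  have hA : IsPreconnected (e '' ball 0 δ) :=
    ((convex_ball (0 : ℝ) δ).isPreconnected).image e hec.continuousOn
  have hAsub : e '' ball 0 δ ⊆ connectedComponentIn (sphere c ε ∩ H) x := by
    refine hA.subset_connectedComponentIn ⟨0, mem_ball_self hδ, he0⟩ ?_
    rintro _ ⟨θ, hθ, rfl⟩
    exact ⟨hsph θ, hδH θ hθ⟩
  have harg : ContinuousAt (fun y : ℂ => ((y - c) / (x - c)).arg) x := by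
    refine ContinuousAt.comp (g := Complex.arg) (f := fun y : ℂ => (y - c) / (x - c)) ?_ (by fun_prop)
    simp only [div_self hxc]
    exact Complex.continuousAt_arg (by simp)
  have h0 : ((x - c) / (x - c)).arg = 0 := by rw [div_self hxc, Complex.arg_one]
  have hev := harg.eventually (ball_mem_nhds _ hδ)
  simp only [h0] at hev
  filter_upwards [hev] with y hy hys
  refine hAsub ⟨_, hy, ?_⟩
  have hn : ‖(y - c) / (x - c)‖ = 1 := by
    rw [norm_div, ← dist_eq_norm, ← dist_eq_norm, mem_sphere.1 hys, mem_sphere.1 hx.1,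
      div_self hε.ne']
  have := Complex.norm_mul_exp_arg_mul_I ((y - c) / (x - c))
  rw [hn, Complex.ofReal_one, one_mul] at this
  simp only [he]
  rw [this, mul_div_cancel₀ _ hxc]; ring

/-- The arc of a circle through a boundary point of a component of the part of `H` inside the circle
lies in the boundary of the component. -/
theorem connectedComponentIn_sphere_subset_frontier {c z x : ℂ} {ε : ℝ} (hε : 0 < ε) {H : Set ℂ}
    (hH : IsOpen H) (hx : x ∈ sphere c ε ∩ H)
    (hxO : x ∈ frontier (connectedComponentIn (ball c ε ∩ H) z)) :
    connectedComponentIn (sphere c ε ∩ H) x ⊆ frontier (connectedComponentIn (ball c ε ∩ H) z) := by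
  set O := connectedComponentIn (ball c ε ∩ H) z with hO
  set s := connectedComponentIn (sphere c ε ∩ H) x with hs
  have hOo : IsOpen O := (isOpen_ball.inter hH).connectedComponentIn
  have hOB : O ⊆ ball c ε ∩ H := connectedComponentIn_subset _ _
  -- A small disc about `y` meets `ball c ε` in a convex set that meets `O`, so this set lies in `O`
  -- and the nearby arc lies in its frontier. Thus `s ∩ frontier O` is open in `s`, as well as
  -- closed.
  have hloc : ∀ y ∈ s ∩ frontier O, ∃ N, IsOpen N ∧ y ∈ N ∧ N ∩ sphere c ε ⊆ frontier O := by
    rintro y ⟨hys, hyO⟩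
    have hyH : y ∈ sphere c ε ∩ H := connectedComponentIn_subset _ _ hys
    obtain ⟨δ, hδ, hδH⟩ := Metric.isOpen_iff.1 hH y hyH.2
    refine ⟨ball y δ, isOpen_ball, mem_ball_self hδ, ?_⟩
    obtain ⟨q, hqN, hqO⟩ := mem_closure_iff.1 (frontier_subset_closure hyO) _ isOpen_ball
      (mem_ball_self hδ)
    have hconv : IsPreconnected (ball y δ ∩ ball c ε) :=
      ((convex_ball y δ).inter (convex_ball c ε)).isPreconnected
    have hsub : ball y δ ∩ ball c ε ⊆ O := by
      have := hconv.subset_connectedComponentIn (F := ball c ε ∩ H) ⟨hqN, (hOB hqO).1⟩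
        (fun a ha => ⟨ha.2, hδH ha.1⟩)
      rwa [← connectedComponentIn_eq hqO] at this
    rintro a ⟨haN, haS⟩
    rw [hOo.frontier_eq]
    refine ⟨?_, fun haO => ?_⟩
    · have h1 : a ∈ closure (ball c ε) := by
        rw [closure_ball c hε.ne']; exact sphere_subset_closedBall haS
      exact closure_mono hsub (isOpen_ball.inter_closure ⟨haN, h1⟩)
    · have := (hOB haO).1
      rw [mem_ball, mem_sphere.1 haS] at this
      exact lt_irrefl _ this
  choose! N hNo hyN hNs using hloc
  have hsp : IsPreconnected s := isPreconnected_connectedComponentIn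
  by_contra hnot
  obtain ⟨b, hbs, hbO⟩ := not_subset.1 hnot
  have hxs : x ∈ s := mem_connectedComponentIn hx
  have := hsp (⋃ y ∈ s ∩ frontier O, N y) (frontier O)ᶜ
    (isOpen_biUnion hNo) isClosed_frontier.isOpen_compl (fun a ha => by
      by_cases hafr : a ∈ frontier O
      · exact Or.inl (mem_biUnion (⟨ha, hafr⟩ : a ∈ s ∩ frontier O) (hyN a ⟨ha, hafr⟩))
      · exact Or.inr hafr)
    ⟨x, hxs, mem_biUnion (⟨hxs, hxO⟩ : x ∈ s ∩ frontier O) (hyN x ⟨hxs, hxO⟩)⟩ ⟨b, hbs, hbO⟩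
  obtain ⟨a, has, haU, haV⟩ := this
  obtain ⟨y, hy, hay⟩ := mem_iUnion₂.1 haU
  exact haV (hNs y hy ⟨hay, (connectedComponentIn_subset _ _ has).1⟩)

end

/-! ### Existence of a separating arc about the tip. -/

noncomputable section

open Metric

theorem isPreconnected_upperHalf_diff (r : ℝ) : IsPreconnected {w | w ∈ upperHalf ∧ r < ‖w‖} := by
  have himg : {w | w ∈ upperHalf ∧ r < ‖w‖} =
      (fun q : ℝ × ℝ => (q.1 : ℂ) * Complex.exp (q.2 * Complex.I)) ''
        (Ioi (max r 0) ×ˢ Ioo 0 Real.pi) := by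
    ext w
    constructor
    · rintro ⟨hw, hr⟩
      have hw0 : 0 < w.im := hw
      have h0 : 0 ≤ w.arg := Complex.arg_nonneg_iff.2 hw0.le
      refine ⟨(‖w‖, w.arg), ⟨max_lt hr (norm_pos_iff.2 fun h => by simp [h] at hw0), ?_, ?_⟩,
        Complex.norm_mul_exp_arg_mul_I w⟩
      · refine h0.lt_of_ne fun h0 => ?_
        have := (Complex.arg_eq_zero_iff.1 h0.symm).2; linarith
      · refine (Complex.arg_le_pi w).lt_of_ne fun h0 => ?_
        have := (Complex.arg_eq_pi_iff.1 h0).2; linarith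
    · rintro ⟨⟨ρ, θ⟩, ⟨hρ, hθ⟩, rfl⟩
      simp only [mem_Ioi, max_lt_iff] at hρ
      have hρ0 := hρ.2
      constructor
      · change 0 < ((ρ : ℂ) * Complex.exp (θ * Complex.I)).im
        rw [Complex.im_ofReal_mul, Complex.exp_ofReal_mul_I_im]
        exact mul_pos hρ0 (Real.sin_pos_of_pos_of_lt_pi hθ.1 hθ.2)
      · simp only [norm_mul, Complex.norm_exp_ofReal_mul_I, mul_one, Complex.norm_real,
          Real.norm_eq_abs, abs_of_pos hρ0]
        exact hρ.1
  rw [himg]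
  refine IsPreconnected.image ?_ _ (by fun_prop)
  exact ((convex_Ioi _).prod (convex_Ioo _ _)).isPreconnected

/-- A domain `H` with inverse conformal maps `F : ℍ → H` and `G : H → ℍ` fixing `∞`, and a boundary
point `p` that is the radial limit of `F` at `0`. -/
structure TipDomain (H : Set ℂ) (F G : ℂ → ℂ) (p : ℂ) : Prop where
  univalent : IsUnivalent F
  isOpen : IsOpen H
  mapsTo_F : MapsTo F upperHalf H
  mapsTo_G : MapsTo G H upperHalf
  F_G : ∀ z ∈ H, F (G z) = z
  G_F : ∀ w ∈ upperHalf, G (F w) = w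
  continuousOn_G : ContinuousOn G H
  tendsto_tip : Tendsto (fun y : ℝ => F (y * Complex.I)) (𝓝[>] 0) (𝓝 p)
  tip_notMem : p ∉ H
  exists_bound_G : ∀ r : ℝ, ∃ r', ∀ z ∈ H, ‖z‖ ≤ r → ‖G z‖ ≤ r'
  exists_bound_F : ∀ r : ℝ, ∃ r', ∀ z ∈ H, ‖G z‖ ≤ r → ‖z‖ ≤ r'

namespace TipDomain

/-- The component of the part of `H` inside the circle of radius `ε` that is near the tip. -/
def component (H : Set ℂ) (F : ℂ → ℂ) (p : ℂ) (ε : ℝ) : Set ℂ :=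
  {z | z ∈ ball p ε ∩ H ∧
    ∀ᶠ y : ℝ in 𝓝[>] 0, F (y * Complex.I) ∈ connectedComponentIn (ball p ε ∩ H) z}

/-- Every curve in `H` from the tip to infinity meets `s`. -/
def Separates (H : Set ℂ) (G : ℂ → ℂ) (s : Set ℂ) : Prop :=
  ∀ η : ℝ → ℂ, ContinuousOn η (Ioi 0) → MapsTo η (Ioi 0) H →
    Tendsto (fun r => G (η r)) (𝓝[>] 0) (𝓝 0) →
    Tendsto η atTop (Bornology.cobounded ℂ) → ∃ r, 0 < r ∧ η r ∈ s

/-- The separating arcs of the circle of radius `ε` about the tip. -/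
structure IsSepArc (H : Set ℂ) (F G : ℂ → ℂ) (p : ℂ) (ε : ℝ) (s : Set ℂ) : Prop where
  exists_eq : ∃ z ∈ sphere p ε ∩ H, s = connectedComponentIn (sphere p ε ∩ H) z
  subset_frontier : s ⊆ frontier (component H F p ε)
  separates : Separates H G s

variable {H : Set ℂ} {F G : ℂ → ℂ} {p : ℂ} {ε : ℝ}

theorem hasContinuousLog (D : TipDomain H F G p) : HasContinuousLog H := by
  intro φ hφ h0
  obtain ⟨h, hc, hh⟩ := hasContinuousLog_upperHalf (φ ∘ F)
    (hφ.comp D.univalent.differentiableOn.continuousOn D.mapsTo_F) fun w hw => h0 _ (D.mapsTo_F hw)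
  refine ⟨h ∘ G, hc.comp D.continuousOn_G D.mapsTo_G, fun z hz => ?_⟩
  simp only [Function.comp_apply]
  rw [hh _ (D.mapsTo_G hz), Function.comp_apply, D.F_G z hz]

theorem F_mem (D : TipDomain H F G p) {y : ℝ} (hy : 0 < y) : F (y * Complex.I) ∈ H :=
  D.mapsTo_F (ofReal_mul_I_mem_upperHalf hy)

theorem continuousOn_ray (D : TipDomain H F G p) :
    ContinuousOn (fun y : ℝ => F (y * Complex.I)) (Ioi 0) :=
  D.univalent.differentiableOn.continuousOn.comp (by fun_prop) fun _ hy =>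
    ofReal_mul_I_mem_upperHalf hy

theorem tendsto_cobounded (D : TipDomain H F G p) {α : Type*} {l : Filter α} {η : α → ℂ}
    (hη : ∀ᶠ a in l, η a ∈ H) :
    Tendsto η l (Bornology.cobounded ℂ) ↔ Tendsto (fun a => G (η a)) l (Bornology.cobounded ℂ) := by
  simp only [← tendsto_norm_atTop_iff_cobounded, Filter.tendsto_atTop]
  constructor
  · intro h b
    obtain ⟨r', hr'⟩ := D.exists_bound_F b
    filter_upwards [h (r' + 1), hη] with a ha haH
    by_contra hcon
    linarith [hr' _ haH (not_le.1 hcon).le]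
  · intro h b
    obtain ⟨r', hr'⟩ := D.exists_bound_G b
    filter_upwards [h (r' + 1), hη] with a ha haH
    by_contra hcon
    linarith [hr' _ haH (not_le.1 hcon).le]

theorem tendsto_ray_atTop (D : TipDomain H F G p) :
    Tendsto (fun y : ℝ => F (y * Complex.I)) atTop (Bornology.cobounded ℂ) := by
  rw [D.tendsto_cobounded ((eventually_gt_atTop 0).mono fun y hy => D.F_mem hy)]
  have : (fun y : ℝ => (y * Complex.I : ℂ)) =ᶠ[atTop] fun y => G (F (y * Complex.I)) :=
    (eventually_gt_atTop 0).mono fun y hy => (D.G_F _ (ofReal_mul_I_mem_upperHalf hy)).symm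
  refine Tendsto.congr' this ?_
  rw [← tendsto_norm_atTop_iff_cobounded]
  simpa using! tendsto_abs_atTop_atTop

theorem tendsto_G_ray (D : TipDomain H F G p) :
    Tendsto (fun r : ℝ => G (F (r * Complex.I))) (𝓝[>] 0) (𝓝 0) := by
  have h1 : Tendsto (fun r : ℝ => (r * Complex.I : ℂ)) (𝓝[>] 0) (𝓝 0) := by
    have : Continuous fun r : ℝ => (r * Complex.I : ℂ) := by fun_prop
    simpa using (this.tendsto 0).mono_left nhdsWithin_le_nhds
  refine h1.congr' ?_
  filter_upwards [self_mem_nhdsWithin] with r hr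
  exact (D.G_F _ (ofReal_mul_I_mem_upperHalf hr)).symm

/-- There is `y₁ > 0` such that the component near the tip is the one that contains
`F (i y)`, `y ≤ y₁`. -/
theorem exists_component_eq (D : TipDomain H F G p) (hε : 0 < ε) :
    ∃ y₁ : ℝ, 0 < y₁ ∧ F (y₁ * Complex.I) ∈ ball p ε ∩ H ∧
      component H F p ε = connectedComponentIn (ball p ε ∩ H) (F (y₁ * Complex.I)) ∧
      ∀ y, 0 < y → y ≤ y₁ → F (y * Complex.I) ∈ component H F p ε := by
  have hev := D.tendsto_tip.eventually (ball_mem_nhds p hε)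
  rw [eventually_nhdsWithin_iff, Metric.eventually_nhds_iff] at hev
  obtain ⟨δ, hδ, hδb⟩ := hev
  have hb : ∀ y, 0 < y → y ≤ δ / 2 → F (y * Complex.I) ∈ ball p ε ∩ H := fun y hy hyδ =>
    ⟨hδb (by rw [Real.dist_eq, sub_zero, abs_of_pos hy]; linarith) hy, D.F_mem hy⟩
  have hy₁ : 0 < δ / 2 := by positivity
  set O := connectedComponentIn (ball p ε ∩ H) (F ((δ / 2 : ℝ) * Complex.I)) with hO
  have hpre : IsPreconnected ((fun y : ℝ => F (y * Complex.I)) '' Ioc 0 (δ / 2)) :=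
    isPreconnected_Ioc.image _ (D.continuousOn_ray.mono fun y hy => hy.1)
  have hmem : ∀ y, 0 < y → y ≤ δ / 2 → F (y * Complex.I) ∈ O := by
    intro y hy hyδ
    have := hpre.subset_connectedComponentIn (F := ball p ε ∩ H)
      (x := F ((δ / 2 : ℝ) * Complex.I)) ⟨δ / 2, ⟨hy₁, le_rfl⟩, rfl⟩
      (by rintro _ ⟨y, hy, rfl⟩; exact hb y hy.1 hy.2)
    exact this ⟨y, ⟨hy, hyδ⟩, rfl⟩
  have hsmall : ∀ᶠ y : ℝ in 𝓝[>] 0, y ∈ Ioc 0 (δ / 2) := Ioc_mem_nhdsGT hy₁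
  have heq : component H F p ε = O := by
    ext z
    constructor
    · rintro ⟨hz, hev⟩
      obtain ⟨y, hy, hyδ⟩ := (hev.and hsmall).exists
      have h1 := connectedComponentIn_eq hy
      have h2 := connectedComponentIn_eq (hmem y hyδ.1 hyδ.2)
      rw [hO, h2, ← h1]
      exact mem_connectedComponentIn hz
    · intro hz
      refine ⟨connectedComponentIn_subset _ _ hz, ?_⟩
      filter_upwards [hsmall] with y hy
      rw [← connectedComponentIn_eq hz]
      exact hmem y hy.1 hy.2
  exact ⟨δ / 2, hy₁, hb _ hy₁ le_rfl, heq, fun y hy hyδ => heq ▸ hmem y hy hyδ⟩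

/-- Small semicircles about `0` with image in the `ε`-neighbourhood of the tip. -/
theorem exists_semicircle (D : TipDomain H F G p) (hε : 0 < ε) {r : ℝ} (hr : 0 < r) :
    ∃ ρ ∈ Ioo 0 r, ∀ w ∈ upperHalf, ‖w‖ = ρ → F w ∈ ball p ε := by
  by_contra hcon
  push Not at hcon
  -- If every small semicircle had a point with `|F - p| ≥ ε`, the axis points, where `|F - p| ≤ ε /
  -- e`, would give `log (r₂ / r₁) ≤ 2π² < 20` for all small `r₁`; the ratio `e^21` contradicts
  -- this.
  set a := Real.exp (-1) * ε with ha
  have ha0 : 0 < a := by positivity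
  have hexp : Real.exp (-1) < 1 := by simp
  have haε : a < ε := by rw [ha]; nlinarith
  have hev := D.tendsto_tip.eventually (ball_mem_nhds p ha0)
  rw [eventually_nhdsWithin_iff, Metric.eventually_nhds_iff] at hev
  obtain ⟨δ, hδ, hδb⟩ := hev
  set r₂ := min r δ with hr₂
  have hr₂0 : 0 < r₂ := lt_min hr hδ
  have key : ∀ r₁ ∈ Ioo 0 r₂, Real.log (r₂ / r₁) ≤ 2 * Real.pi ^ 2 := by
    intro r₁ hr₁
    have := D.univalent.log_mul_log_le_of_arcs (S := {w ∈ upperHalf | ε ≤ ‖F w - p‖})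
      (fun w hw => hw.1) (p := p) ha0 haε hr₁.1 hr₁.2 (fun ρ hρ => by
        obtain ⟨w, hw, hwρ, hwb⟩ := hcon ρ ⟨hr₁.1.trans hρ.1, hρ.2.trans_le (min_le_left _ _)⟩
        exact ⟨w, ⟨hw, by rwa [mem_ball, dist_eq_norm, not_lt] at hwb⟩, hwρ⟩)
      (Or.inr ⟨fun w hw => hw.2, fun ρ hρ => by
        have hρ0 : 0 < ρ := hr₁.1.trans hρ.1
        have := hδb (y := ρ) (by
          rw [Real.dist_eq, sub_zero, abs_of_pos hρ0]; exact hρ.2.trans_le (min_le_right _ _)) hρ0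
        rw [dist_eq_norm] at this
        exact this.le⟩)
    have e : ε / a = Real.exp 1 := by rw [ha, Real.exp_neg]; field_simp
    rw [e, Real.log_exp, mul_one] at this
    exact this
  have hpi := IsUnivalent.pi_sq_lt
  have h1 := key (r₂ * Real.exp (-21)) ⟨by positivity, by
    have : Real.exp (-21) < 1 := by simp
    nlinarith⟩
  have e : r₂ / (r₂ * Real.exp (-21)) = Real.exp 21 := by rw [Real.exp_neg]; field_simp
  rw [e, Real.log_exp] at h1
  linarith

/-- A curve that starts at the tip visits the component near the tip. -/
theorem exists_mem_component (D : TipDomain H F G p) (hε : 0 < ε) {η : ℝ → ℂ}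
    (hη : ContinuousOn η (Ioi 0)) (hηH : MapsTo η (Ioi 0) H)
    (h0 : Tendsto (fun r => G (η r)) (𝓝[>] 0) (𝓝 0))  :
    ∃ r, 0 < r ∧ η r ∈ component H F p ε := by
  obtain ⟨y₁, hy₁, hy₁b, heq, hmem⟩ := D.exists_component_eq hε
  have hpos : ∀ w ∈ upperHalf, 0 < ‖w‖ := fun w hw => norm_pos_iff.2 fun h => by
    simp [h, upperHalf] at hw
  have hG1 := hpos _ (D.mapsTo_G (hηH (mem_Ioi.2 one_pos)))
  obtain ⟨ρ, hρ, hρb⟩ := D.exists_semicircle hε (lt_min hy₁ hG1)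
  have hcont : ContinuousOn (fun r => ‖G (η r)‖) (Ioi 0) :=
    (D.continuousOn_G.comp hη hηH).norm
  obtain ⟨r₀, hr₀⟩ : ∃ r₀ ∈ Ioc (0 : ℝ) 1, ‖G (η r₀)‖ < ρ := by
    have h2 := (h0.norm.eventually (gt_mem_nhds (by simpa using hρ.1)))
    obtain ⟨r₀, h3, h4⟩ := (h2.and (Ioc_mem_nhdsGT one_pos)).exists
    exact ⟨r₀, h4, h3⟩
  -- The image of the curve in the half-plane must cross the good semicircle, and the image of that
  -- semicircle under `F` is connected, inside the disc, and meets the ray near the tip.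
  obtain ⟨r, hr, hrρ⟩ := isPreconnected_Ioi.intermediate_value (mem_Ioi.2 hr₀.1.1)
    (mem_Ioi.2 one_pos) hcont ⟨hr₀.2.le, (hρ.2.trans_le (min_le_right _ _)).le⟩
  refine ⟨r, hr, ?_⟩
  have hw := D.mapsTo_G (hηH hr)
  -- the semicircle of radius `ρ` is connected
  have hpre : IsPreconnected {w | w ∈ upperHalf ∧ ‖w‖ = ρ} := by
    have himg : {w | w ∈ upperHalf ∧ ‖w‖ = ρ} =
        (fun θ : ℝ => (ρ : ℂ) * Complex.exp (θ * Complex.I)) '' Ioo 0 Real.pi := by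
      ext w
      constructor
      · rintro ⟨hw, hr⟩
        have hw0 : 0 < w.im := hw
        have h0 : 0 ≤ w.arg := Complex.arg_nonneg_iff.2 hw0.le
        refine ⟨w.arg, ⟨?_, ?_⟩, by rw [← hr]; exact Complex.norm_mul_exp_arg_mul_I w⟩
        · refine h0.lt_of_ne fun h0 => ?_
          have := (Complex.arg_eq_zero_iff.1 h0.symm).2; linarith
        · refine (Complex.arg_le_pi w).lt_of_ne fun h0 => ?_
          have := (Complex.arg_eq_pi_iff.1 h0).2; linarith
      · rintro ⟨θ, hθ, rfl⟩
        constructor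
        · change 0 < ((ρ : ℂ) * Complex.exp (θ * Complex.I)).im
          rw [Complex.im_ofReal_mul, Complex.exp_ofReal_mul_I_im]
          exact mul_pos hρ.1 (Real.sin_pos_of_pos_of_lt_pi hθ.1 hθ.2)
        · simp only [norm_mul, Complex.norm_exp_ofReal_mul_I, mul_one, Complex.norm_real,
            Real.norm_eq_abs, abs_of_pos hρ.1]
    rw [himg]
    exact isPreconnected_Ioo.image _ (by fun_prop)
  have himF := hpre.image F (D.univalent.differentiableOn.continuousOn.mono fun w hw => hw.1)
  have hρI : F (ρ * Complex.I) ∈ component H F p ε :=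
    hmem ρ hρ.1 (hρ.2.le.trans (min_le_left _ _))
  have hsub := himF.subset_connectedComponentIn (F := ball p ε ∩ H) (x := F (ρ * Complex.I))
    ⟨ρ * Complex.I, ⟨ofReal_mul_I_mem_upperHalf hρ.1, by simp [abs_of_pos hρ.1]⟩, rfl⟩
    (by rintro _ ⟨w, hw, rfl⟩; exact ⟨hρb w hw.1 hw.2, D.mapsTo_F hw.1⟩)
  rw [heq] at hρI ⊢
  rw [connectedComponentIn_eq hρI]
  refine hsub ⟨G (η r), ⟨hw, hrρ⟩, D.F_G _ (hηH hr)⟩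

/-- Let `O` be the component at the tip and `W` the component of `H \ closure O` containing a
neighbourhood of infinity. A curve from the tip to infinity visits `O` and then ends in `W`, so it
crosses `frontier W ∩ H`. This set lies on the circle, and by unicoherence it is connected, so a
single arc contains it. -/
theorem exists_isSepArc (D : TipDomain H F G p) (hε : 0 < ε) : ∃ s, IsSepArc H F G p ε s := by
  obtain ⟨y₁, hy₁, hy₁b, heq, hmem⟩ := D.exists_component_eq hε
  set O := component H F p ε with hO
  have hOo : IsOpen O := heq ▸ (isOpen_ball.inter D.isOpen).connectedComponentIn
  have hOp : IsPreconnected O := heq ▸ isPreconnected_connectedComponentIn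
  have hOB : O ⊆ ball p ε ∩ H := fun z hz => hz.1
  have hclB : closure O ⊆ closedBall p ε :=
    closure_minimal (fun z hz => ball_subset_closedBall (hOB hz).1) isClosed_closedBall
  obtain ⟨r', hr'⟩ := D.exists_bound_G (‖p‖ + ε)
  set E : Set ℂ := F '' {w | w ∈ upperHalf ∧ r' < ‖w‖} with hE
  have hEp : IsPreconnected E := (isPreconnected_upperHalf_diff r').image F
    (D.univalent.differentiableOn.continuousOn.mono fun w hw => hw.1)
  have hEsub : E ⊆ H \ closure O := by
    rintro _ ⟨w, ⟨hw, hwr⟩, rfl⟩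
    refine ⟨D.mapsTo_F hw, fun hcl => ?_⟩
    have h1 := hclB hcl
    rw [mem_closedBall, dist_eq_norm] at h1
    have h2 := hr' (F w) (D.mapsTo_F hw) (by
      have := norm_add_le (F w - p) p
      rw [sub_add_cancel] at this; linarith)
    rw [D.G_F w hw] at h2
    linarith
  set Y : ℝ := |r'| + 1 with hY
  have hY0 : 0 < Y := by positivity
  have hYE : F (Y * Complex.I) ∈ E := ⟨_, ⟨ofReal_mul_I_mem_upperHalf hY0, by
    rw [norm_mul, Complex.norm_I, Complex.norm_real, mul_one, Real.norm_eq_abs, abs_of_pos hY0]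
    linarith [le_abs_self r']⟩, rfl⟩
  have hUo : IsOpen (H \ closure O) := D.isOpen.sdiff isClosed_closure
  set W := connectedComponentIn (H \ closure O) (F (Y * Complex.I)) with hW
  have hWo : IsOpen W := hUo.connectedComponentIn
  have hWp : IsPreconnected W := isPreconnected_connectedComponentIn
  have hWsub : W ⊆ H \ closure O := connectedComponentIn_subset _ _
  have hEW : E ⊆ W := hEp.subset_connectedComponentIn hYE hEsub
  have hWO : Disjoint W O := disjoint_left.2 fun x hx hxO => (hWsub hx).2 (subset_closure hxO)
  have hfrC : frontier W ∩ H ⊆ closure O ∩ H := by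
    rintro x ⟨hx, hxH⟩
    refine ⟨?_, hxH⟩
    by_contra hxO
    have := connectedComponentIn_mem_of_closure (hEsub hYE) (frontier_subset_closure hx) ⟨hxH, hxO⟩
    rw [hWo.frontier_eq] at hx
    exact hx.2 this
  have hfrp : IsPreconnected (frontier W ∩ H) :=
    D.hasContinuousLog.isPreconnected_frontier (C := closure O ∩ H)
      (hOp.subset_closure (fun x hx => ⟨subset_closure hx, (hOB hx).2⟩) inter_subset_left)
      inter_subset_right hWp (fun x hx => (hWsub hx).1)
      (disjoint_left.2 fun x hx hxC => (hWsub hx).2 hxC.1) hfrC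
  have hfrS : frontier W ∩ H ⊆ sphere p ε ∩ H := by
    intro x hx
    refine ⟨?_, hx.2⟩
    have h1 := (hfrC hx).1
    by_contra hxs
    have hxb : x ∈ ball p ε := by
      have h2 := hclB h1
      rw [mem_closedBall] at h2
      rw [mem_sphere] at hxs
      exact lt_of_le_of_ne h2 hxs
    have hxO : x ∈ O := by
      rw [heq] at h1 ⊢
      exact connectedComponentIn_mem_of_closure hy₁b h1 ⟨hxb, hx.2⟩
    have := (hWO.closure_left hOo)
    exact disjoint_left.1 this (frontier_subset_closure hx.1) hxO
  have hfrO : frontier W ∩ H ⊆ frontier O := by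
    intro x hx
    rw [hOo.frontier_eq]
    refine ⟨(hfrC hx).1, fun hxO => ?_⟩
    exact disjoint_left.1 (hWO.closure_left hOo) (frontier_subset_closure hx.1) hxO
  have hsep : Separates H G (frontier W ∩ H) := by
    intro η hη hηH h0 hinf
    obtain ⟨r₁, hr₁, hr₁O⟩ := D.exists_mem_component hε hη hηH h0
    have hG := (D.tendsto_cobounded ((eventually_gt_atTop 0).mono fun y hy => hηH hy)).1 hinf
    rw [← tendsto_norm_atTop_iff_cobounded] at hG
    obtain ⟨r₂, hr₂, hr₂0⟩ := ((hG.eventually_gt_atTop r').and (eventually_gt_atTop 0)).exists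
    have hr₂W : η r₂ ∈ W := hEW ⟨G (η r₂), ⟨D.mapsTo_G (hηH hr₂0), hr₂⟩, D.F_G _ (hηH hr₂0)⟩
    have hpre : IsPreconnected (η '' Ioi 0) := isPreconnected_Ioi.image η hη
    obtain ⟨_, ⟨r, hr, rfl⟩, hx⟩ : (η '' Ioi 0 ∩ frontier W).Nonempty := by
      by_contra hemp
      rw [not_nonempty_iff_eq_empty] at hemp
      obtain ⟨x, -, hxW, hxc⟩ := hpre W (closure W)ᶜ hWo isClosed_closure.isOpen_compl
        (fun x hx => by
          by_cases hxW : x ∈ W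
          · exact Or.inl hxW
          · refine Or.inr fun hcl => ?_
            have : x ∈ η '' Ioi 0 ∩ frontier W := ⟨hx, by rw [hWo.frontier_eq]; exact ⟨hcl, hxW⟩⟩
            rw [hemp] at this
            exact this)
        ⟨η r₂, ⟨r₂, hr₂0, rfl⟩, hr₂W⟩ ⟨η r₁, ⟨r₁, hr₁, rfl⟩, fun h =>
          disjoint_left.1 (hWO.closure_left hOo) h hr₁O⟩
      exact hxc (subset_closure hxW)
    exact ⟨r, hr, hx, hηH hr⟩
  obtain ⟨r₀, hr₀, hx₀⟩ := hsep (fun y : ℝ => F (y * Complex.I)) D.continuousOn_ray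
    (fun y hy => D.F_mem hy) D.tendsto_G_ray D.tendsto_ray_atTop
  refine ⟨connectedComponentIn (sphere p ε ∩ H) (F (r₀ * Complex.I)), ⟨_, hfrS hx₀, rfl⟩, ?_, ?_⟩
  · have := connectedComponentIn_sphere_subset_frontier hε D.isOpen (hfrS hx₀)
      (z := F (y₁ * Complex.I)) (by rw [← heq]; exact hfrO hx₀)
    rwa [← heq] at this
  · intro η hη hηH h0 hinf
    obtain ⟨r, hr, hηr⟩ := hsep η hη hηH h0 hinf
    exact ⟨r, hr, hfrp.subset_connectedComponentIn hx₀ hfrS hηr⟩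

end TipDomain

end

/-! ### The outermost separating arc and the ends of its image. -/

noncomputable section

open Metric

namespace TipDomain

variable {H : Set ℂ} {F G : ℂ → ℂ} {p : ℂ} {ε : ℝ}

theorem isOpen_diff_arc (D : TipDomain H F G p) {z : ℂ} (hz : z ∈ sphere p ε ∩ H) :
    IsOpen (H \ connectedComponentIn (sphere p ε ∩ H) z) := by
  have : H \ connectedComponentIn (sphere p ε ∩ H) z =
      H \ closure (connectedComponentIn (sphere p ε ∩ H) z) := by
    ext x
    refine ⟨fun hx => ⟨hx.1, fun hcl => hx.2 ?_⟩, fun hx => ⟨hx.1, fun h => hx.2 (subset_closure h)⟩⟩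
    refine connectedComponentIn_mem_of_closure hz hcl ⟨?_, hx.1⟩
    exact (closure_minimal (fun y hy => (connectedComponentIn_subset _ _ hy).1)
      isClosed_sphere : _ ⊆ sphere p ε) hcl
  rw [this]
  exact D.isOpen.sdiff isClosed_closure

/-- If the ray near the tip can be connected to infinity in `H \ s`, then `s` does not separate. -/
theorem not_separates (D : TipDomain H F G p) {s K : Set ℂ} (hs : IsOpen (H \ s)) {y₁ : ℝ}
    (hy₁ : 0 < y₁) (hray : ∀ y, 0 < y → y ≤ y₁ → F (y * Complex.I) ∉ s) (hK : IsPreconnected K)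
    (hKs : K ⊆ H \ s) (hy₁K : F (y₁ * Complex.I) ∈ K) {η : ℝ → ℂ} (hη : ContinuousOn η (Ici 0))
    (hηs : ∀ r, 0 ≤ r → η r ∈ H \ s) (hηK : η 0 ∈ K)
    (hinf : Tendsto η atTop (Bornology.cobounded ℂ)) : ¬ Separates H G s := by
  intro hsep
  set U := connectedComponentIn (H \ s) (F (y₁ * Complex.I)) with hU
  have hKU : K ⊆ U := hK.subset_connectedComponentIn hy₁K hKs
  have hUc : IsConnected U := ⟨⟨_, hKU hy₁K⟩, isPreconnected_connectedComponentIn⟩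
  have hUp := (hs.connectedComponentIn.isConnected_iff_isPathConnected).1 hUc
  obtain ⟨c, hc⟩ := hUp.joinedIn _ (hKU hy₁K) _ (hKU hηK)
  have hcU : ∀ t, c.extend t ∈ H \ s := fun t => by
    obtain ⟨x, hx⟩ : c.extend t ∈ range c := by rw [← c.extend_range]; exact mem_range_self t
    rw [← hx]; exact connectedComponentIn_subset _ _ (hc x)
  -- Three pieces in succession: the ray up to height `y₁` for `r ≤ 1`, a path inside `H \ s` for `1
  -- ≤ r ≤ 2`, then `η`. With the parameters clamped, their concatenation is a sum, continuous term
  -- by term.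
  set ζ : ℝ → ℂ := fun r => F ((min (y₁ * r) y₁ : ℝ) * Complex.I) +
    (c.extend (r - 1) - F (y₁ * Complex.I)) + (η (max (r - 2) 0) - η 0) with hζ
  have h1 : ∀ r, r ≤ 1 → ζ r = F ((y₁ * r : ℝ) * Complex.I) := fun r hr => by
    simp only [hζ]
    rw [min_eq_left (by nlinarith), max_eq_right (by linarith), c.extend_of_le_zero (by linarith)]
    ring
  have h2 : ∀ r, 1 ≤ r → r ≤ 2 → ζ r = c.extend (r - 1) := fun r hr hr2 => by
    simp only [hζ]
    rw [min_eq_right (by nlinarith), max_eq_right (by linarith)]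
    ring
  have h3 : ∀ r, 2 ≤ r → ζ r = η (r - 2) := fun r hr => by
    simp only [hζ]
    rw [min_eq_right (by nlinarith), max_eq_left (by linarith), c.extend_of_one_le (by linarith)]
    ring
  have hmem : ∀ r, 0 < r → ζ r ∈ H \ s := by
    intro r hr
    rcases le_total r 1 with hr1 | hr1
    · rw [h1 r hr1]
      have : 0 < y₁ * r := by positivity
      exact ⟨D.F_mem this, hray _ this (by nlinarith)⟩
    rcases le_total r 2 with hr2 | hr2
    · rw [h2 r hr1 hr2]; exact hcU _
    · rw [h3 r hr2]; exact hηs _ (by linarith)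
  have hcont : ContinuousOn ζ (Ioi 0) := by
    refine ((ContinuousOn.comp D.continuousOn_ray (f := fun r => min (y₁ * r) y₁) (by fun_prop)
      fun r hr => ?_).add ?_).add (ContinuousOn.sub ?_ continuousOn_const)
    · exact lt_min (mul_pos hy₁ hr) hy₁
    · exact (Continuous.sub (c.continuous_extend.comp (by fun_prop)) continuous_const).continuousOn
    · exact hη.comp (f := fun r => max (r - 2) 0) (by fun_prop) fun r _ => by
        simp only [mem_Ici]; exact le_max_right _ _
  obtain ⟨r, hr, hrs⟩ := hsep ζ hcont (fun r hr => (hmem r hr).1) (by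
    have h4 : Tendsto (fun r : ℝ => y₁ * r) (𝓝[>] 0) (𝓝[>] 0) := by
      refine tendsto_nhdsWithin_iff.2 ⟨?_, ?_⟩
      · have : Continuous fun r : ℝ => y₁ * r := by fun_prop
        simpa using (this.tendsto 0).mono_left nhdsWithin_le_nhds
      · filter_upwards [self_mem_nhdsWithin] with r hr
        exact mul_pos hy₁ hr
    refine (D.tendsto_G_ray.comp h4).congr' ?_
    filter_upwards [Ioc_mem_nhdsGT one_pos] with r hr
    rw [h1 r hr.2]; rfl) (by
    refine (hinf.comp (tendsto_atTop_add_const_right atTop (-2 : ℝ) tendsto_id)).congr' ?_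
    filter_upwards [eventually_ge_atTop 2] with r hr
    rw [h3 r hr]; rfl)
  exact (hmem r hr).2 hrs

/-- `s` is a separating arc that separates the other ones from infinity. -/
structure IsOuterArc (H : Set ℂ) (F G : ℂ → ℂ) (p : ℂ) (ε : ℝ) (s : Set ℂ) : Prop where
  isSepArc : IsSepArc H F G p ε s
  exists_mem : ∀ s', IsSepArc H F G p ε s' → s' ≠ s →
      ∀ η : ℝ → ℂ, ContinuousOn η (Ici 0) → MapsTo η (Ici 0) H → η 0 ∈ s' →
        Tendsto η atTop (Bornology.cobounded ℂ) → ∃ r, 0 ≤ r ∧ η r ∈ s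

theorem IsSepArc.subset {s : Set ℂ} (h : IsSepArc H F G p ε s) : s ⊆ sphere p ε ∩ H := by
  obtain ⟨z, -, rfl⟩ := h.exists_eq
  exact connectedComponentIn_subset _ _

theorem IsSepArc.isPreconnected {s : Set ℂ} (h : IsSepArc H F G p ε s) : IsPreconnected s := by
  obtain ⟨z, -, rfl⟩ := h.exists_eq
  exact isPreconnected_connectedComponentIn

theorem IsSepArc.eq_component {s : Set ℂ} (h : IsSepArc H F G p ε s) {x : ℂ} (hx : x ∈ s) :
    s = connectedComponentIn (sphere p ε ∩ H) x := by
  obtain ⟨z, -, rfl⟩ := h.exists_eq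
  exact connectedComponentIn_eq hx

theorem IsSepArc.notMem {s s' : Set ℂ} (h : IsSepArc H F G p ε s) (h' : IsSepArc H F G p ε s')
    (hne : s' ≠ s) {x : ℂ} (hx : x ∈ s) : x ∉ s' := fun hx' =>
  hne ((h'.eq_component hx').trans (h.eq_component hx).symm)

theorem IsSepArc.isOpen_diff (D : TipDomain H F G p) {s : Set ℂ} (h : IsSepArc H F G p ε s) :
    IsOpen (H \ s) := by
  obtain ⟨z, hz, rfl⟩ := h.exists_eq
  exact D.isOpen_diff_arc hz

theorem IsSepArc.exists_ray_mem (D : TipDomain H F G p) {s : Set ℂ} (h : IsSepArc H F G p ε s) :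
    ∃ y : ℝ, 0 < y ∧ F (y * Complex.I) ∈ s :=
  h.separates (fun y : ℝ => F (y * Complex.I)) D.continuousOn_ray (fun _ hy => D.F_mem hy)
    D.tendsto_G_ray D.tendsto_ray_atTop

theorem exists_ray_bounds (D : TipDomain H F G p) (hε : 0 < ε) :
    ∃ y₁ Y : ℝ, 0 < y₁ ∧ ∀ y : ℝ, 0 < y → F (y * Complex.I) ∈ sphere p ε → y ∈ Icc y₁ Y := by
  obtain ⟨y₁, hy₁, -, heq, hmem⟩ := D.exists_component_eq hε
  obtain ⟨Y, hY⟩ := D.exists_bound_G (‖p‖ + ε)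
  refine ⟨y₁, Y, hy₁, fun y hy hys => ⟨?_, ?_⟩⟩
  · by_contra hlt
    have := (hmem y hy (not_le.1 hlt).le).1.1
    rw [mem_ball, mem_sphere.1 hys] at this
    exact lt_irrefl _ this
  · have := hY _ (D.F_mem hy) (by
      have h1 := norm_add_le (F (y * Complex.I) - p) p
      rw [sub_add_cancel, ← dist_eq_norm, mem_sphere.1 hys] at h1; linarith)
    rw [D.G_F _ (ofReal_mul_I_mem_upperHalf hy), norm_mul, Complex.norm_I, Complex.norm_real,
      mul_one, Real.norm_eq_abs, abs_of_pos hy] at this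
    exact this

/-- There is an outermost separating arc; it is the last one on the ray. -/
theorem exists_isOuterArc (D : TipDomain H F G p) (hε : 0 < ε) :
    ∃ s, IsOuterArc H F G p ε s ∧ ∀ s', IsOuterArc H F G p ε s' → s' = s := by
  obtain ⟨y₁, Y, hy₁, hbd⟩ := D.exists_ray_bounds hε
  set T : Set ℝ := {y | 0 < y ∧ ∃ s, IsSepArc H F G p ε s ∧ F (y * Complex.I) ∈ s} with hT
  have hTbd : T ⊆ Icc y₁ Y := fun y hy => by
    obtain ⟨hy0, s, hs, hys⟩ := hy
    exact hbd y hy0 (hs.subset hys).1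
  have hTne : T.Nonempty := by
    obtain ⟨s, hs⟩ := D.exists_isSepArc hε
    obtain ⟨y, hy, hys⟩ := hs.exists_ray_mem D
    exact ⟨y, hy, s, hs, hys⟩
  -- Arcs are relatively open in the circle, so a limit of ray points on separating arcs lies on the
  -- same arc as nearby ones. Hence there is a last such point on the ray, and its arc is the
  -- candidate.
  have hTcl : IsClosed T := by
    rw [← isOpen_compl_iff, isOpen_iff_mem_nhds]
    by_contra hcon
    push Not at hcon
    obtain ⟨y, hyT, hy⟩ := hcon
    have hfreq : ∃ᶠ x in 𝓝 y, x ∈ T := fun h => hy (by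
      filter_upwards [h] with x hx; exact hx)
    have hycl : y ∈ Icc y₁ Y := (isClosed_Icc.mem_of_frequently_of_tendsto
      (hfreq.mono fun x hx => hTbd hx) tendsto_id)
    have hy0 : 0 < y := hy₁.trans_le hycl.1
    have hct : ContinuousAt (fun y : ℝ => F (y * Complex.I)) y :=
      D.continuousOn_ray.continuousAt (Ioi_mem_nhds hy0)
    have hys : F (y * Complex.I) ∈ sphere p ε :=
      isClosed_sphere.mem_of_frequently_of_tendsto (hfreq.mono fun x hx => by
        obtain ⟨hx0, s, hs, hxs⟩ := hx
        exact (hs.subset hxs).1) hct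
    have hev := hct.eventually
      (eventually_mem_connectedComponentIn_sphere hε D.isOpen ⟨hys, D.F_mem hy0⟩)
    obtain ⟨x, hx, hxe⟩ := (hfreq.and_eventually hev).exists
    obtain ⟨hx0, s, hs, hxs⟩ := hx
    have hmem := hxe (hs.subset hxs).1
    refine hyT ⟨hy0, s, hs, ?_⟩
    rw [hs.eq_component hxs, ← connectedComponentIn_eq hmem]
    exact mem_connectedComponentIn ⟨hys, D.F_mem hy0⟩
  have hTc : IsCompact T := isCompact_Icc.of_isClosed_subset hTcl hTbd
  obtain ⟨y', ⟨hy'0, s, hs, hy's⟩, hmax⟩ := hTc.exists_isGreatest hTne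
  have hafter : ∀ s', IsSepArc H F G p ε s' → s' ≠ s → ∀ r, 0 ≤ r →
      F ((y' + r : ℝ) * Complex.I) ∉ s' := by
    intro s' hs' hne r hr hmem
    rcases hr.eq_or_lt with h0 | h0
    · rw [← h0, add_zero] at hmem
      exact hs.notMem hs' hne hy's hmem
    · have := hmax ⟨by linarith, s', hs', hmem⟩
      linarith
  have htail : ContinuousOn (fun r : ℝ => F ((y' + r : ℝ) * Complex.I)) (Ici 0) :=
    D.continuousOn_ray.comp (f := fun r => y' + r) (by fun_prop) fun r hr => by
      simp only [mem_Ici] at hr; simp only [mem_Ioi]; linarith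
  have htailH : ∀ r : ℝ, 0 ≤ r → F ((y' + r : ℝ) * Complex.I) ∈ H := fun r hr =>
    D.F_mem (by linarith)
  have htailinf : Tendsto (fun r : ℝ => F ((y' + r : ℝ) * Complex.I)) atTop
      (Bornology.cobounded ℂ) :=
    D.tendsto_ray_atTop.comp (tendsto_atTop_add_const_left atTop y' tendsto_id)
  refine ⟨s, ⟨hs, ?_⟩, ?_⟩
  · intro s' hs' hne η hη hηH hη0 hinf
    by_contra hcon
    push Not at hcon
    -- the first point of the ray on one of the two arcs
    set P : Set ℝ := Icc y₁ Y ∩ {y : ℝ | F (y * Complex.I) ∉ (H \ s) ∩ (H \ s')} with hP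
    have hPc : IsCompact P := by
      have hcont : ContinuousOn (fun y : ℝ => F (y * Complex.I)) (Icc y₁ Y) :=
        D.continuousOn_ray.mono fun y hy => hy₁.trans_le hy.1
      refine isCompact_Icc.of_isClosed_subset ?_ inter_subset_left
      exact hcont.preimage_isClosed_of_isClosed isClosed_Icc
        ((hs.isOpen_diff D).inter (hs'.isOpen_diff D)).isClosed_compl
    have hPiff : ∀ y : ℝ, 0 < y → (F (y * Complex.I) ∈ s ∨ F (y * Complex.I) ∈ s') → y ∈ P := by
      rintro y hy (h | h)
      · exact ⟨hbd y hy (hs.subset h).1, fun h' => h'.1.2 h⟩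
      · exact ⟨hbd y hy (hs'.subset h).1, fun h' => h'.2.2 h⟩
    obtain ⟨x, ⟨hxI, hxP⟩, hmin⟩ := hPc.exists_isLeast ⟨y', hPiff y' hy'0 (Or.inl hy's)⟩
    have hx0 : 0 < x := hy₁.trans_le hxI.1
    have hxor : F (x * Complex.I) ∈ s ∨ F (x * Complex.I) ∈ s' := by
      by_contra hno
      push Not at hno
      exact hxP ⟨⟨D.F_mem hx0, hno.1⟩, ⟨D.F_mem hx0, hno.2⟩⟩
    -- Follow the ray to its first point `x` on either arc. If it is on `s`, continue along `s` and
    -- leave by the ray beyond `y'`, avoiding `s'`. If it is on `s'`, continue along `s'` and leave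
    -- by `η`, avoiding `s`. Either way one of them fails to separate.
    rcases hxor with hxs | hxs
    · refine D.not_separates (hs'.isOpen_diff D) hx0 (fun y hy hyx hmem => ?_) hs.isPreconnected
        (fun a ha => ⟨(hs.subset ha).2, hs.notMem hs' hne ha⟩) hxs htail
        (fun r hr => ⟨htailH r hr, hafter s' hs' hne r hr⟩) (by simpa using hy's) htailinf
        hs'.separates
      have := hmin (hPiff y hy (Or.inr hmem))
      have hxy : y = x := le_antisymm hyx this
      rw [hxy] at hmem
      exact hs.notMem hs' hne hxs hmem
    · refine D.not_separates (hs.isOpen_diff D) hx0 (fun y hy hyx hmem => ?_) hs'.isPreconnected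
        (fun a ha => ⟨(hs'.subset ha).2, hs'.notMem hs hne.symm ha⟩) hxs hη
        (fun r hr => ⟨hηH hr, hcon r hr⟩) hη0 hinf hs.separates
      have := hmin (hPiff y hy (Or.inl hmem))
      have hxy : y = x := le_antisymm hyx this
      rw [hxy] at hmem
      exact hs'.notMem hs hne.symm hxs hmem
  -- The ray beyond `y'` starts on `s` and misses every other separating arc, so no other arc can be
  -- outermost.
  · intro s' hs'
    by_contra hne
    obtain ⟨r, hr, hrs⟩ := hs'.exists_mem s hs (Ne.symm hne) _ htail (fun r hr => htailH r hr)
      (by simpa using hy's) htailinf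
    exact hafter s' hs'.isSepArc hne r hr hrs

/-- The properties of the image in `ℍ` of a separating arc. -/
theorem IsSepArc.image_subset (D : TipDomain H F G p) {s : Set ℂ} (h : IsSepArc H F G p ε s) :
    G '' s ⊆ upperHalf := by
  rintro _ ⟨z, hz, rfl⟩; exact D.mapsTo_G (h.subset hz).2

theorem IsSepArc.image_isPreconnected (D : TipDomain H F G p) {s : Set ℂ}
    (h : IsSepArc H F G p ε s) : IsPreconnected (G '' s) :=
  h.isPreconnected.image G (D.continuousOn_G.mono fun _ hz => (h.subset hz).2)

theorem IsSepArc.norm_eq (D : TipDomain H F G p) {s : Set ℂ} (h : IsSepArc H F G p ε s) :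
    ∀ w ∈ G '' s, ‖F w - p‖ = ε := by
  rintro _ ⟨z, hz, rfl⟩
  rw [D.F_G z (h.subset hz).2, ← dist_eq_norm]
  exact (h.subset hz).1

theorem exists_image_bound (D : TipDomain H F G p) (R : ℝ) :
    ∃ M : ℝ, ∀ ε ≤ R, ∀ s, IsSepArc H F G p ε s → ∀ w ∈ G '' s, ‖w‖ ≤ M := by
  obtain ⟨M, hM⟩ := D.exists_bound_G (‖p‖ + R)
  refine ⟨M, fun ε hε s hs => ?_⟩
  rintro _ ⟨z, hz, rfl⟩
  refine hM z (hs.subset hz).2 ?_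
  have h1 := norm_add_le (z - p) p
  rw [sub_add_cancel, ← dist_eq_norm, mem_sphere.1 (hs.subset hz).1] at h1; linarith

/-- On both sides of `0` the image of a separating arc accumulates at the real line. -/
theorem IsSepArc.exists_mem_closure (D : TipDomain H F G p) {s : Set ℂ}
    (h : IsSepArc H F G p ε s) {σ : ℝ} (hσ : |σ| = 1) :
    ∃ x : ℝ, 0 ≤ σ * x ∧ (x : ℂ) ∈ closure (G '' s) := by
  by_contra hcon
  push Not at hcon
  obtain ⟨M, hM⟩ := D.exists_image_bound ε
  have hM' := hM ε le_rfl s h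
  have hcomp : IsCompact (closure (G '' s)) :=
    ((isBounded_iff_forall_norm_le.2 ⟨M, hM'⟩).closure).isCompact_closure.of_isClosed_subset
      isClosed_closure subset_closure
  set Z : Set ℂ := (fun r : ℝ => ((σ * r : ℝ) : ℂ)) '' Ici 0 with hZ
  have hσ2 : σ * σ = 1 := by rw [← abs_mul_abs_self, hσ, one_mul]
  have hZcl : IsClosed Z := by
    have : Z = {z : ℂ | z.im = 0 ∧ 0 ≤ σ * z.re} := by
      ext z
      constructor
      · rintro ⟨r, hr, rfl⟩
        refine ⟨Complex.ofReal_im _, ?_⟩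
        rw [Complex.ofReal_re, ← mul_assoc, hσ2, one_mul]; exact hr
      · rintro ⟨h1, h2⟩
        refine ⟨σ * z.re, h2, ?_⟩
        simp only
        rw [← mul_assoc, hσ2, one_mul]
        exact Complex.ext (by simp) (by simp [h1])
    rw [this]
    exact (isClosed_eq Complex.continuous_im continuous_const).inter
      (isClosed_le continuous_const (continuous_const.mul Complex.continuous_re))
  have hdisj : Disjoint (closure (G '' s)) Z := by
    rw [disjoint_left]
    rintro _ hx ⟨r, hr, rfl⟩
    exact hcon (σ * r) (by rw [← mul_assoc, hσ2, one_mul]; exact hr) hx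
  obtain ⟨δ, hδ, hδd⟩ := hdisj.exists_thickenings hcomp hZcl
  -- A curve from `0` to infinity at height at most `δ / 2` over the half-line, hence off the image
  -- of `s`, which has positive distance from the half-line by compactness.
  set η : ℝ → ℂ := fun r => ((σ * r : ℝ) : ℂ) + ((min r (δ / 2) : ℝ) : ℂ) * Complex.I with hη
  have hηc : Continuous η := by fun_prop
  have hηim : ∀ r, (η r).im = min r (δ / 2) := fun r => by simp [hη]
  have hηU : ∀ r ∈ Ioi (0 : ℝ), η r ∈ upperHalf := fun r hr => by
    change 0 < (η r).im
    rw [hηim]; exact lt_min hr (by positivity)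
  have hGF : ∀ r ∈ Ioi (0 : ℝ), G (F (η r)) = η r := fun r hr => D.G_F _ (hηU r hr)
  obtain ⟨r, hr, hrs⟩ := h.separates (F ∘ η)
    (D.univalent.differentiableOn.continuousOn.comp hηc.continuousOn hηU)
    (fun r hr => D.mapsTo_F (hηU r hr)) (by
      have h0 : η 0 = 0 := by
        simp only [hη, mul_zero, Complex.ofReal_zero, zero_add]
        rw [min_eq_left (by positivity)]; simp
      have h1 : Tendsto η (𝓝[>] 0) (𝓝 0) := by
        have := (hηc.tendsto 0).mono_left (nhdsWithin_le_nhds (s := Ioi 0))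
        rwa [h0] at this
      refine h1.congr' ?_
      filter_upwards [self_mem_nhdsWithin] with r hr
      exact (hGF r hr).symm) (by
      refine (D.tendsto_cobounded (η := F ∘ η)
        ((eventually_gt_atTop 0).mono fun r hr => D.mapsTo_F (hηU r hr))).2 ?_
      have h1 : Tendsto η atTop (Bornology.cobounded ℂ) := by
        rw [← tendsto_norm_atTop_iff_cobounded]
        refine tendsto_atTop_mono (fun r => ?_) tendsto_id
        have h2 := Complex.abs_re_le_norm (η r)
        have h3 : (η r).re = σ * r := by simp [hη]
        rw [h3, abs_mul, hσ, one_mul] at h2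
        exact (le_abs_self r).trans h2
      refine h1.congr' ?_
      filter_upwards [eventually_gt_atTop 0] with r hr
      exact (hGF r hr).symm)
  have hmem : η r ∈ G '' s := ⟨_, hrs, hGF r hr⟩
  refine disjoint_left.1 hδd (self_subset_thickening hδ _ (subset_closure hmem)) ?_
  rw [mem_thickening_iff]
  refine ⟨((σ * r : ℝ) : ℂ), ⟨r, le_of_lt hr, rfl⟩, ?_⟩
  rw [dist_eq_norm]
  simp only [hη, add_sub_cancel_left, norm_mul, Complex.norm_I, mul_one, Complex.norm_real,
    Real.norm_eq_abs]
  rw [abs_of_pos (lt_min hr (by positivity))]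
  exact (min_le_right _ _).trans_lt (by linarith)

end TipDomain

end

/-! ### Inverse conformal maps, and the tip domain of a Loewner curve. -/

noncomputable section
open Metric

section Inverse

variable {U V : Set ℂ} {f g : ℂ → ℂ}

theorem nhds_le_map_nhds_of_injOn (hU : IsOpen U) (hg : DifferentiableOn ℂ g U) (hinj : InjOn g U)
    {z : ℂ} (hz : z ∈ U) : 𝓝 (g z) ≤ map g (𝓝 z) := by
  have han : AnalyticAt ℂ g z := hg.analyticAt (hU.mem_nhds hz)
  refine han.eventually_constant_or_nhds_le_map_nhds_aux.resolve_left fun h => ?_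
  have h1 : ∀ᶠ w in 𝓝[≠] z, g w = g z ∧ w ∈ U :=
    (h.and (hU.mem_nhds hz)).filter_mono nhdsWithin_le_nhds
  obtain ⟨w, ⟨hw, hwU⟩, hne⟩ := (h1.and self_mem_nhdsWithin).exists
  exact hne (hinj hwU hz hw)

theorem continuousAt_inverse (hU : IsOpen U) (hg : DifferentiableOn ℂ g U)
    (hinv : ∀ z ∈ U, f (g z) = z) {z : ℂ} (hz : z ∈ U) : ContinuousAt f (g z) := by
  have hinj : InjOn g U := fun x hx y hy h => by rw [← hinv x hx, ← hinv y hy, h]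
  have hmap := nhds_le_map_nhds_of_injOn hU hg hinj hz
  rw [ContinuousAt, hinv z hz]
  refine (tendsto_map' (?_ : Tendsto (f ∘ g) (𝓝 z) (𝓝 z))).mono_left hmap
  refine tendsto_id.congr' ?_
  filter_upwards [hU.mem_nhds hz] with x hx
  exact (hinv x hx).symm

/-- The inverse of an injective holomorphic map is holomorphic with non-vanishing derivative. -/
theorem differentiableAt_and_deriv_ne_zero_of_inverse (hU : IsOpen U) (hV : IsOpen V) (hg : DifferentiableOn ℂ g U)
    (hf : MapsTo f V U) (hinv : ∀ z ∈ U, f (g z) = z) (hinv' : ∀ w ∈ V, g (f w) = w) {w : ℂ}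
    (hw : w ∈ V) : DifferentiableAt ℂ f w ∧ deriv f w ≠ 0 := by
  have hinj : InjOn g U := fun x hx y hy h => by rw [← hinv x hx, ← hinv y hy, h]
  have hcont : ∀ w ∈ V, ContinuousAt f w := fun w hw => by
    have := continuousAt_inverse hU hg hinv (hf hw)
    rwa [hinv' w hw] at this
  set z := f w with hz
  have hzU : z ∈ U := hf hw
  have hdiff : ∀ w ∈ V, deriv g (f w) ≠ 0 → DifferentiableAt ℂ f w := fun w hw h =>
    (((hg.differentiableAt (hU.mem_nhds (hf hw))).hasDerivAt).of_local_left_inverse (hcont w hw) h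
      (mem_of_superset (hV.mem_nhds hw) hinv')).differentiableAt
  have hdan : AnalyticAt ℂ (deriv g) z := (hg.analyticAt (hU.mem_nhds hzU)).deriv
  have hfd : DifferentiableAt ℂ f w := by
    -- If `g'` vanished near `z`, then `g` would be locally constant. Otherwise a zero of `g'` is
    -- isolated, and the continuous inverse extends holomorphically over one point.
    rcases hdan.eventually_eq_zero_or_eventually_ne_zero with h | h
    · exfalso
      obtain ⟨δ, hδ, hball⟩ := Metric.eventually_nhds_iff_ball.1 (h.and (hU.mem_nhds hzU))
      have hconst : ∀ x ∈ ball z δ, g x = g z := fun x hx =>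
        isOpen_ball.is_const_of_deriv_eq_zero (convex_ball z δ).isPreconnected
          (hg.mono fun y hy => (hball y hy).2) (fun y hy => (hball y hy).1) hx
          (mem_ball_self hδ)
      have hx : z + ((δ / 2 : ℝ) : ℂ) ∈ ball z δ := by
        rw [mem_ball, dist_eq_norm, add_sub_cancel_left, Complex.norm_real, Real.norm_eq_abs,
          abs_of_pos (by positivity)]
        linarith
      have := hinj (hball _ hx).2 hzU (hconst _ hx)
      rw [add_eq_left, Complex.ofReal_eq_zero] at this
      linarith
    · refine (Complex.analyticAt_of_differentiable_on_punctured_nhds_of_continuousAt ?_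
        (hcont w hw)).differentiableAt
      have ht : Tendsto f (𝓝[≠] w) (𝓝[≠] z) := by
        refine tendsto_nhdsWithin_iff.2 ⟨(hcont w hw).mono_left nhdsWithin_le_nhds, ?_⟩
        filter_upwards [self_mem_nhdsWithin, nhdsWithin_le_nhds (hV.mem_nhds hw)] with x hx hxV hxz
        refine hx ?_
        rw [mem_singleton_iff, ← hinv' x hxV, ← hinv' w hw, mem_singleton_iff.1 hxz]
      filter_upwards [ht.eventually h, nhdsWithin_le_nhds (hV.mem_nhds hw)] with x hx hxV
      exact hdiff x hxV hx
  refine ⟨hfd, fun h0 => ?_⟩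
  have h1 := (hg.differentiableAt (hU.mem_nhds hzU)).hasDerivAt.comp w hfd.hasDerivAt
  rw [h0, mul_zero] at h1
  have h2 : HasDerivAt (g ∘ f) 1 w := (hasDerivAt_id w).congr_of_eventuallyEq
    (mem_of_superset (hV.mem_nhds hw) hinv')
  exact zero_ne_one (h1.unique h2)

end Inverse

namespace LoewnerCurve

variable (L : LoewnerCurve) {t : ℝ}

theorem isCompact_hull (t : ℝ) : IsCompact (L.γ '' Icc 0 t) :=
  isCompact_Icc.image_of_continuousOn (L.continuousOn_γ.mono fun _ hs => hs.1)

theorem isOpen_compl_hull (t : ℝ) : IsOpen (upperHalf \ L.γ '' Icc 0 t) :=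
  isOpen_upperHalf.sdiff (L.isCompact_hull t).isClosed

theorem isOpen_H (t : ℝ) : IsOpen (L.H t) := by
  rw [isOpen_iff_mem_nhds]
  intro z hz
  refine mem_of_superset ((L.isOpen_compl_hull t).connectedComponentIn.mem_nhds
    (mem_connectedComponentIn hz.1)) fun w hw => ⟨connectedComponentIn_subset _ _ hw, ?_⟩
  rw [← connectedComponentIn_eq hw]
  exact hz.2

theorem tip_notMem_H (ht : 0 ≤ t) : L.γ t ∉ L.H t := fun h =>
  h.1.2 ⟨t, ⟨ht, le_rfl⟩, rfl⟩

theorem exists_norm_bound_mem_H (t : ℝ) : ∃ M : ℝ, ∀ z ∈ upperHalf, M < ‖z‖ → z ∈ L.H t := by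
  obtain ⟨M, hM⟩ := (L.isCompact_hull t).isBounded.exists_norm_le
  have hsub : {w | w ∈ upperHalf ∧ M < ‖w‖} ⊆ upperHalf \ L.γ '' Icc 0 t := fun w hw =>
    ⟨hw.1, fun hK => (hM w hK).not_gt hw.2⟩
  refine ⟨M, fun z hz hzM => ⟨hsub ⟨hz, hzM⟩, fun hbd => ?_⟩⟩
  have hpre := (isPreconnected_upperHalf_diff M).subset_connectedComponentIn
    (x := z) ⟨hz, hzM⟩ hsub
  obtain ⟨M', hM'⟩ := (hbd.subset hpre).exists_norm_le
  have hpos : 0 < max (max M M') 0 + 1 := by positivity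
  have hn : ‖((max (max M M') 0 + 1 : ℝ) : ℂ) * Complex.I‖ = max (max M M') 0 + 1 := by
    rw [norm_mul, Complex.norm_I, mul_one, Complex.norm_real, Real.norm_eq_abs, abs_of_pos hpos]
  have h1 := hM' _ ⟨ofReal_mul_I_mem_upperHalf hpos, by
    rw [hn]; linarith [le_max_left (max M M') 0, le_max_left M M']⟩
  rw [hn] at h1
  linarith [le_max_left (max M M') 0, le_max_right M M']

theorem mapsTo_g (ht : 0 ≤ t) : MapsTo (L.g t) (L.H t) upperHalf := (L.bijOn_g t ht).mapsTo

theorem f_g (ht : 0 ≤ t) {z : ℂ} (hz : z ∈ L.H t) : L.f t (L.g t z) = z :=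
  (L.bijOn_g t ht).invOn_invFunOn.1 hz

theorem g_f (ht : 0 ≤ t) {w : ℂ} (hw : w ∈ upperHalf) : L.g t (L.f t w) = w :=
  (L.bijOn_g t ht).invOn_invFunOn.2 hw

theorem mapsTo_f (ht : 0 ≤ t) : MapsTo (L.f t) upperHalf (L.H t) :=
  (L.bijOn_g t ht).surjOn.mapsTo_invFunOn

theorem tendsto_g_sub (ht : 0 ≤ t) :
    Tendsto (fun z => L.g t z - z) (Bornology.cobounded ℂ ⊓ 𝓟 (L.H t)) (𝓝 0) := by
  have hinv : Tendsto (fun z : ℂ => ‖z‖⁻¹) (Bornology.cobounded ℂ ⊓ 𝓟 (L.H t)) (𝓝 0) :=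
    (tendsto_norm_cobounded_atTop.inv_tendsto_atTop).mono_left inf_le_left
  have h1 : Tendsto (fun z : ℂ => ‖z‖ ^ (-2 : ℤ)) (Bornology.cobounded ℂ ⊓ 𝓟 (L.H t)) (𝓝 0) := by
    have := hinv.pow 2
    rw [zero_pow two_ne_zero] at this
    refine this.congr fun z => ?_
    rw [zpow_neg, inv_pow]; norm_cast
  have h2 := (L.expansion_g t ht).trans_tendsto h1
  have h3 : Tendsto (fun z : ℂ => ((L.a * t : ℝ) : ℂ) / z)
      (Bornology.cobounded ℂ ⊓ 𝓟 (L.H t)) (𝓝 0) := by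
    rw [tendsto_zero_iff_norm_tendsto_zero]
    have := hinv.const_mul ‖((L.a * t : ℝ) : ℂ)‖
    rw [mul_zero] at this
    refine this.congr fun z => ?_
    rw [norm_div, div_eq_mul_inv]
  have := h2.add h3
  rw [add_zero] at this
  exact this.congr fun z => by ring

theorem exists_norm_g_sub_le (ht : 0 ≤ t) :
    ∃ M : ℝ, ∀ z ∈ L.H t, M < ‖z‖ → ‖L.g t z - z‖ ≤ 1 := by
  have h := (L.tendsto_g_sub ht).norm.eventually (Iic_mem_nhds (by simp : ‖(0 : ℂ)‖ < 1))
  rw [eventually_inf_principal, ← comap_norm_atTop, eventually_comap] at h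
  obtain ⟨M, hM⟩ := eventually_atTop.1 h
  exact ⟨M, fun z hz hzM => hM _ hzM.le z rfl hz⟩

/-- Far out `g_t` moves points by at most 1, so `|f_t|` never equals `r₀` on `|w| > r₀ + 1`. That
set is connected in the half-plane and `|f_t| > r₀` somewhere on it, hence everywhere. -/
theorem exists_bound_g (ht : 0 ≤ t) (r : ℝ) : ∃ r', ∀ z ∈ L.H t, ‖z‖ ≤ r → ‖L.g t z‖ ≤ r' := by
  obtain ⟨M, hM⟩ := L.exists_norm_g_sub_le ht
  obtain ⟨M', hM'⟩ := L.exists_norm_bound_mem_H t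
  obtain ⟨r₀, h0, h0M, h0M', h0r⟩ : ∃ r₀ : ℝ, 0 < r₀ ∧ M < r₀ ∧ M' < r₀ ∧ r < r₀ :=
    ⟨max (max M M') (max r 0) + 1, by positivity,
      by linarith [le_max_left (max M M') (max r 0), le_max_left M M'],
      by linarith [le_max_left (max M M') (max r 0), le_max_right M M'],
      by linarith [le_max_right (max M M') (max r 0), le_max_left r 0]⟩
  set E := {w | w ∈ upperHalf ∧ r₀ + 1 < ‖w‖} with hE
  have hcont : ContinuousOn (fun w => ‖L.f t w‖) E := by
    refine ContinuousOn.norm fun w hw => ?_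
    have := continuousAt_inverse (L.isOpen_H t) (L.differentiableOn_g t ht)
      (fun z hz => L.f_g ht hz) (L.mapsTo_f ht hw.1)
    rw [L.g_f ht hw.1] at this
    exact this.continuousWithinAt
  have hne : ∀ w ∈ E, ‖L.f t w‖ ≠ r₀ := fun w hw h => by
    have h1 := hM _ (L.mapsTo_f ht hw.1) (by rw [h]; exact h0M)
    rw [L.g_f ht hw.1] at h1
    have h2 := norm_add_le (w - L.f t w) (L.f t w)
    rw [sub_add_cancel, h] at h2
    linarith [hw.2]
  have hpre : IsPreconnected ((fun w => ‖L.f t w‖) '' E) :=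
    (isPreconnected_upperHalf_diff (r₀ + 1)).image _ hcont
  set z₀ : ℂ := ((r₀ + 3 : ℝ) : ℂ) * Complex.I with hz₀
  have hz₀n : ‖z₀‖ = r₀ + 3 := by
    rw [hz₀, norm_mul, Complex.norm_I, mul_one, Complex.norm_real, Real.norm_eq_abs,
      abs_of_pos (by positivity)]
  have hz₀H : z₀ ∈ L.H t :=
    hM' _ (ofReal_mul_I_mem_upperHalf (by positivity)) (by rw [hz₀n]; linarith)
  have hmem : L.g t z₀ ∈ E := by
    refine ⟨L.mapsTo_g ht hz₀H, ?_⟩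
    have h1 := hM _ hz₀H (by rw [hz₀n]; linarith)
    have h2 := norm_sub_le (L.g t z₀) (L.g t z₀ - z₀)
    rw [sub_sub_cancel, hz₀n] at h2
    linarith
  refine ⟨r₀ + 1, fun z hz hzr => ?_⟩
  by_contra hcon
  have hzE : L.g t z ∈ E := ⟨L.mapsTo_g ht hz, not_le.1 hcon⟩
  have hI := hpre.ordConnected.out (mem_image_of_mem _ hzE) (mem_image_of_mem _ hmem)
  simp only [L.f_g ht hz, L.f_g ht hz₀H, hz₀n] at hI
  obtain ⟨w, hw, hwr⟩ := hI (show r₀ ∈ Icc ‖z‖ (r₀ + 3) from ⟨by linarith, by linarith⟩)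
  exact hne w hw hwr

theorem add_V_mem {w : ℂ} (hw : w ∈ upperHalf) (x : ℝ) : w + x ∈ upperHalf := by
  change 0 < (w + x).im
  rw [Complex.add_im, Complex.ofReal_im, add_zero]
  exact hw

/-- Translation by `V t` moves the prime end of the tip to `0`; behaviour at infinity comes from the
expansion of `g_t`. -/
theorem tipDomain (ht : 0 ≤ t) :
    TipDomain (L.H t) (L.fHat t) (fun z => L.g t z - L.V t) (L.γ t) := by
  have hd : ∀ w ∈ upperHalf, DifferentiableAt ℂ (L.f t) w ∧ deriv (L.f t) w ≠ 0 := fun w hw =>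
    differentiableAt_and_deriv_ne_zero_of_inverse (L.isOpen_H t) isOpen_upperHalf (L.differentiableOn_g t ht)
      (L.mapsTo_f ht) (fun z hz => L.f_g ht hz) (fun w hw => L.g_f ht hw) hw
  have hGF : ∀ w ∈ upperHalf, L.g t (L.fHat t w) - L.V t = w := fun w hw => by
    rw [fHat, L.g_f ht (add_V_mem hw _), add_sub_cancel_right]
  refine ⟨⟨fun w hw => ?_, fun w hw w' hw' h => ?_, fun w hw => ?_⟩, L.isOpen_H t, fun w hw =>
    L.mapsTo_f ht (add_V_mem hw _), fun z hz => ?_, fun z hz => ?_, hGF, ?_, ?_,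
    L.tip_notMem_H ht, fun r => ?_, fun r => ?_⟩
  · exact ((hd _ (add_V_mem hw (L.V t))).1.comp w (by fun_prop)).differentiableWithinAt
  · rw [← hGF w hw, ← hGF w' hw', h]
  · have : deriv (L.fHat t) w = deriv (L.f t) (w + L.V t) := by
      exact deriv_comp_add_const (L.f t) (L.V t : ℂ) w
    rw [this]
    exact (hd _ (add_V_mem hw (L.V t))).2
  · have := add_V_mem (L.mapsTo_g ht hz) (-L.V t)
    rwa [Complex.ofReal_neg, ← sub_eq_add_neg] at this
  · rw [fHat, sub_add_cancel, L.f_g ht hz]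
  · exact (L.differentiableOn_g t ht).continuousOn.sub continuousOn_const
  · refine (L.tip t ht).congr fun y => ?_
    rw [fHat, add_comm]; rfl
  · obtain ⟨r', hr'⟩ := L.exists_bound_g ht r
    exact ⟨r' + ‖(L.V t : ℂ)‖, fun z hz h => (norm_sub_le _ _).trans (by linarith [hr' z hz h])⟩
  · obtain ⟨M, hM⟩ := L.exists_norm_g_sub_le ht
    refine ⟨max M (r + ‖(L.V t : ℂ)‖ + 1), fun z hz h => ?_⟩
    by_contra hcon
    rw [not_le, max_lt_iff] at hcon
    have h1 := hM z hz hcon.1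
    have h2 := norm_sub_le (L.g t z) (L.g t z - z)
    rw [sub_sub_cancel] at h2
    have h3 := norm_add_le (L.g t z - L.V t) (L.V t)
    rw [sub_add_cancel] at h3
    linarith [hcon.2]

theorem isSeparatingArc_iff (ε : ℝ) (s : Set ℂ) : L.IsSeparatingArc t ε s ↔
    TipDomain.IsSepArc (L.H t) (L.fHat t) (fun z => L.g t z - L.V t) (L.γ t) ε s := by
  have key : ∀ η : ℝ → ℂ, MapsTo η (Ioi 0) (L.H t) →
      (Tendsto η (𝓝[>] 0) (L.primeEnd t (L.V t)) ↔
        Tendsto (fun r => L.g t (η r) - L.V t) (𝓝[>] 0) (𝓝 0)) := fun η hη => by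
    rw [primeEnd, tendsto_inf, tendsto_comap_iff, tendsto_principal,
      and_iff_left (eventually_mem_nhdsWithin.mono hη), ← tendsto_sub_nhds_zero_iff]
    rfl
  constructor
  · rintro ⟨h1, h2, h3⟩
    exact ⟨h1, h2, fun η hη hm h0 hinf => h3 η hη hm ((key η hm).2 h0) hinf⟩
  · rintro ⟨h1, h2, h3⟩
    exact ⟨h1, h2, fun η hη hm h0 hinf => h3 η hη hm ((key η hm).1 h0) hinf⟩

theorem isTipArc_iff (ε : ℝ) (s : Set ℂ) : L.IsTipArc t ε s ↔
    TipDomain.IsOuterArc (L.H t) (L.fHat t) (fun z => L.g t z - L.V t) (L.γ t) ε s := by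
  simp only [IsTipArc, L.isSeparatingArc_iff]
  exact ⟨fun h => ⟨h.1, h.2⟩, fun h => ⟨h.1, h.2⟩⟩

/-- Exactly one tip arc exists, so the union defining `tipArc` is that arc. -/
theorem isSepArc_tipArc (ht : 0 ≤ t) {ε : ℝ} (hε : 0 < ε) :
    TipDomain.IsSepArc (L.H t) (L.fHat t) (fun z => L.g t z - L.V t) (L.γ t) ε
      (L.tipArc t ε) := by
  obtain ⟨s, hs, huniq⟩ := (L.tipDomain ht).exists_isOuterArc hε
  have : L.tipArc t ε = s := by
    rw [tipArc, show {s | L.IsTipArc t ε s} = {s} from ?_, sUnion_singleton]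
    ext s'
    simp only [mem_ofPred_eq, mem_singleton_iff, L.isTipArc_iff]
    exact ⟨huniq s', fun h => h ▸ hs⟩
  rw [this]
  exact hs.isSepArc

/-- The crosscut `g_t(σ_{t,ε}) - V_t` of the upper half-plane. -/
def crosscut (t ε : ℝ) : Set ℂ := (fun z => L.g t z - L.V t) '' L.tipArc t ε

theorem mem_endpointImages_iff {ε x : ℝ} :
    x ∈ L.endpointImages t ε ↔ ((x - L.V t : ℝ) : ℂ) ∈ closure (L.crosscut t ε) := by
  have h : L.crosscut t ε = (Homeomorph.subRight (L.V t : ℂ)) '' (L.g t '' L.tipArc t ε) := by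
    rw [image_image]; rfl
  rw [h, ← Homeomorph.image_closure, Complex.ofReal_sub]
  change _ ↔ (Homeomorph.subRight (L.V t : ℂ)) (x : ℂ) ∈ _
  rw [Function.Injective.mem_set_image (Homeomorph.injective _)]
  rfl

theorem exists_crosscut_bound (ht : 0 ≤ t) :
    ∃ M : ℝ, ∀ ε ∈ Ioc (0 : ℝ) 1, ∀ w ∈ closure (L.crosscut t ε), ‖w‖ ≤ M := by
  obtain ⟨M, hM⟩ := (L.tipDomain ht).exists_image_bound 1
  refine ⟨M, fun ε hε w hw => ?_⟩
  have : L.crosscut t ε ⊆ closedBall 0 M := fun w hw =>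
    mem_closedBall_zero_iff.2 (hM ε hε.2 _ (L.isSepArc_tipArc ht hε.1) w hw)
  exact mem_closedBall_zero_iff.1 (closure_minimal this isClosed_closedBall hw)

theorem isCompact_endpointImages (ht : 0 ≤ t) {ε : ℝ} (hε : ε ∈ Ioc (0 : ℝ) 1) :
    IsCompact (L.endpointImages t ε) := by
  obtain ⟨M, hM⟩ := L.exists_crosscut_bound ht
  have hcl : IsClosed (L.endpointImages t ε) := isClosed_closure.preimage Complex.continuous_ofReal
  refine (isCompact_Icc (a := L.V t - M) (b := L.V t + M)).of_isClosed_subset hcl fun x hx => ?_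
  have h1 := hM ε hε _ (L.mem_endpointImages_iff.1 hx)
  rw [Complex.norm_real, Real.norm_eq_abs, abs_le] at h1
  constructor <;> linarith [h1.1, h1.2]

/-- The crosscut accumulates at the real line on both sides of `V t`, and compactness makes the
infimum and supremum attained. Only these two closure points enter the estimates, so the limits
along the arc are never needed. -/
theorem xMinus_xPlus_spec (ht : 0 ≤ t) {ε : ℝ} (hε : ε ∈ Ioc (0 : ℝ) 1) :
    L.xMinus t ε ≤ L.V t ∧ L.V t ≤ L.xPlus t ε ∧
    ((L.xMinus t ε - L.V t : ℝ) : ℂ) ∈ closure (L.crosscut t ε) ∧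
    ((L.xPlus t ε - L.V t : ℝ) : ℂ) ∈ closure (L.crosscut t ε) := by
  have hc := L.isCompact_endpointImages ht hε
  have hs := L.isSepArc_tipArc ht hε.1
  obtain ⟨x, hx, hxc⟩ := hs.exists_mem_closure (L.tipDomain ht) (σ := 1) (by simp)
  obtain ⟨x', hx', hxc'⟩ := hs.exists_mem_closure (L.tipDomain ht) (σ := -1) (by simp)
  have h1 : x + L.V t ∈ L.endpointImages t ε := by
    rw [mem_endpointImages_iff, add_sub_cancel_right]; exact hxc
  have h2 : x' + L.V t ∈ L.endpointImages t ε := by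
    rw [mem_endpointImages_iff, add_sub_cancel_right]; exact hxc'
  refine ⟨?_, ?_, L.mem_endpointImages_iff.1 (hc.sInf_mem ⟨_, h1⟩),
    L.mem_endpointImages_iff.1 (hc.sSup_mem ⟨_, h1⟩)⟩
  · exact (csInf_le hc.bddBelow h2).trans (by linarith)
  · exact le_trans (by linarith) (le_csSup hc.bddAbove h1)

end LoewnerCurve

end

/-! ### Harmonic measure: maximum principle and the argument function. -/

noncomputable section
open Metric

theorem DifferentiableOn.circleAverage_im {h : ℂ → ℂ} {U : Set ℂ} (hU : DifferentiableOn ℂ h U)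
    {z : ℂ} {r : ℝ} (hr : 0 < r) (hsub : closedBall z r ⊆ U) :
    Real.circleAverage (fun w => (h w).im) z r = (h z).im := by
  have hc : ContinuousOn h (sphere z r) := (hU.mono hsub).continuousOn.mono sphere_subset_closedBall
  have h1 := Complex.imCLM.circleAverage_comp_comm (hc.circleIntegrable hr.le)
  have h2 : Real.circleAverage h z r = h z := by
    refine DiffContOnCl.circleAverage ?_
    rw [abs_of_pos hr]
    exact hU.diffContOnCl_ball hsub
  rw [h2] at h1
  exact h1

/-- The maximum principle on an open set: a continuous function with the sub-mean value property
whose superlevel sets are compact is non-positive. -/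
theorem le_zero_of_subharmonic {U : Set ℂ} (hU : IsOpen U) {v : ℂ → ℝ} (hv : IsSubharmonicOn v U)
    (hK : ∀ δ : ℝ, 0 < δ → IsCompact {z | z ∈ U ∧ δ ≤ v z}) {z : ℂ} (hz : z ∈ U) : v z ≤ 0 := by
  by_contra hpos
  rw [not_le] at hpos
  obtain ⟨m, ⟨hmU, hmδ⟩, hmax⟩ := (hK _ hpos).exists_isMaxOn ⟨z, hz, le_rfl⟩
    (hv.1.mono fun w hw => hw.1)
  have hM : 0 < v m := hpos.trans_le hmδ
  have hmax' : ∀ w ∈ U, v w ≤ v m := fun w hw => by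
    by_cases h : v z ≤ v w
    · exact hmax ⟨hw, h⟩
    · exact (not_le.1 h).le.trans hmδ
  -- The rightmost maximum point: the point `q + r` of a small circle about it lies further right,
  -- so the value there is strictly smaller and the mean value inequality fails.
  obtain ⟨q, ⟨hqU, hqM⟩, hqre⟩ := (hK _ hM).exists_isMaxOn ⟨m, hmU, le_rfl⟩
    Complex.continuous_re.continuousOn
  obtain ⟨r, hr, hsub⟩ := Metric.nhds_basis_closedBall.mem_iff.1 (hU.mem_nhds hqU)
  have hcm : ∀ θ, circleMap q r θ ∈ closedBall q r := fun θ => circleMap_mem_closedBall q hr.le θ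
  have hlt : v (circleMap q r 0) < v m := by
    refine (hmax' _ (hsub (hcm 0))).lt_of_ne fun heq => ?_
    have := hqre (show circleMap q r 0 ∈ _ from ⟨hsub (hcm 0), heq.ge⟩)
    simp [circleMap] at this
    linarith
  have hcont : Continuous fun θ => v (circleMap q r θ) :=
    hv.1.comp_continuous (continuous_circleMap q r) fun θ => hsub (hcm θ)
  have hint := intervalIntegral.integral_lt_integral_of_continuousOn_of_le_of_exists_lt
    Real.two_pi_pos hcont.continuousOn (continuousOn_const (c := v m))
    (fun θ _ => hmax' _ (hsub (hcm θ))) ⟨0, ⟨le_rfl, Real.two_pi_pos.le⟩, hlt⟩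
  have hmean := hv.2 q r hr hsub
  rw [Real.circleAverage_def, smul_eq_mul] at hmean
  rw [intervalIntegral.integral_const, sub_zero, smul_eq_mul] at hint
  have h2 : (2 * Real.pi)⁻¹ * ∫ θ in (0 : ℝ)..2 * Real.pi, v (circleMap q r θ) < v m := by
    rw [inv_mul_lt_iff₀ Real.two_pi_pos]; exact hint
  linarith [hmax' q hqU]

section Interval

/-- The harmonic measure of the interval `[a, b]` in the upper half-plane. -/
def intervalMeasure (a b : ℝ) (w : ℂ) : ℝ := ((w - b) / (w - a)).arg / Real.pi

variable {a b : ℝ}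

theorem sub_ofReal_ne_zero {w : ℂ} (hw : w ∈ upperHalf) (x : ℝ) : w - x ≠ 0 := fun h => by
  have : (w - x).im = 0 := by rw [h]; simp
  rw [Complex.sub_im, Complex.ofReal_im, sub_zero] at this
  exact (ne_of_gt hw) this

theorem im_sub_div_sub (a b : ℝ) (w : ℂ) :
    ((w - b) / (w - a)).im = w.im * (b - a) / Complex.normSq (w - a) := by
  simp [Complex.div_im]
  ring

theorem sub_div_sub_mem_slitPlane (hab : a ≤ b) {w : ℂ} (hw : w ∈ upperHalf) :
    (w - b) / (w - a) ∈ Complex.slitPlane := by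
  have hw' : 0 < w.im := hw
  rcases hab.eq_or_lt with rfl | hlt
  · rw [div_self (sub_ofReal_ne_zero hw _)]; exact Complex.one_mem_slitPlane
  · refine Complex.mem_slitPlane_iff.2 (Or.inr (ne_of_gt ?_))
    rw [im_sub_div_sub]
    have := Complex.normSq_pos.2 (sub_ofReal_ne_zero hw a)
    have := sub_pos.2 hlt
    positivity

theorem differentiableOn_log_sub_div_sub (hab : a ≤ b) :
    DifferentiableOn ℂ (fun w => Complex.log ((w - b) / (w - a))) upperHalf := fun w hw => by
  refine (DifferentiableAt.clog (f := fun w : ℂ => (w - b) / (w - a)) ?_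
    (sub_div_sub_mem_slitPlane hab hw)).differentiableWithinAt
  exact (by fun_prop : DifferentiableAt ℂ (fun w : ℂ => w - b) w).div (by fun_prop)
    (sub_ofReal_ne_zero hw a)

theorem im_sub_div_sub_nonneg (hab : a ≤ b) {w : ℂ} (hw : w ∈ upperHalf) :
    0 ≤ ((w - b) / (w - a)).im := by
  have hw' : 0 < w.im := hw
  rw [im_sub_div_sub]
  have := Complex.normSq_nonneg (w - a)
  have := sub_nonneg.2 hab
  positivity

theorem intervalMeasure_nonneg (hab : a ≤ b) {w : ℂ} (hw : w ∈ upperHalf) :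
    0 ≤ intervalMeasure a b w := by
  refine div_nonneg ?_ Real.pi_pos.le
  rw [Complex.arg_nonneg_iff]
  exact im_sub_div_sub_nonneg hab hw

theorem intervalMeasure_le_one (a b : ℝ) (w : ℂ) : intervalMeasure a b w ≤ 1 := by
  rw [intervalMeasure, div_le_one Real.pi_pos]
  exact Complex.arg_le_pi _

theorem tendsto_intervalMeasure_of_notMem {x : ℝ} (hab : a ≤ b) (hx : x ∉ Icc a b) :
    Tendsto (intervalMeasure a b) (𝓝 (x : ℂ)) (𝓝 0) := by
  have hpos : 0 < (x - b) / (x - a) := by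
    rcases lt_or_ge x a with h | h
    · exact div_pos_of_neg_of_neg (by linarith) (by linarith)
    · have : b < x := by
        by_contra hcon
        exact hx ⟨h, not_lt.1 hcon⟩
      exact div_pos (by linarith) (by linarith)
  have hne : (x : ℂ) - a ≠ 0 := by
    intro h
    rw [← Complex.ofReal_sub, Complex.ofReal_eq_zero] at h
    rw [h, div_zero] at hpos
    exact lt_irrefl _ hpos
  have hval : ((x : ℂ) - b) / (x - a) = (((x - b) / (x - a) : ℝ) : ℂ) := by push_cast; rfl
  have hc : ContinuousAt (fun w : ℂ => (w - b) / (w - a)) x :=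
    ContinuousAt.div (by fun_prop) (by fun_prop) hne
  have h2 : ContinuousAt Complex.arg (((x : ℂ) - b) / (x - a)) := Complex.continuousAt_arg (by
    rw [hval]; exact Complex.ofReal_mem_slitPlane.2 hpos)
  have h3 := (ContinuousAt.comp (f := fun w : ℂ => (w - b) / (w - a)) h2 hc).tendsto.div_const
    Real.pi
  simp only [Function.comp_apply] at h3
  rw [hval, Complex.arg_ofReal_of_nonneg hpos.le, zero_div] at h3
  exact h3

theorem tendsto_intervalMeasure_of_mem {x : ℝ} (hx : x ∈ Ioo a b) :
    Tendsto (intervalMeasure a b) (𝓝[upperHalf] (x : ℂ)) (𝓝 1) := by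
  have hab : a ≤ b := (hx.1.trans hx.2).le
  have hneg : (x - b) / (x - a) < 0 := div_neg_of_neg_of_pos (by linarith [hx.2]) (by linarith [hx.1])
  have hne : (x : ℂ) - a ≠ 0 := by
    rw [← Complex.ofReal_sub, Complex.ofReal_ne_zero]; linarith [hx.1]
  have hval : ((x : ℂ) - b) / (x - a) = (((x - b) / (x - a) : ℝ) : ℂ) := by push_cast; rfl
  have hc : ContinuousAt (fun w : ℂ => (w - b) / (w - a)) x :=
    ContinuousAt.div (by fun_prop) (by fun_prop) hne
  have h1 : Tendsto (fun w : ℂ => (w - b) / (w - a)) (𝓝[upperHalf] (x : ℂ))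
      (𝓝[{z : ℂ | 0 ≤ z.im}] ((((x - b) / (x - a) : ℝ) : ℂ))) := by
    refine tendsto_nhdsWithin_iff.2 ⟨?_, ?_⟩
    · rw [← hval]; exact hc.tendsto.mono_left nhdsWithin_le_nhds
    · filter_upwards [self_mem_nhdsWithin] with w hw using im_sub_div_sub_nonneg hab hw
  have h2 := (Complex.tendsto_arg_nhdsWithin_im_nonneg_of_re_neg_of_im_zero
    (z := (((x - b) / (x - a) : ℝ) : ℂ)) (by rwa [Complex.ofReal_re]) (Complex.ofReal_im _)).comp h1
  have h3 := h2.div_const Real.pi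
  rw [div_self Real.pi_ne_zero] at h3
  exact h3

theorem sub_div_sub_eq {w : ℂ} (hw : w - a ≠ 0) : (w - b) / (w - a) = 1 - (b - a) * (w - a)⁻¹ := by
  field_simp; ring

theorem tendsto_intervalMeasure_cobounded (a b : ℝ) :
    Tendsto (intervalMeasure a b) (Bornology.cobounded ℂ) (𝓝 0) := by
  have h0 : Tendsto (fun w : ℂ => w - a) (Bornology.cobounded ℂ) (Bornology.cobounded ℂ) := by
    exact tendsto_sub_const_cobounded _
  have h1 : Tendsto (fun w : ℂ => 1 - ((b : ℂ) - a) * (w - a)⁻¹) (Bornology.cobounded ℂ) (𝓝 1) := by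
    have := ((tendsto_inv₀_cobounded.comp h0).const_mul ((b : ℂ) - a)).const_sub 1
    simpa using this
  have h2 := ((Complex.continuousAt_arg Complex.one_mem_slitPlane).tendsto.comp h1).div_const
    Real.pi
  rw [Complex.arg_one, zero_div] at h2
  refine h2.congr' ?_
  filter_upwards [h0.eventually (Bornology.eventually_ne_cobounded 0)] with w hw
  simp only [Function.comp_apply, intervalMeasure]
  rw [sub_div_sub_eq hw]

/-- Write `(w - b) / (w - a) = 1 - (b - a) s` with `s = 1 / (w - a)`. Its logarithm is asymptotic to
`-(b - a) s`, and `y s → -i` along `η`. -/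
theorem tendsto_mul_intervalMeasure (a b : ℝ) {η : ℝ → ℂ}
    (hη : Tendsto (fun y : ℝ => η y - y * Complex.I) atTop (𝓝 0)) :
    Tendsto (fun y => y * intervalMeasure a b (η y)) atTop (𝓝 ((b - a) / Real.pi)) := by
  have hy : Tendsto (fun y : ℝ => ((y : ℂ))⁻¹) atTop (𝓝 0) := by
    have := (Complex.continuous_ofReal.tendsto 0).comp (tendsto_inv_atTop_zero (𝕜 := ℝ))
    rw [Complex.ofReal_zero] at this
    exact this.congr fun y => by simp
  -- `(η y - a) / y → i`
  have h1 : Tendsto (fun y : ℝ => (η y - a) * (y : ℂ)⁻¹) atTop (𝓝 Complex.I) := by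
    have := ((hη.sub_const (a : ℂ)).mul hy).add_const Complex.I
    rw [mul_zero, zero_add] at this
    refine this.congr' ?_
    filter_upwards [eventually_gt_atTop 0] with y hy0
    have : (y : ℂ) ≠ 0 := Complex.ofReal_ne_zero.2 hy0.ne'
    field_simp; ring
  have h2 : Tendsto (fun y : ℝ => y * (η y - a)⁻¹) atTop (𝓝 (-Complex.I)) := by
    have := h1.inv₀ Complex.I_ne_zero
    rw [Complex.inv_I] at this
    exact this.congr fun y => by rw [mul_inv, inv_inv, mul_comm]
  have h3 : Tendsto (fun y : ℝ => (η y - a)⁻¹) atTop (𝓝 0) := by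
    have := hy.mul h2
    rw [zero_mul] at this
    refine this.congr' ?_
    filter_upwards [eventually_gt_atTop 0] with y hy0
    have : (y : ℂ) ≠ 0 := Complex.ofReal_ne_zero.2 hy0.ne'
    rw [← mul_assoc, inv_mul_cancel₀ this, one_mul]
  have h4 : HasDerivAt (fun s : ℂ => Complex.log (1 - (b - a) * s)) (-(b - a : ℂ)) 0 := by
    have h := (((hasDerivAt_id (0 : ℂ)).const_mul ((b : ℂ) - a)).const_sub 1).clog
      (by simp [Complex.one_mem_slitPlane])
    refine h.congr_deriv ?_
    simp
  have h5 : Tendsto (fun y : ℝ => (y : ℂ) * Complex.log (1 - (b - a) * (η y - a)⁻¹)) atTop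
      (𝓝 (-(b - a : ℂ) * -Complex.I)) := by
    set l : ℂ → ℂ := fun s => Complex.log (1 - (b - a) * s) with hl
    have hd : Tendsto (dslope l 0) (𝓝 0) (𝓝 (-(b - a : ℂ))) := by
      have := (continuousAt_dslope_same.2 h4.differentiableAt).tendsto
      rwa [dslope_same, h4.deriv] at this
    refine ((hd.comp h3).mul h2).congr fun y => ?_
    have h := sub_smul_dslope l 0 (η y - a)⁻¹
    have hl0 : l 0 = 0 := by simp [hl]
    rw [sub_zero, hl0, sub_zero, smul_eq_mul] at h
    change dslope l 0 _ * _ = y * l (η y - a)⁻¹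
    rw [← h]; ring
  have h6 := ((Complex.continuous_im.tendsto _).comp h5).div_const Real.pi
  have h7 : (-(b - a : ℂ) * -Complex.I).im = b - a := by simp
  rw [h7] at h6
  refine h6.congr' ?_
  have hev : ∀ᶠ y : ℝ in atTop, y * (η y - a)⁻¹ ≠ 0 :=
    h2.eventually_ne (neg_ne_zero.2 Complex.I_ne_zero)
  filter_upwards [hev] with y hy'
  have hne : η y - a ≠ 0 := fun h => hy' (by rw [h, inv_zero, mul_zero])
  simp only [Function.comp_apply, intervalMeasure]
  rw [sub_div_sub_eq hne, Complex.im_ofReal_mul, Complex.log_im, mul_div_assoc]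

theorem tendsto_intervalMeasure_enlarge (hab : a ≤ b) {w : ℂ} (hw : w ∈ upperHalf) :
    Tendsto (fun η : ℝ => intervalMeasure (a - η) (b + η) w) (𝓝[>] 0)
      (𝓝 (intervalMeasure a b w)) := by
  have hc : ContinuousAt (fun η : ℝ => (w - (b + η : ℝ)) / (w - (a - η : ℝ))) 0 :=
    ContinuousAt.div (by fun_prop) (by fun_prop) (sub_ofReal_ne_zero hw _)
  have h0 : (w - ((b + 0 : ℝ) : ℂ)) / (w - ((a - 0 : ℝ) : ℂ)) = (w - b) / (w - a) := by simp
  have h1 : ContinuousAt Complex.arg ((w - ((b + 0 : ℝ) : ℂ)) / (w - ((a - 0 : ℝ) : ℂ))) := by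
    rw [h0]; exact Complex.continuousAt_arg (sub_div_sub_mem_slitPlane hab hw)
  have h2 := ((ContinuousAt.comp (f := fun η : ℝ => (w - (b + η : ℝ)) / (w - (a - η : ℝ)))
    h1 hc).tendsto.div_const Real.pi).mono_left (nhdsWithin_le_nhds (s := Ioi 0))
  simp only [Function.comp_apply] at h2
  rw [h0] at h2
  exact h2

end Interval


/-! ### Perron harmonic measure of an interval of prime ends. -/

namespace LoewnerCurve

variable (L : LoewnerCurve) {t a b : ℝ}

theorem tendsto_g_cobounded (ht : 0 ≤ t) :
    Tendsto (L.g t) (Bornology.cobounded ℂ ⊓ 𝓟 (L.H t)) (Bornology.cobounded ℂ) := by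
  have h1 : Tendsto (fun z : ℂ => ‖z‖ - 1) (Bornology.cobounded ℂ ⊓ 𝓟 (L.H t)) atTop :=
    (tendsto_atTop_add_const_right _ (-1) tendsto_norm_cobounded_atTop).mono_left inf_le_left
  rw [← tendsto_norm_atTop_iff_cobounded]
  refine tendsto_atTop_mono' _ ?_ h1
  have h2 := (L.tendsto_g_sub ht).norm.eventually (Iic_mem_nhds (by simp : ‖(0 : ℂ)‖ < 1))
  filter_upwards [h2] with z hz
  have h3 := norm_sub_le (L.g t z) (L.g t z - z)
  rw [sub_sub_cancel] at h3
  have hz' : ‖L.g t z - z‖ ≤ 1 := hz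
  linarith

theorem tendsto_g_primeEnd (ht : 0 ≤ t) (x : ℝ) :
    Tendsto (L.g t) (L.primeEnd t x) (𝓝[upperHalf] (x : ℂ)) :=
  tendsto_inf.2 ⟨tendsto_comap.mono_left inf_le_left,
    tendsto_principal.2 (mem_inf_of_right (mem_principal.2 fun _ hz => L.mapsTo_g ht hz))⟩

/-- The pull-back of the harmonic measure of an interval has the mean value property. -/
theorem intervalMeasure_comp_g_harmonic (ht : 0 ≤ t) (hab : a ≤ b) :
    ContinuousOn (fun z => intervalMeasure a b (L.g t z)) (L.H t) ∧
      ∀ z r, 0 < r → closedBall z r ⊆ L.H t →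
        Real.circleAverage (fun z => intervalMeasure a b (L.g t z)) z r =
          intervalMeasure a b (L.g t z) := by
  have hd : DifferentiableOn ℂ
      (fun z => Complex.log ((L.g t z - b) / (L.g t z - a)) / Real.pi) (L.H t) :=
    ((differentiableOn_log_sub_div_sub hab).comp (L.differentiableOn_g t ht)
      (L.mapsTo_g ht)).div_const _
  have heq : (fun z => intervalMeasure a b (L.g t z)) =
      fun z => (Complex.log ((L.g t z - b) / (L.g t z - a)) / Real.pi).im := by
    ext z
    rw [Complex.div_ofReal_im, Complex.log_im, intervalMeasure]
  rw [heq]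
  refine ⟨Complex.continuous_im.comp_continuousOn hd.continuousOn, fun z r hr hsub => ?_⟩
  rw [hd.circleAverage_im hr hsub]
  exact (congrFun heq z).symm

theorem intervalMeasure_mem_perronFamily (ht : 0 ≤ t) (hab : a ≤ b) :
    (fun z => intervalMeasure a b (L.g t z)) ∈ L.perronFamily t (Icc a b) := by
  obtain ⟨hc, hm⟩ := L.intervalMeasure_comp_g_harmonic ht hab
  refine ⟨⟨hc, fun z r hr hsub => (hm z r hr hsub).ge⟩, fun x c hx => ?_, fun c hc => ?_⟩
  · by_cases hxI : x ∈ Icc a b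
    · rw [indicator_of_mem hxI] at hx
      exact .of_forall fun z => (intervalMeasure_le_one a b _).trans_lt hx
    · rw [indicator_of_notMem hxI] at hx
      exact ((tendsto_intervalMeasure_of_notMem hab hxI).comp
        ((L.tendsto_g_primeEnd ht x).mono_right nhdsWithin_le_nhds)).eventually (gt_mem_nhds hx)
  · exact ((tendsto_intervalMeasure_cobounded a b).comp (L.tendsto_g_cobounded ht)).eventually
      (gt_mem_nhds hc)

/-- Enlarging the interval by `η` makes the comparison function tend to `1` on all of `[a, b]`,
endpoints included. The difference then has non-positive upper limit at every prime end and at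
infinity, and the maximum principle applies. -/
theorem le_intervalMeasure_of_mem_perronFamily (ht : 0 ≤ t) (hab : a ≤ b) {η : ℝ} (hη : 0 < η)
    {u : ℂ → ℝ} (hu : u ∈ L.perronFamily t (Icc a b)) {z : ℂ} (hz : z ∈ L.H t) :
    u z ≤ intervalMeasure (a - η) (b + η) (L.g t z) := by
  have hab' : a - η ≤ b + η := by linarith
  obtain ⟨hc, hm⟩ := L.intervalMeasure_comp_g_harmonic ht hab'
  obtain ⟨⟨huc, hus⟩, hux, hui⟩ := hu
  set v : ℂ → ℝ := fun z => u z - intervalMeasure (a - η) (b + η) (L.g t z) with hv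
  have hvc : ContinuousOn v (L.H t) := huc.sub hc
  have hsub : IsSubharmonicOn v (L.H t) := by
    refine ⟨hvc, fun z r hr hb => ?_⟩
    have hs : sphere z r ⊆ L.H t := sphere_subset_closedBall.trans hb
    rw [hv, Real.circleAverage_fun_sub ((huc.mono hs).circleIntegrable hr.le)
      ((hc.mono hs).circleIntegrable hr.le), hm z r hr hb]
    linarith [hus z r hr hb]
  have hnonneg : ∀ z ∈ L.H t, 0 ≤ intervalMeasure (a - η) (b + η) (L.g t z) := fun z hz =>
    intervalMeasure_nonneg hab' (L.mapsTo_g ht hz)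
  have hbdy : ∀ x δ : ℝ, 0 < δ → ∀ᶠ z in L.primeEnd t x, v z < δ := fun x δ hδ => by
    by_cases hx : x ∈ Icc a b
    · have h1 := hux x (1 + δ / 2) (by rw [indicator_of_mem hx]; linarith)
      have h2 := ((tendsto_intervalMeasure_of_mem (a := a - η) (b := b + η) (x := x)
        ⟨by linarith [hx.1], by linarith [hx.2]⟩).comp (L.tendsto_g_primeEnd ht x)).eventually
        (lt_mem_nhds (show 1 - δ / 2 < 1 by linarith))
      filter_upwards [h1, h2] with z hz1 hz2
      simp only [Function.comp_apply] at hz2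
      simp only [hv]; linarith
    · have h1 := hux x δ (by rw [indicator_of_notMem hx]; exact hδ)
      have hH : ∀ᶠ z in L.primeEnd t x, z ∈ L.H t := mem_inf_of_right (mem_principal_self _)
      filter_upwards [h1, hH] with z hz1 hz2
      linarith [hnonneg z hz2]
  have hfc : ContinuousOn (L.f t) upperHalf := fun w hw =>
    (differentiableAt_and_deriv_ne_zero_of_inverse (L.isOpen_H t) isOpen_upperHalf
      (L.differentiableOn_g t ht) (L.mapsTo_f ht) (fun z hz => L.f_g ht hz)
      (fun w hw => L.g_f ht hw) hw).1.continuousAt.continuousWithinAt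
  have hK : ∀ δ : ℝ, 0 < δ → IsCompact {z | z ∈ L.H t ∧ δ ≤ v z} := fun δ hδ => by
    set K := {z | z ∈ L.H t ∧ δ ≤ v z} with hKdef
    have hKb : ∃ r : ℝ, ∀ z ∈ K, ‖z‖ ≤ r := by
      have h1 := hui δ hδ
      rw [eventually_inf_principal, ← comap_norm_atTop, eventually_comap] at h1
      obtain ⟨M, hM⟩ := eventually_atTop.1 h1
      refine ⟨M, fun z hz => ?_⟩
      by_contra hcon
      have h2 := hM _ (not_le.1 hcon).le z rfl hz.1
      linarith [hnonneg z hz.1, hz.2]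
    obtain ⟨r, hr⟩ := hKb
    obtain ⟨r', hr'⟩ := L.exists_bound_g ht r
    have himg : L.g t '' K = {w | w ∈ upperHalf ∧ δ ≤ v (L.f t w)} := by
      ext w
      constructor
      · rintro ⟨z, hz, rfl⟩
        exact ⟨L.mapsTo_g ht hz.1, by rw [L.f_g ht hz.1]; exact hz.2⟩
      · rintro ⟨hw, hwδ⟩
        exact ⟨L.f t w, ⟨L.mapsTo_f ht hw, hwδ⟩, L.g_f ht hw⟩
    -- A limit point on the real axis is excluded by the boundary bound at that prime end; a limit
    -- point inside is kept by continuity.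
    have hcl : IsClosed (L.g t '' K) := by
      refine isClosed_of_closure_subset fun w hw => ?_
      have him : 0 ≤ w.im := by
        have : L.g t '' K ⊆ {w : ℂ | 0 ≤ w.im} := by
          rintro _ ⟨z, hz, rfl⟩
          exact (show 0 < (L.g t z).im from L.mapsTo_g ht hz.1).le
        exact closure_minimal this (isClosed_le continuous_const Complex.continuous_im) hw
      rcases him.eq_or_lt with h0 | hpos
      · exfalso
        have hwx : w = (w.re : ℂ) := Complex.ext (by simp) (by simp [← h0])
        have h1 := hbdy w.re δ hδ
        rw [primeEnd, eventually_inf_principal, eventually_comap, ← hwx] at h1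
        obtain ⟨_, ⟨z, hz, rfl⟩, hw1⟩ :=
          ((mem_closure_iff_frequently.1 hw).and_eventually h1).exists
        exact (hw1 z rfl hz.1).not_ge hz.2
      · rw [himg]
        refine ⟨hpos, ?_⟩
        have hcon : ContinuousAt (fun w => v (L.f t w)) w :=
          ((hvc.comp hfc (L.mapsTo_f ht)).continuousAt (isOpen_upperHalf.mem_nhds hpos))
        refine ge_of_tendsto_of_frequently hcon.tendsto ?_
        refine (mem_closure_iff_frequently.1 hw).mono fun x hx => ?_
        rw [himg] at hx
        exact hx.2
    have hcomp : IsCompact (L.g t '' K) := by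
      refine (isCompact_closedBall 0 r').of_isClosed_subset hcl ?_
      rintro _ ⟨z, hz, rfl⟩
      exact mem_closedBall_zero_iff.2 (hr' z hz.1 (hr z hz))
    have hKeq : L.f t '' (L.g t '' K) = K := by
      rw [image_image]
      exact (image_congr fun z hz => L.f_g ht hz.1).trans (image_id' K)
    rw [← hKeq]
    refine hcomp.image_of_continuousOn (hfc.mono ?_)
    rintro _ ⟨z, hz, rfl⟩
    exact L.mapsTo_g ht hz.1
  have := le_zero_of_subharmonic (L.isOpen_H t) hsub hK hz
  simp only [hv] at this
  linarith

theorem hmFrom_Icc (ht : 0 ≤ t) (hab : a ≤ b) {z : ℂ} (hz : z ∈ L.H t) :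
    L.hmFrom t z (Icc a b) = intervalMeasure a b (L.g t z) := by
  have hmem := L.intervalMeasure_mem_perronFamily ht hab
  have hub : ∀ s ∈ {s | ∃ u ∈ L.perronFamily t (Icc a b), s = u z},
      s ≤ intervalMeasure a b (L.g t z) := by
    rintro _ ⟨u, hu, rfl⟩
    refine ge_of_tendsto (tendsto_intervalMeasure_enlarge hab (L.mapsTo_g ht hz)) ?_
    filter_upwards [self_mem_nhdsWithin] with η hη
    exact L.le_intervalMeasure_of_mem_perronFamily ht hab hη hu hz
  exact IsGreatest.csSup_eq ⟨⟨_, hmem, rfl⟩, hub⟩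

/-- Since `g_t(iy) - iy → 0`, the normalized measure agrees with its half-plane value. -/
theorem hm_Icc (ht : 0 ≤ t) (hab : a ≤ b) : L.hm t (Icc a b) = (b - a) / Real.pi := by
  refine Tendsto.limUnder_eq ?_
  obtain ⟨M, hM⟩ := L.exists_norm_bound_mem_H t
  have hinf : Tendsto (fun y : ℝ => (y : ℂ) * Complex.I) atTop (Bornology.cobounded ℂ) := by
    rw [← tendsto_norm_atTop_iff_cobounded]
    simpa using! tendsto_abs_atTop_atTop
  have hH : ∀ᶠ y : ℝ in atTop, (y : ℂ) * Complex.I ∈ L.H t := by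
    filter_upwards [(tendsto_norm_atTop_iff_cobounded.2 hinf).eventually_gt_atTop M,
      eventually_gt_atTop 0] with y hy hy0
    exact hM _ (ofReal_mul_I_mem_upperHalf hy0) hy
  have h1 := (L.tendsto_g_sub ht).comp (tendsto_inf.2 ⟨hinf, tendsto_principal.2 hH⟩)
  refine (tendsto_mul_intervalMeasure a b (η := fun y => L.g t (y * Complex.I)) h1).congr' ?_
  filter_upwards [hH] with y hy
  rw [L.hmFrom_Icc ht hab hy]

theorem mu_eq (ht : 0 ≤ t) {ε : ℝ} (hε : ε ∈ Ioc (0 : ℝ) 1) :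
    L.mu t ε = (L.xPlus t ε - L.xMinus t ε) / Real.pi := by
  obtain ⟨h1, h2, -, -⟩ := L.xMinus_xPlus_spec ht hε
  exact L.hm_Icc ht (h1.trans h2)

end LoewnerCurve

end

/-! ### Exponent arithmetic: from the crosscut estimates to the equivalence. -/

noncomputable section

theorem eventually_const_mul_rpow_le (C : ℝ) {p q : ℝ} (h : q < p) :
    ∀ᶠ y in 𝓝[>] (0 : ℝ), C * y ^ p ≤ y ^ q := by
  have h1 : Tendsto (fun y : ℝ => C * y ^ (p - q)) (𝓝[>] 0) (𝓝 0) := by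
    have h2 : Tendsto (fun y : ℝ => y ^ (p - q)) (𝓝[>] 0) (𝓝 0) := by
      have := (Real.continuousAt_rpow_const 0 (p - q) (Or.inr (sub_pos.2 h).le)).tendsto
      rw [Real.zero_rpow (sub_pos.2 h).ne'] at this
      exact this.mono_left nhdsWithin_le_nhds
    simpa using h2.const_mul C
  filter_upwards [h1.eventually (gt_mem_nhds one_pos), self_mem_nhdsWithin] with y hy hy0
  have hy0 : 0 < y := hy0
  calc C * y ^ p = C * y ^ (p - q) * y ^ q := by
        rw [mul_assoc, ← Real.rpow_add hy0, sub_add_cancel]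
    _ ≤ 1 * y ^ q := by gcongr
    _ = y ^ q := one_mul _

theorem tendsto_rpow_nhdsGT_zero {p : ℝ} (hp : 0 < p) :
    Tendsto (fun y : ℝ => y ^ p) (𝓝[>] 0) (𝓝[>] 0) := by
  refine tendsto_nhdsWithin_iff.2 ⟨?_, ?_⟩
  · have := (Real.continuousAt_rpow_const 0 p (Or.inr hp.le)).tendsto
    rw [Real.zero_rpow hp.ne'] at this
    exact this.mono_left nhdsWithin_le_nhds
  · filter_upwards [self_mem_nhdsWithin] with y hy using Real.rpow_pos_of_pos hy p

theorem eventually_mem_Ioc_zero {b : ℝ} (hb : 0 < b) : ∀ᶠ y in 𝓝[>] (0 : ℝ), y ∈ Ioc 0 b :=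
  Ioc_mem_nhdsGT hb

/-- The size `R ε` of the crosscut at distance `ε` from the tip, the distance `D y` of the tip
from the point of the hyperbolic ray at height `y`, and the conformal radius `d y` there. -/
structure CrosscutEstimates (d D R : ℝ → ℝ) (C c κ : ℝ) : Prop where
  C_pos : 0 < C
  c_pos : 0 < c
  κ_nonneg : 0 ≤ κ
  d_pos : ∀ y, 0 < y → 0 < d y
  R_pos : ∀ ε ∈ Ioc (0 : ℝ) 1, 0 < R ε
  bddAbove : ∃ M, ∀ ε ∈ Ioc (0 : ℝ) 1, R ε ≤ M
  d_R_le : ∀ ε ∈ Ioc (0 : ℝ) 1, d (R ε) ≤ C * ε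
  le_R : ∀ ε ∈ Ioc (0 : ℝ) 1, ∀ y, 0 < y → (∀ s ∈ Ioc 0 y, D s ≤ c * ε) → y / 2 ≤ R ε
  mul_pow_le : ∀ ε ∈ Ioc (0 : ℝ) 1, ∀ y, 0 < y → R ε ≤ y / 2 → 2 * ε ≤ D y →
    ε * R ε ^ 4 ≤ C * d y * y ^ 4
  distortion : ∀ y ρ r : ℝ, 0 < y → 0 < ρ → ρ ≤ r * y → y ≤ r * ρ → d ρ ≤ C * r ^ κ * d y
  D_le : ∀ b y : ℝ, 0 < b → 0 < y → (∀ s ∈ Ioc 0 y, d s ≤ s ^ b) → D y ≤ b⁻¹ * y ^ b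

/-- `F y = y ^ (β + o(1))` as `y → 0+`. -/
def RpowEquiv (F : ℝ → ℝ) (β : ℝ) : Prop :=
  ∀ u : ℝ, 0 < u → ∀ᶠ y in 𝓝[>] (0 : ℝ), y ^ (β + u) ≤ F y ∧ F y ≤ y ^ (β - u)

namespace CrosscutEstimates

variable {d D R : ℝ → ℝ} {C c κ α : ℝ}

/-- If `R ε ≥ δ`, then `R ε` and `1` are comparable heights, so distortion and `d_R_le` bound the
fixed number `d 1` by a multiple of `ε`. -/
theorem tendsto_R (h : CrosscutEstimates d D R C c κ) : Tendsto R (𝓝[>] 0) (𝓝[>] 0) := by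
  have hpos : ∀ᶠ ε in 𝓝[>] (0 : ℝ), R ε ∈ Ioi 0 :=
    (eventually_mem_Ioc_zero one_pos).mono fun ε hε => h.R_pos ε hε
  refine tendsto_nhdsWithin_iff.2 ⟨?_, hpos⟩
  obtain ⟨M, hM⟩ := h.bddAbove
  have hC := h.C_pos
  refine tendsto_order.2 ⟨fun a ha => hpos.mono fun ε hε => ha.trans hε, fun δ hδ => ?_⟩
  set r := max (max M δ⁻¹) 1 with hr
  have hr1 : 1 ≤ r := le_max_right _ _
  have hrM : M ≤ r := (le_max_left _ _).trans (le_max_left _ _)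
  have hrδ : δ⁻¹ ≤ r := (le_max_right _ _).trans (le_max_left _ _)
  have hd1 := h.d_pos 1 one_pos
  set q := d 1 / (C * r ^ κ * C) with hq
  have hq0 : 0 < q := by positivity
  have hq2 : 0 < min (q / 2) 1 := by positivity
  filter_upwards [eventually_mem_Ioc_zero hq2] with ε hε
  by_contra hcon
  rw [not_lt] at hcon
  have hεI : ε ∈ Ioc (0 : ℝ) 1 := ⟨hε.1, hε.2.trans (min_le_right _ _)⟩
  have h1 := h.distortion (R ε) 1 r (h.R_pos ε hεI) one_pos (by
    rw [inv_le_iff_one_le_mul₀ hδ] at hrδ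
    calc (1 : ℝ) ≤ r * δ := hrδ
      _ ≤ r * R ε := by gcongr) (by rw [mul_one]; exact (hM ε hεI).trans hrM)
  have h2 : d 1 ≤ C * r ^ κ * (C * ε) := h1.trans (by gcongr; exact h.d_R_le ε hεI)
  have h3 : q ≤ ε := by
    rw [hq, div_le_iff₀ (by positivity)]; linarith
  linarith [hε.2.trans (min_le_left _ _)]

/-- Solve `(R ε)^(α⁻¹ + η) ≤ d (R ε) ≤ C ε` for `R ε`; the lower bound on `d` applies because `R ε →
0`. -/
theorem R_le_of_d (h : CrosscutEstimates d D R C c κ) (hα : 0 < α) (hd : RpowEquiv d α⁻¹) {v : ℝ}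
    (hv : 0 < v) : ∀ᶠ ε in 𝓝[>] (0 : ℝ), R ε ≤ ε ^ (α - v) := by
  obtain ⟨η, hη, hη0⟩ : ∃ η : ℝ, α - v < 1 / (α⁻¹ + η) ∧ 0 < η := by
    have hc : ContinuousAt (fun η : ℝ => 1 / (α⁻¹ + η)) 0 :=
      ContinuousAt.div (by fun_prop) (by fun_prop) (by simp [hα.ne'])
    have h1 := (hc.tendsto.mono_left (nhdsWithin_le_nhds (s := Ioi 0))).eventually
      (lt_mem_nhds (a := α - v) (by simp [hv]))
    exact (h1.and self_mem_nhdsWithin).exists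
  have hb : 0 < α⁻¹ + η := by positivity
  have hC := h.C_pos
  filter_upwards [eventually_mem_Ioc_zero one_pos, h.tendsto_R.eventually (hd η hη0),
    eventually_const_mul_rpow_le (C ^ (1 / (α⁻¹ + η))) hη] with ε hε h1 h2
  have hR := h.R_pos ε hε
  have h3 : R ε ^ (α⁻¹ + η) ≤ C * ε := h1.1.trans (h.d_R_le ε hε)
  calc R ε = (R ε ^ (α⁻¹ + η)) ^ (1 / (α⁻¹ + η)) := by
        rw [← Real.rpow_mul hR.le, mul_one_div_cancel hb.ne', Real.rpow_one]
    _ ≤ (C * ε) ^ (1 / (α⁻¹ + η)) := by gcongr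
    _ = C ^ (1 / (α⁻¹ + η)) * ε ^ (1 / (α⁻¹ + η)) := Real.mul_rpow hC.le hε.1.le
    _ ≤ _ := h2

theorem D_le_of_d_le (h : CrosscutEstimates d D R C c κ) {b : ℝ} (hb : 0 < b)
    (hd : ∀ᶠ y in 𝓝[>] (0 : ℝ), d y ≤ y ^ b) :
    ∃ δ > 0, ∀ y ∈ Ioc 0 δ, D y ≤ b⁻¹ * y ^ b := by
  obtain ⟨δ, hδ, hsub⟩ := mem_nhdsGT_iff_exists_Ioc_subset.1 hd
  exact ⟨δ, hδ, fun y hy => h.D_le b y hb hy.1 fun s hs => hsub ⟨hs.1, hs.2.trans hy.2⟩⟩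

/-- With `b = α⁻¹ - η` one has `D ≤ b⁻¹ y^b`, so at `y = ε^(1/b + η)` the ray up to height `y` is
within `c ε` of the tip and `le_R` applies. -/
theorem le_R_of_d (h : CrosscutEstimates d D R C c κ) (hα : 0 < α) (hd : RpowEquiv d α⁻¹) {v : ℝ}
    (hv : 0 < v) : ∀ᶠ ε in 𝓝[>] (0 : ℝ), ε ^ (α + v) ≤ R ε := by
  obtain ⟨η, ⟨hη, hηα⟩, hη0⟩ : ∃ η : ℝ, (1 / (α⁻¹ - η) + η < α + v ∧ η < α⁻¹) ∧ 0 < η := by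
    have hc : ContinuousAt (fun η : ℝ => 1 / (α⁻¹ - η) + η) 0 :=
      (ContinuousAt.div (by fun_prop) (by fun_prop) (by simp [hα.ne'])).add (by fun_prop)
    have h1 := (hc.tendsto.mono_left (nhdsWithin_le_nhds (s := Ioi 0))).eventually
      (gt_mem_nhds (show 1 / (α⁻¹ - 0) + 0 < α + v by simp [hv]))
    have h2 : ∀ᶠ η in 𝓝[>] (0 : ℝ), η < α⁻¹ :=
      nhdsWithin_le_nhds (gt_mem_nhds (inv_pos.2 hα))
    exact ((h1.and h2).and self_mem_nhdsWithin).exists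
  set b := α⁻¹ - η with hb
  have hb0 : 0 < b := sub_pos.2 hηα
  have hp : 0 < 1 / b + η := by positivity
  have hc := h.c_pos
  obtain ⟨δ, hδ, hD⟩ := h.D_le_of_d_le hb0 ((hd η hη0).mono fun y hy => hy.2)
  have hpb : (1 / b + η) * b = 1 + η * b := by field_simp
  filter_upwards [eventually_mem_Ioc_zero one_pos,
    (tendsto_rpow_nhdsGT_zero hp).eventually (eventually_mem_Ioc_zero hδ),
    eventually_const_mul_rpow_le 2 hη,
    eventually_const_mul_rpow_le (b⁻¹ * c⁻¹) (p := 1 + η * b) (q := 1)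
      (by linarith [mul_pos hη0 hb0])] with ε hε h1 h2 h3
  have h4 := h.le_R ε hε (ε ^ (1 / b + η)) h1.1 fun s hs => by
    calc D s ≤ b⁻¹ * s ^ b := hD s ⟨hs.1, hs.2.trans h1.2⟩
      _ ≤ b⁻¹ * (ε ^ (1 / b + η)) ^ b := by
        have := Real.rpow_le_rpow hs.1.le hs.2 hb0.le
        gcongr
      _ = c * (b⁻¹ * c⁻¹ * ε ^ (1 + η * b)) := by
        rw [← Real.rpow_mul hε.1.le, hpb]; field_simp
      _ ≤ c * ε := by
        rw [Real.rpow_one] at h3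
        gcongr
  linarith

/-- At `ε = y^(1/α)` the height `R ε` lies between `y^(1+u)` and `y^(1-u)`, and `d (R ε) ≤ C ε`.
Distortion back to height `y` costs `y^(-uκ)`, and `u` is chosen with `uκ < v`. -/
theorem d_le_of_R (h : CrosscutEstimates d D R C c κ) (hα : 0 < α) (hR : RpowEquiv R α) {v : ℝ}
    (hv : 0 < v) : ∀ᶠ y in 𝓝[>] (0 : ℝ), d y ≤ y ^ (α⁻¹ - v) := by
  have hκ := h.κ_nonneg
  have hC := h.C_pos
  set u := v / (2 * (κ + 1)) with hu
  have hu0 : 0 < u := by positivity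
  have huκ : u * κ < v := by
    rw [hu, div_mul_eq_mul_div, div_lt_iff₀ (by positivity)]
    nlinarith
  filter_upwards [eventually_mem_Ioc_zero one_pos, (tendsto_rpow_nhdsGT_zero
    (inv_pos.2 hα)).eventually ((hR (u * α) (by positivity)).and (eventually_mem_Ioc_zero one_pos)),
    eventually_const_mul_rpow_le (C * C) (p := α⁻¹ - u * κ) (q := α⁻¹ - v) (by linarith)]
    with y hy hRy hle
  obtain ⟨⟨h1, h2⟩, hεI⟩ := hRy
  have hy0 := hy.1
  rw [← Real.rpow_mul hy0.le] at h1 h2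
  rw [show α⁻¹ * (α + u * α) = 1 + u by field_simp] at h1
  rw [show α⁻¹ * (α - u * α) = 1 - u by field_simp] at h2
  have h3 := h.distortion (R (y ^ α⁻¹)) y (y ^ (-u)) (h.R_pos _ hεI) hy0 (by
      calc y = y ^ (-u) * y ^ (1 + u) := by
            rw [← Real.rpow_add hy0]; ring_nf; rw [Real.rpow_one]
        _ ≤ _ := by gcongr) (by
      calc R (y ^ α⁻¹) ≤ y ^ (1 - u) := h2
        _ = y ^ (-u) * y := by
          rw [← Real.rpow_add_one hy0.ne']; ring_nf)
  calc d y ≤ C * (y ^ (-u)) ^ κ * d (R (y ^ α⁻¹)) := h3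
    _ ≤ C * (y ^ (-u)) ^ κ * (C * y ^ α⁻¹) := by gcongr; exact h.d_R_le _ hεI
    _ = C * C * y ^ (α⁻¹ - u * κ) := by
      rw [← Real.rpow_mul hy0.le, show α⁻¹ - u * κ = -u * κ + α⁻¹ by ring, Real.rpow_add hy0]
      ring
    _ ≤ _ := hle

/-- Some point of the ray below height `y` is at distance at least `2 * y ^ (α⁻¹ + η)` from the
tip. -/
theorem exists_lt_D (h : CrosscutEstimates d D R C c κ) (hα : 0 < α) (hR : RpowEquiv R α) {η : ℝ}
    (hη : 0 < η) : ∀ᶠ y in 𝓝[>] (0 : ℝ), ∃ s ∈ Ioc 0 y, 2 * y ^ (α⁻¹ + η) < D s := by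
  have hc := h.c_pos
  set p := α⁻¹ + η / 2 with hp
  have hp0 : 0 < p := by positivity
  -- Makes `p (α - v) = 1 + ηα/4` exceed `1`: for `ε = y^p` the crosscut is smaller than `y / 2`,
  -- against `le_R`.
  set v := η * α / (4 * p) with hv
  have hv0 : 0 < v := by positivity
  have hpv : p * (α - v) = 1 + η * α / 4 := by
    rw [hv, hp]; field_simp; ring
  filter_upwards [eventually_mem_Ioc_zero one_pos, (tendsto_rpow_nhdsGT_zero hp0).eventually
    ((hR v hv0).and (eventually_mem_Ioc_zero one_pos)),
    eventually_const_mul_rpow_le 4 (p := 1 + η * α / 4) (q := 1)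
      (by linarith [mul_pos hη hα]),
    eventually_const_mul_rpow_le (2 / c) (p := α⁻¹ + η) (q := p) (by rw [hp]; linarith)]
    with y hy hRy h1 h2
  obtain ⟨⟨-, h3⟩, hεI⟩ := hRy
  by_contra! hcon
  have h4 := h.le_R _ hεI y hy.1 fun s hs => (hcon s hs).trans (by
    calc 2 * y ^ (α⁻¹ + η) = c * (2 / c * y ^ (α⁻¹ + η)) := by field_simp
      _ ≤ c * y ^ p := by gcongr)
  rw [← Real.rpow_mul hy.1.le, hpv] at h3
  rw [Real.rpow_one] at h1
  linarith [hy.1]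

theorem le_d_of_R (h : CrosscutEstimates d D R C c κ) (hα : 0 < α) (hR : RpowEquiv R α) {v : ℝ}
    (hv : 0 < v) : ∀ᶠ y in 𝓝[>] (0 : ℝ), y ^ (α⁻¹ + v) ≤ d y := by
  have hκ := h.κ_nonneg
  have hC := h.C_pos
  -- The height `s` with large `D s` satisfies `s ≥ y^τ`. Take `ε = y^σ`: then `σ (α - η) > τ` gives
  -- `R ε ≤ s / 2`, and `σ > α⁻¹ + η` gives `2ε ≤ D s`. The resulting bound is `y^E`: from `ε
  -- R(ε)^4`, less `y^4` for `s^4`, plus the distortion cost `(τ - 1)κ`. At `η = 0` it is `α⁻¹(1 +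
  -- 4α) - 4 = α⁻¹`.
  set τ : ℝ → ℝ := fun η => (α⁻¹ + 2 * η) / (α⁻¹ - η) with hτ
  set σ : ℝ → ℝ := fun η => (τ η + η) / (α - η) + η with hσ
  set E : ℝ → ℝ := fun η => σ η * (1 + 4 * (α + η)) - 4 + (τ η - 1) * κ with hE
  obtain ⟨η, ⟨hηE, hηα, hηα'⟩, hη⟩ :
      ∃ η : ℝ, (E η < α⁻¹ + v ∧ η < α ∧ η < α⁻¹) ∧ 0 < η := by
    have hτc : ContinuousAt τ 0 :=
      ContinuousAt.div (by fun_prop) (by fun_prop) (by simp [hα.ne'])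
    have hσc : ContinuousAt σ 0 :=
      (ContinuousAt.div (hτc.add continuousAt_id) (by fun_prop) (by simp [hα.ne'])).add
        continuousAt_id
    have hEc : ContinuousAt E 0 :=
      ((hσc.mul (by fun_prop)).sub continuousAt_const).add
        ((hτc.sub continuousAt_const).mul continuousAt_const)
    have hE0 : E 0 = α⁻¹ := by
      have h0 : α * α⁻¹ = 1 := mul_inv_cancel₀ hα.ne'
      simp only [hE, hσ, hτ, mul_zero, add_zero, sub_zero, div_self (inv_ne_zero hα.ne'), sub_self,
        zero_mul, one_div]
      linear_combination 4 * h0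
    have h1 := (hEc.tendsto.mono_left (nhdsWithin_le_nhds (s := Ioi 0))).eventually
      (gt_mem_nhds (show E 0 < α⁻¹ + v by rw [hE0]; linarith))
    have h2 : ∀ᶠ η in 𝓝[>] (0 : ℝ), η < α := nhdsWithin_le_nhds (gt_mem_nhds hα)
    have h3 : ∀ᶠ η in 𝓝[>] (0 : ℝ), η < α⁻¹ := nhdsWithin_le_nhds (gt_mem_nhds (inv_pos.2 hα))
    exact ((h1.and (h2.and h3)).and self_mem_nhdsWithin).exists
  set b := α⁻¹ - η with hb
  have hb0 : 0 < b := sub_pos.2 hηα'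
  have hα' : 0 < α - η := sub_pos.2 hηα
  have hτ1 : 1 < τ η := by
    simp only [hτ]; rw [one_lt_div hb0]; linarith
  have hσ1 : α⁻¹ + η < σ η := by
    simp only [hσ]
    have : α⁻¹ < (τ η + η) / (α - η) := by
      rw [lt_div_iff₀ hα']
      have : α⁻¹ * (α - η) = 1 - α⁻¹ * η := by field_simp
      rw [this]
      have : 0 < α⁻¹ * η := by positivity
      linarith
    linarith
  have hσ0 : 0 < σ η := by linarith [inv_pos.2 hα]
  have hσα : τ η < σ η * (α - η) := by
    simp only [hσ]
    rw [add_mul, div_mul_cancel₀ _ hα'.ne']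
    nlinarith
  obtain ⟨δ, hδ, hD⟩ := h.D_le_of_d_le hb0 (h.d_le_of_R hα hR hη)
  filter_upwards [eventually_mem_Ioc_zero one_pos, eventually_mem_Ioc_zero hδ,
    h.exists_lt_D hα hR hη,
    (tendsto_rpow_nhdsGT_zero hσ0).eventually ((hR η hη).and (eventually_mem_Ioc_zero one_pos)),
    eventually_const_mul_rpow_le b⁻¹ (p := α⁻¹ + 2 * η) (q := α⁻¹ + η) (by linarith),
    eventually_const_mul_rpow_le 2 hσα,
    eventually_const_mul_rpow_le (C * C) hηE] with y hy hyδ hs hRy h1 h2 h3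
  obtain ⟨s, ⟨hs0, hsy⟩, hsD⟩ := hs
  obtain ⟨⟨hR1, hR2⟩, hεI⟩ := hRy
  have hy0 := hy.1
  have hsτ : y ^ τ η ≤ s := by
    have h4 := hD s ⟨hs0, hsy.trans hyδ.2⟩
    have h5 : y ^ (α⁻¹ + 2 * η) ≤ s ^ b := by
      have h6 : b⁻¹ * y ^ (α⁻¹ + 2 * η) ≤ b⁻¹ * s ^ b := by
        have : 0 ≤ y ^ (α⁻¹ + η) := Real.rpow_nonneg hy0.le _
        linarith
      exact le_of_mul_le_mul_left h6 (inv_pos.2 hb0)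
    calc y ^ τ η = (y ^ (α⁻¹ + 2 * η)) ^ b⁻¹ := by
          rw [← Real.rpow_mul hy0.le]; rfl
      _ ≤ (s ^ b) ^ b⁻¹ := by gcongr
      _ = s := by rw [← Real.rpow_mul hs0.le, mul_inv_cancel₀ hb0.ne', Real.rpow_one]
  have hRs : R (y ^ σ η) ≤ s / 2 := by
    rw [← Real.rpow_mul hy0.le] at hR2
    linarith
  have hDs : 2 * y ^ σ η ≤ D s := by
    have := Real.rpow_le_rpow_of_exponent_ge hy0 hy.2 hσ1.le
    linarith
  have h4 := h.mul_pow_le _ hεI s hs0 hRs hDs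
  have h5 := h.distortion y s (y ^ (-(τ η - 1))) hy0 hs0 (by
      have : 1 ≤ y ^ (-(τ η - 1)) :=
        Real.one_le_rpow_of_pos_of_le_one_of_nonpos hy0 hy.2 (by linarith)
      nlinarith) (by
      calc y = y ^ (-(τ η - 1)) * y ^ τ η := by
            rw [← Real.rpow_add hy0]; ring_nf; rw [Real.rpow_one]
        _ ≤ _ := by gcongr)
  have hdy := h.d_pos y hy0
  have h6 : y ^ σ η * (y ^ (σ η * (α + η))) ^ 4 ≤
      C * (C * (y ^ (-(τ η - 1))) ^ κ * d y) * y ^ 4 := by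
    rw [Real.rpow_mul hy0.le]
    calc y ^ σ η * ((y ^ σ η) ^ (α + η)) ^ 4 ≤ y ^ σ η * R (y ^ σ η) ^ 4 := by
          have := hεI.1
          gcongr
      _ ≤ C * d s * s ^ 4 := h4
      _ ≤ _ := by gcongr
  -- collect the powers of `y`
  have h7 : y ^ E η ≤ C * C * d y := by
    have e1 : y ^ E η = y ^ σ η * (y ^ (σ η * (α + η))) ^ 4 * (y ^ ((τ η - 1) * κ) / y ^ 4) := by
      rw [← Real.rpow_natCast (y ^ (σ η * (α + η))), ← Real.rpow_natCast y,
        ← Real.rpow_mul hy0.le, ← Real.rpow_sub hy0, ← Real.rpow_add hy0, ← Real.rpow_add hy0]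
      congr 1
      simp only [hE]; push_cast; ring
    have e2 : (y ^ (-(τ η - 1))) ^ κ * y ^ ((τ η - 1) * κ) = 1 := by
      rw [← Real.rpow_mul hy0.le, ← Real.rpow_add hy0]
      ring_nf; exact Real.rpow_zero y
    rw [e1]
    calc _ ≤ C * (C * (y ^ (-(τ η - 1))) ^ κ * d y) * y ^ 4 * (y ^ ((τ η - 1) * κ) / y ^ 4) := by
          gcongr
      _ = C * C * d y * ((y ^ (-(τ η - 1))) ^ κ * y ^ ((τ η - 1) * κ)) := by
          field_simp
      _ = _ := by rw [e2, mul_one]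
  exact le_of_mul_le_mul_left (h3.trans h7) (by positivity)

theorem rpowEquiv_iff (h : CrosscutEstimates d D R C c κ) (hα : 0 < α) :
    RpowEquiv R α ↔ RpowEquiv d α⁻¹ :=
  ⟨fun hR _ hu => (h.le_d_of_R hα hR hu).and (h.d_le_of_R hα hR hu),
    fun hd _ hu => (h.le_R_of_d hα hd hu).and (h.R_le_of_d hα hd hu)⟩

end CrosscutEstimates

end

/-! ### Assembly for a Loewner curve. -/

noncomputable section

theorem RpowEquiv.const_mul {F G : ℝ → ℝ} {β k : ℝ} (hk : 0 < k) (h : RpowEquiv F β)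
    (hG : ∀ᶠ y in 𝓝[>] (0 : ℝ), G y = k * F y) : RpowEquiv G β := by
  intro u hu
  filter_upwards [h (u / 2) (by positivity), hG,
    eventually_const_mul_rpow_le k (p := β - u / 2) (q := β - u) (by linarith),
    eventually_const_mul_rpow_le k⁻¹ (p := β + u) (q := β + u / 2) (by linarith)]
    with y h1 h2 h3 h4
  rw [h2]
  constructor
  · rw [inv_mul_le_iff₀ hk] at h4
    exact h4.trans (by gcongr; exact h1.1)
  · exact le_trans (by gcongr; exact h1.2) h3

/-- Integrate `|F'(is)| ≤ s^(b-1)` from `x` to `y` and let `x → 0+`. -/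
theorem TipDomain.norm_sub_tip_le {H : Set ℂ} {F G : ℂ → ℂ} {p : ℂ} (D : TipDomain H F G p)
    {b y : ℝ} (hb : 0 < b) (hy : 0 < y)
    (hd : ∀ s ∈ Ioc 0 y, s * ‖deriv F (s * Complex.I)‖ ≤ s ^ b) :
    ‖F (y * Complex.I) - p‖ ≤ b⁻¹ * y ^ b := by
  have hderiv : ∀ s : ℝ, 0 < s → HasDerivAt (fun s : ℝ => F (s * Complex.I))
      (deriv F (s * Complex.I) * Complex.I) s := fun s hs => by
    have h1 := (D.univalent.differentiableOn.differentiableAt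
      (isOpen_upperHalf.mem_nhds (ofReal_mul_I_mem_upperHalf hs))).hasDerivAt
    have h2 : HasDerivAt (fun s : ℝ => (s : ℂ) * Complex.I) Complex.I s := by
      simpa using (Complex.ofRealCLM.hasDerivAt (x := s)).mul_const Complex.I
    exact h1.comp s h2
  have key : ∀ x ∈ Ioc 0 y, ‖F (y * Complex.I) - F (x * Complex.I)‖ ≤ b⁻¹ * y ^ b := by
    intro x hx
    have hB : ∀ s : ℝ, 0 < s →
        HasDerivAt (fun s : ℝ => b⁻¹ * s ^ b - b⁻¹ * x ^ b) (s ^ (b - 1)) s := fun s hs => by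
      have := ((Real.hasDerivAt_rpow_const (p := b) (Or.inl hs.ne')).const_mul b⁻¹).sub_const
        (b⁻¹ * x ^ b)
      rwa [← mul_assoc, inv_mul_cancel₀ hb.ne', one_mul] at this
    have h := image_norm_le_of_norm_deriv_right_le_deriv_boundary'
      (f := fun s : ℝ => F (s * Complex.I) - F (x * Complex.I))
      (f' := fun s : ℝ => deriv F (s * Complex.I) * Complex.I) (a := x) (b := y)
      (B := fun s : ℝ => b⁻¹ * s ^ b - b⁻¹ * x ^ b) (B' := fun s => s ^ (b - 1))
      (fun s hs => ((hderiv s (hx.1.trans_le hs.1)).sub_const _).continuousAt.continuousWithinAt)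
      (fun s hs => ((hderiv s (hx.1.trans_le hs.1)).sub_const _).hasDerivWithinAt) (by simp)
      (fun s hs => (hB s (hx.1.trans_le hs.1)).continuousAt.continuousWithinAt)
      (fun s hs => (hB s (hx.1.trans_le hs.1)).hasDerivWithinAt) (fun s hs => by
        have hs0 : 0 < s := hx.1.trans_le hs.1
        rw [norm_mul, Complex.norm_I, mul_one, Real.rpow_sub_one hs0.ne', le_div_iff₀' hs0]
        exact hd s ⟨hs0, hs.2.le⟩) ⟨hx.2, le_rfl⟩
    have : 0 ≤ b⁻¹ * x ^ b := mul_nonneg (inv_pos.2 hb).le (Real.rpow_nonneg hx.1.le _)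
    linarith
  refine le_of_tendsto (D.tendsto_tip.const_sub (F (y * Complex.I))).norm ?_
  filter_upwards [Ioc_mem_nhdsGT hy] with x hx using key x hx

namespace LoewnerCurve

variable (L : LoewnerCurve) {t : ℝ}

theorem exists_crosscutEstimates (ht : 0 ≤ t) : ∃ C c κ : ℝ, CrosscutEstimates
    (fun y => y * ‖deriv (L.fHat t) (y * Complex.I)‖)
    (fun y => ‖L.fHat t (y * Complex.I) - L.γ t‖)
    (fun ε => L.xPlus t ε - L.xMinus t ε) C c κ := by
  have D := L.tipDomain ht
  obtain ⟨κ, hκ, hdist⟩ := D.univalent.exists_norm_deriv_le_rpow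
  have hp : L.γ t ∉ L.fHat t '' upperHalf := by
    rintro ⟨w, hw, h⟩
    exact D.tip_notMem (h ▸ D.mapsTo_F hw)
  have hC := one_le_distortionConst
  have hC0 : 0 < distortionConst := by linarith
  have he : 1 ≤ Real.exp 30 := Real.one_le_exp (by norm_num)
  set C := 404 * distortionConst ^ 32 * Real.exp 30 with hCdef
  have hC1 : distortionConst ≤ C := by
    calc distortionConst = 1 * distortionConst ^ 1 * 1 := by ring
      _ ≤ 404 * distortionConst ^ 32 * Real.exp 30 := by gcongr <;> norm_num
  have hC2 : 404 * distortionConst ^ 16 * Real.exp 30 ≤ C := by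
    rw [hCdef]; gcongr; norm_num
  have hC3 : 4 * distortionConst ^ 32 * Real.exp 30 ≤ C := by
    rw [hCdef]; gcongr; norm_num
  have hsep : ∀ ε ∈ Ioc (0 : ℝ) 1, TipDomain.IsSepArc (L.H t) (L.fHat t)
      (fun z => L.g t z - L.V t) (L.γ t) ε (L.tipArc t ε) := fun ε hε => L.isSepArc_tipArc ht hε.1
  have hR : ∀ ε, L.xPlus t ε - L.xMinus t ε =
    (L.xPlus t ε - L.V t) - (L.xMinus t ε - L.V t) := fun ε => by ring
  have hle : ∀ ε ∈ Ioc (0 : ℝ) 1, ∀ y : ℝ, 0 < y →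
      (∀ s ∈ Ioc (0 : ℝ) y, ‖L.fHat t (s * Complex.I) - L.γ t‖ ≤ Real.exp (-30) * ε) →
      y / 2 ≤ L.xPlus t ε - L.xMinus t ε := by
    intro ε hε y hy h
    obtain ⟨h1, h2, -, h4⟩ := L.xMinus_xPlus_spec ht hε
    have hs := hsep ε hε
    obtain ⟨y₀, hy₀, hy₀s⟩ := hs.exists_ray_mem D
    have h5 := D.univalent.half_le_of_crosscut (hs.image_subset D) (hs.image_isPreconnected D)
      hε.1 (hs.norm_eq D) h4 hy₀
      ⟨_, hy₀s, D.G_F _ (ofReal_mul_I_mem_upperHalf hy₀)⟩ hy h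
    rw [abs_of_nonneg (by linarith)] at h5
    linarith
  have hpos : ∀ ε ∈ Ioc (0 : ℝ) 1, 0 < L.xPlus t ε - L.xMinus t ε := by
    intro ε hε
    have hev := (tendsto_iff_norm_sub_tendsto_zero.1 D.tendsto_tip).eventually
      (Iic_mem_nhds (mul_pos (Real.exp_pos (-30)) hε.1))
    obtain ⟨y, hy, hsub⟩ := mem_nhdsGT_iff_exists_Ioc_subset.1 hev
    have hy : 0 < y := hy
    linarith [hle ε hε y hy fun s hs => hsub hs]
  -- The exponent `κ + 1`: besides `|F'|`, the height factor in `d` can grow by `r`.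
  refine ⟨C, Real.exp (-30), κ + 1, ?_, Real.exp_pos _, by positivity, fun y hy => ?_, hpos, ?_,
    fun ε hε => ?_, hle, fun ε hε y hy hRy hDy => ?_, fun y ρ r hy hρ h1 h2 => ?_,
    fun b y hb hy h => D.norm_sub_tip_le hb hy h⟩
  · positivity
  · exact mul_pos hy (norm_pos_iff.2 (D.univalent.deriv_ne_zero _ (ofReal_mul_I_mem_upperHalf hy)))
  · obtain ⟨M, hM⟩ := L.exists_crosscut_bound ht
    refine ⟨M + M, fun ε hε => ?_⟩
    obtain ⟨-, -, h3, h4⟩ := L.xMinus_xPlus_spec ht hε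
    have h5 := hM ε hε _ h3
    have h6 := hM ε hε _ h4
    rw [Complex.norm_real, Real.norm_eq_abs, abs_le] at h5 h6
    linarith [h5.1, h6.2]
  · obtain ⟨h1, h2, h3, h4⟩ := L.xMinus_xPlus_spec ht hε
    have hs := hsep ε hε
    have h5 := D.univalent.mul_norm_deriv_le_of_crosscut hp (hs.image_subset D)
      (hs.image_isPreconnected D) hε.1 (fun w hw => (hs.norm_eq D w hw).le)
      (sub_nonpos.2 h1) (sub_nonneg.2 h2) (by linarith [hpos ε hε]) h3 h4
    rw [← hR] at h5
    exact h5.trans (by have := hε.1; gcongr)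
  · obtain ⟨h1, h2, h3, h4⟩ := L.xMinus_xPlus_spec ht hε
    have hs := hsep ε hε
    have h5 := D.univalent.mul_pow_le_of_crosscut (hs.image_subset D) (hs.image_isPreconnected D)
      hε.1 hy (fun w hw => ?_) (sub_nonpos.2 h1) (sub_nonneg.2 h2) (by linarith [hpos ε hε])
      (by rw [← hR]; exact hRy) h3 h4
    · rw [← hR] at h5
      exact h5.trans (by gcongr)
    -- On the crosscut `|F - p| = ε` while `|F(iy) - p| ≥ 2ε`, so it is mapped outside the disc of
    -- radius `ε` about `F(iy)`.
    · have h6 := norm_sub_le_norm_sub_add_norm_sub (L.fHat t (y * Complex.I)) (L.fHat t w) (L.γ t)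
      rw [hs.norm_eq D w hw, norm_sub_rev (L.fHat t (y * Complex.I)) (L.fHat t w)] at h6
      linarith
  · have hr : 0 < r := by
      by_contra hcon
      nlinarith [not_lt.1 hcon]
    calc ρ * ‖deriv (L.fHat t) (ρ * Complex.I)‖
        ≤ (r * y) * (distortionConst * r ^ κ * ‖deriv (L.fHat t) (y * Complex.I)‖) := by
          gcongr; exact hdist y ρ r hy hρ h1 h2
      _ = distortionConst * r ^ (κ + 1) * (y * ‖deriv (L.fHat t) (y * Complex.I)‖) := by
          rw [Real.rpow_add_one hr.ne']; ring
      _ ≤ _ := by gcongr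

/-- With `β = 1 - 1/α` the exponent `1 - β` is `α⁻¹`, and the factor `π` between `μ` and `x₊ - x₋`
does not affect exponents. -/
theorem mem_thetaHm_iff {α : ℝ} (hα : 0 < α) : t ∈ L.thetaHm α ↔ t ∈ L.theta (1 - 1 / α) := by
  refine and_congr_right fun ht => ?_
  obtain ⟨C, c, κ, h⟩ := L.exists_crosscutEstimates ht.1.le
  rw [show (1 : ℝ) - (1 - 1 / α) = α⁻¹ by rw [one_div]; ring, subpowerEquiv_rpow_iff,
    subpowerEquiv_rpow_iff]
  refine Iff.trans ?_ (h.rpowEquiv_iff hα)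
  have hmu : ∀ᶠ ε in 𝓝[>] (0 : ℝ), L.mu t ε = (L.xPlus t ε - L.xMinus t ε) / Real.pi :=
    (eventually_mem_Ioc_zero one_pos).mono fun ε hε => L.mu_eq ht.1.le hε
  constructor
  · intro h1
    refine RpowEquiv.const_mul Real.pi_pos h1 (hmu.mono fun ε hε => ?_)
    rw [hε, mul_div_cancel₀ _ Real.pi_ne_zero]
  · intro h1
    refine RpowEquiv.const_mul (inv_pos.2 Real.pi_pos) h1 (hmu.mono fun ε hε => ?_)
    rw [hε, inv_mul_eq_div]

end LoewnerCurve

end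

theorem lemma2p8 (L : LoewnerCurve) (α : ℝ) (hα : 1 / 2 ≤ α) :
    L.thetaHm α = L.theta (1 - 1 / α) :=
  Set.ext fun _ => L.mem_thetaHm_iff (by linarith)
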